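/- Let $e,f,h$ be the standard basis of $\mathfrak{sl}_2(\mathbb{C})$ and $\langle x,y\rangle=\operatorname{tr}(xy)$. Let $$\hat{\mathfrak g}=h\otimes\mathbb{C}[t^{2},t^{-2}]\oplus\operatorname{span}\{e,f\}\otimes t\,\mathbb{C}[t^{2},t^{-2}]\oplus\mathbb{C}c\oplus\mathbb{C}d$$ be the twisted affine Lie algebra in which $c$ is central, $[x\otimes t^m,y\otimes t^n]=[x,y]\otimes t^{m+n}+\langle x,y\rangle\tfrac m2\delta_{m+n,0}\,c$ and $[d,x\otimes t^m]=m\,x\otimes t^m$. Put $B(n)=(e+f)\otimes t^n$ for odd $n$, $X(n)=(f-e)\otimes t^n$ for odd $n$, and $X(n)=h\otimes t^n$ for even $n$. Let $\mathfrak h=\mathbb{C}(h\otimes 1)\oplus\mathbb{C}c\oplus\mathbb{C}d$, and let $\mathfrak n_+$ be the span of the elements $x\in\hat{\mathfrak g}$ with $[d,x]=nx$ for some integer $n>0$. For $\Lambda\in\mathfrak h^*$ let $M(\Lambda)$ be the Verma module with highest weight $\Lambda$, i.e. the quotient of $U(\hat{\mathfrak g})$ by the left ideal generated by $\mathfrak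 n_+$ and all $y-\Lambda(y)$, $y\in\mathfrak h$, and let $v_\Lambda$ be the image of $1$. For $p\ge 1$ write $$\prod_{1\le k<l\le p}(\zeta_k\zeta_l)^{-1}(\zeta_k+\zeta_l)^2\;X(\zeta_1)\cdots X(\zeta_p)=\sum_{i_1,\dots,i_p\in\mathbb{Z}}f(i_1,\dots,i_p)\,\zeta_1^{i_1}\cdots\zeta_p^{i_p},\qquad X(\zeta)=\sum_{n\in\mathbb{Z}}X(n)\zeta^n,$$ with $f(i_1,\dots,i_p)\in U(\hat{\mathfrak g})$, and let the quasi-particle $X^{(p)}(n)$ act on $M(\Lambda)$ by $X^{(p)}(n)v=\sum_{i_1+\cdots+i_p=n}f(i_1,\dots,i_p)v$. Theorem 6.3. Let $\Lambda\in\mathfrak h^*$ with $\Lambda(d)=0$. Then for all $p\ge 1$, $n\in\mathbb{Z}$ and $v\in M(\Lambda)$ the sum defining $X^{(p)}(n)v$ has only finitely many nonzero terms, and the vectors $$B(i_1)\cdots B(i_r)\,X^{(p_1)}(j_1)\cdots X^{(p_s)}(j_s)\,v_\Lambda,$$ indexed by all $r,s\ge 0$ and all integers $i_1,\dots,i_r$,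 $p_1,\dots,p_s$, $j_1,\dots,j_s$ such that 1. $i_1\le\dots\le i_r\le -1$ and all $i_k$ are odd; 2. $1\le p_1\le\dots\le p_s$; 3. $j_s\le -p_s$ if $s\ge 1$; 4. $j_l\le -p_l-2p_l(s-l)$ whenever $1\le l<s$ and $p_l<p_{l+1}$; 5. $j_l\le j_{l+1}-2p_l$ whenever $1\le l<s$ and $p_l=p_{l+1}$, form a basis of the complex vector space $M(\Lambda)$ (the vectors of distinct indices being distinct). -/

import Mathlib

noncomputable section

namespace PrincipalSl2

/-! ### The loop algebra and its extension by `c` and `d` -/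

/-- The loop algebra `𝔤𝔩₂ ⊗ ℂ[t, t⁻¹]`, realised as Laurent polynomials in `t` whose coefficients are
`2 × 2` matrices. -/
abbrev Loop : Type := AddMonoidAlgebra (Matrix (Fin 2) (Fin 2) ℂ) ℤ

/-- The monomial `x ⊗ tⁿ`. -/
abbrev tm (n : ℤ) (x : Matrix (Fin 2) (Fin 2) ℂ) : Loop := AddMonoidAlgebra.single n x

/-- The degree derivation `D = t d/dt`, that is `D (x ⊗ tⁿ) = n x ⊗ tⁿ`. -/
def D : Loop →ₗ[ℂ] Loop where
  toFun a := AddMonoidAlgebra.ofCoeff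
    (Finsupp.onFinset a.coeff.support (fun n => (n : ℂ) • a.coeff n) (by
      intro n hn
      rw [Finsupp.mem_support_iff]
      rintro h
      exact hn (by simp [h])))
  map_add' a b := by
    ext n : 2
    simp [Finsupp.onFinset]
  map_smul' r a := by
    ext n : 2
    simp [Finsupp.onFinset, mul_left_comm]

theorem D_coeff (a : Loop) (n : ℤ) : (D a).coeff n = (n : ℂ) • a.coeff n := rfl

theorem D_tm (n : ℤ) (x : Matrix (Fin 2) (Fin 2) ℂ) : D (tm n x) = tm n ((n : ℂ) • x) := by
  ext m : 2
  rw [D_coeff]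
  simp only [tm, AddMonoidAlgebra.coeff_single, Finsupp.single_apply]
  split_ifs with h
  · rw [h]
  · simp

theorem D_mul (a b : Loop) : D (a * b) = D a * b + a * D b := by
  induction a using AddMonoidAlgebra.induction_linear with
  | zero => simp
  | add f g hf hg => rw [add_mul, map_add, hf, hg, map_add]; noncomm_ring
  | single m x =>
    induction b using AddMonoidAlgebra.induction_linear with
    | zero => simp
    | add f g hf hg => rw [mul_add, map_add, hf, hg, map_add]; noncomm_ring
    | single n y =>
      have h1 := D_tm m x
      have h2 := D_tm n y
      have h3 := D_tm (m + n) (x * y)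
      simp only [tm] at h1 h2 h3
      rw [AddMonoidAlgebra.single_mul_single, h1, h2, h3, AddMonoidAlgebra.single_mul_single,
        AddMonoidAlgebra.single_mul_single, ← AddMonoidAlgebra.single_add]
      congr 1
      push_cast
      rw [add_smul, smul_mul_assoc, mul_smul_comm]

/-- The trace of the coefficient of `t⁰`. -/
def tr0 : Loop →ₗ[ℂ] ℂ where
  toFun a := (a.coeff 0).trace
  map_add' a b := by simp
  map_smul' r a := by simp

theorem coeff_trace_mul_comm (a b : Loop) (n : ℤ) :
    ((a * b).coeff n).trace = ((b * a).coeff n).trace := by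
  induction a using AddMonoidAlgebra.induction_linear with
  | zero => simp
  | add f g hf hg => simp [add_mul, mul_add, hf, hg]
  | single m x =>
    induction b using AddMonoidAlgebra.induction_linear with
    | zero => simp
    | add f g hf hg =>
      simp only [mul_add, add_mul, AddMonoidAlgebra.coeff_add, Finsupp.add_apply,
        Matrix.trace_add, hf, hg]
    | single n' y =>
      rw [AddMonoidAlgebra.single_mul_single, AddMonoidAlgebra.single_mul_single, add_comm n' m]
      simp only [AddMonoidAlgebra.coeff_single, Finsupp.single_apply]
      split_ifs
      · exact Matrix.trace_mul_comm x y
      · rfl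

theorem tr0_mul_comm (a b : Loop) : tr0 (a * b) = tr0 (b * a) := coeff_trace_mul_comm a b 0

theorem tr0_D (a : Loop) : tr0 (D a) = 0 := by
  simp [tr0, D_coeff]

theorem tr0_D_mul (a b : Loop) : tr0 (D a * b) = - tr0 (a * D b) := by
  have h := tr0_D (a * b)
  rw [D_mul, map_add] at h
  exact eq_neg_of_add_eq_zero_left h

/-- The Lie algebra `𝔤𝔩₂ ⊗ ℂ[t, t⁻¹] ⊕ ℂ c ⊕ ℂ d`; an element is a triple
(loop part, coefficient of `c`, coefficient of `d`). -/
def Affine : Type := Loop × ℂ × ℂ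

namespace Affine

instance : AddCommGroup Affine := inferInstanceAs (AddCommGroup (Loop × ℂ × ℂ))

instance : Module ℂ Affine := inferInstanceAs (Module ℂ (Loop × ℂ × ℂ))

/-- The element `a + γ c + δ d`. -/
def mk (a : Loop) (γ δ : ℂ) : Affine := (a, γ, δ)

/-- The loop part. -/
def loop (x : Affine) : Loop := x.1

/-- The coefficient of `c`. -/
def cPart (x : Affine) : ℂ := x.2.1

/-- The coefficient of `d`. -/
def dPart (x : Affine) : ℂ := x.2.2

@[ext] theorem ext {x y : Affine} (h1 : x.loop = y.loop) (h2 : x.cPart = y.cPart)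
    (h3 : x.dPart = y.dPart) : x = y := Prod.ext h1 (Prod.ext h2 h3)

@[simp] theorem loop_mk (a : Loop) (γ δ : ℂ) : (mk a γ δ).loop = a := rfl
@[simp] theorem cPart_mk (a : Loop) (γ δ : ℂ) : (mk a γ δ).cPart = γ := rfl
@[simp] theorem dPart_mk (a : Loop) (γ δ : ℂ) : (mk a γ δ).dPart = δ := rfl
@[simp] theorem loop_add (x y : Affine) : (x + y).loop = x.loop + y.loop := rfl
@[simp] theorem cPart_add (x y : Affine) : (x + y).cPart = x.cPart + y.cPart := rfl
@[simp] theorem dPart_add (x y : Affine) : (x + y).dPart = x.dPart + y.dPart := rfl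
@[simp] theorem loop_smul (r : ℂ) (x : Affine) : (r • x).loop = r • x.loop := rfl
@[simp] theorem cPart_smul (r : ℂ) (x : Affine) : (r • x).cPart = r * x.cPart := rfl
@[simp] theorem dPart_smul (r : ℂ) (x : Affine) : (r • x).dPart = r * x.dPart := rfl
@[simp] theorem loop_zero : (0 : Affine).loop = 0 := rfl
@[simp] theorem cPart_zero : (0 : Affine).cPart = 0 := rfl
@[simp] theorem dPart_zero : (0 : Affine).dPart = 0 := rfl

/-- The bracket determined by `[x ⊗ tᵐ, y ⊗ tⁿ] = [x, y] ⊗ tᵐ⁺ⁿ + tr(x y) (m / 2) δ_{m+n,0} c`,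
`[d, x ⊗ tᵐ] = m x ⊗ tᵐ`, and `c` central. -/
instance : Bracket Affine Affine where
  bracket x y := mk
    (x.loop * y.loop - y.loop * x.loop + x.dPart • D y.loop - y.dPart • D x.loop)
    ((1 / 2 : ℂ) * tr0 (D x.loop * y.loop))
    0

@[simp] theorem loop_lie (x y : Affine) : ⁅x, y⁆.loop =
    x.loop * y.loop - y.loop * x.loop + x.dPart • D y.loop - y.dPart • D x.loop := rfl
@[simp] theorem cPart_lie (x y : Affine) :
    ⁅x, y⁆.cPart = (1 / 2 : ℂ) * tr0 (D x.loop * y.loop) := rfl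
@[simp] theorem dPart_lie (x y : Affine) : ⁅x, y⁆.dPart = 0 := rfl

instance : LieRing Affine where
  add_lie x y z := by
    ext1
    · simp only [loop_lie, loop_add, dPart_add, map_add, add_mul, mul_add, add_smul, smul_add]; abel
    · simp only [cPart_lie, cPart_add, loop_add, map_add, add_mul, mul_add]
    · simp
  lie_add x y z := by
    ext1
    · simp only [loop_lie, loop_add, dPart_add, map_add, add_mul, mul_add, add_smul, smul_add]; abel
    · simp only [cPart_lie, cPart_add, loop_add, map_add, mul_add]
    · simp
  lie_self x := by
    ext1
    · simp
    · have h := tr0_D_mul x.loop x.loop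
      rw [tr0_mul_comm x.loop] at h
      have h' : tr0 (D x.loop * x.loop) = 0 := self_eq_neg.mp h
      simp [h']
    · simp
  leibniz_lie x y z := by
    ext1
    · simp only [loop_lie, loop_add, dPart_lie, map_add, map_sub, map_smul, D_mul, mul_add, add_mul,
        mul_sub, sub_mul, smul_add, smul_sub, smul_mul_assoc, mul_smul_comm, zero_smul, sub_zero,
        add_zero, mul_assoc, smul_comm z.dPart, smul_comm y.dPart x.dPart]
      abel
    · obtain ⟨a, γ, δ, rfl⟩ : ∃ a γ δ, x = mk a γ δ := ⟨_, _, _, rfl⟩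
      obtain ⟨b, γ', δ', rfl⟩ : ∃ a γ δ, y = mk a γ δ := ⟨_, _, _, rfl⟩
      obtain ⟨e, γ'', δ'', rfl⟩ : ∃ a γ δ, z = mk a γ δ := ⟨_, _, _, rfl⟩
      have k1 := tr0_D_mul (D a) e
      have k2 := tr0_D_mul (D b) e
      have k3 := tr0_mul_comm (D a) (D b)
      have k4 := tr0_mul_comm b (D a * e)
      have k5 := tr0_mul_comm a (D b * e)
      simp only [mul_assoc] at k4 k5
      simp only [cPart_lie, cPart_add, loop_lie, loop_mk, dPart_mk, map_add, map_sub,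
        map_smul, D_mul, mul_add, add_mul, mul_sub, sub_mul, smul_mul_assoc, mul_smul_comm,
        smul_eq_mul, mul_assoc]
      linear_combination (1 / 2) * (δ' * k1 - δ * k2 - δ'' * k3 + k4 - k5)
    · simp

instance : LieAlgebra ℂ Affine where
  lie_smul r x y := by
    ext1
    · simp only [loop_lie, loop_smul, dPart_smul, map_smul, mul_smul_comm, smul_mul_assoc,
        smul_add, smul_sub, mul_smul, smul_comm x.dPart r]
    · simp only [cPart_lie, cPart_smul, loop_smul, mul_smul_comm, map_smul, smul_eq_mul]
      ring
    · simp

end Affine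

/-! ### The twisted affine Lie algebra -/

/-- The matrix `e`. -/
def e : Matrix (Fin 2) (Fin 2) ℂ := !![0, 1; 0, 0]

/-- The matrix `f`. -/
def f : Matrix (Fin 2) (Fin 2) ℂ := !![0, 0; 1, 0]

/-- The matrix `h`. -/
def h : Matrix (Fin 2) (Fin 2) ℂ := !![1, 0; 0, -1]

/-- `a` lies in `h ⊗ ℂ[t², t⁻²] ⊕ span {e, f} ⊗ t ℂ[t², t⁻²]`. -/
def IsTwisted (a : Loop) : Prop :=
  (∀ n : ℤ, Even n → a.coeff n ∈ Submodule.span ℂ {h}) ∧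
  (∀ n : ℤ, Odd n → a.coeff n ∈ Submodule.span ℂ {e, f})

theorem mem_span_h (x : Matrix (Fin 2) (Fin 2) ℂ) :
    x ∈ Submodule.span ℂ {h} ↔ x.trace = 0 ∧ x 0 1 = 0 ∧ x 1 0 = 0 := by
  rw [Submodule.mem_span_singleton]
  constructor
  · rintro ⟨r, rfl⟩
    simp [h, Matrix.trace_fin_two]
  · rintro ⟨h1, h2, h3⟩
    rw [Matrix.trace_fin_two] at h1
    refine ⟨x 0 0, ?_⟩
    ext i j
    fin_cases i <;> fin_cases j <;> simp [h, h2, h3]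
    linear_combination -h1

theorem mem_span_ef (x : Matrix (Fin 2) (Fin 2) ℂ) :
    x ∈ Submodule.span ℂ {e, f} ↔ x 0 0 = 0 ∧ x 1 1 = 0 := by
  rw [Submodule.mem_span_pair]
  constructor
  · rintro ⟨r, s, rfl⟩
    simp [e, f]
  · rintro ⟨h1, h2⟩
    refine ⟨x 0 1, x 1 0, ?_⟩
    ext i j
    fin_cases i <;> fin_cases j <;> simp [e, f, h1, h2]

theorem isTwisted_iff (a : Loop) : IsTwisted a ↔
    (∀ n i j, a.coeff n i j ≠ 0 → (i = j ↔ Even n)) ∧ ∀ n, (a.coeff n).trace = 0 := by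
  simp only [IsTwisted, mem_span_h, mem_span_ef]
  constructor
  · rintro ⟨h0, h1⟩
    constructor
    · intro n i j hne
      rcases Int.even_or_odd n with hn | hn
      · have := h0 n hn
        fin_cases i <;> fin_cases j <;> simp_all
      · have := h1 n hn
        have hn' : ¬ Even n := Int.not_even_iff_odd.mpr hn
        fin_cases i <;> fin_cases j <;> simp_all
    · intro n
      rcases Int.even_or_odd n with hn | hn
      · exact (h0 n hn).1
      · rw [Matrix.trace_fin_two, (h1 n hn).1, (h1 n hn).2, add_zero]
  · rintro ⟨h0, h1⟩
    refine ⟨fun n hn => ⟨h1 n, ?_, ?_⟩, fun n hn => ⟨?_, ?_⟩⟩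
    · by_contra hne; simpa [hn] using h0 n 0 1 hne
    · by_contra hne; simpa [hn] using h0 n 1 0 hne
    · by_contra hne; simpa [Int.not_even_iff_odd.mpr hn] using h0 n 0 0 hne
    · by_contra hne; simpa [Int.not_even_iff_odd.mpr hn] using h0 n 1 1 hne

theorem parity_mul {a b : Loop} (ha : ∀ n i j, a.coeff n i j ≠ 0 → (i = j ↔ Even n))
    (hb : ∀ n i j, b.coeff n i j ≠ 0 → (i = j ↔ Even n)) (n : ℤ) (i j : Fin 2)
    (hne : (a * b).coeff n i j ≠ 0) : i = j ↔ Even n := by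
  by_contra hcon
  apply hne
  rw [AddMonoidAlgebra.coeff_mul, Finsupp.sum, Matrix.sum_apply]
  refine Finset.sum_eq_zero fun m _ => ?_
  rw [Finsupp.sum, Matrix.sum_apply]
  refine Finset.sum_eq_zero fun l _ => ?_
  split_ifs with hml
  · subst hml
    rw [Matrix.mul_apply]
    refine Finset.sum_eq_zero fun k _ => ?_
    by_contra hk
    have h1 := ha m i k (left_ne_zero_of_mul hk)
    have h2 := hb l k j (right_ne_zero_of_mul hk)
    apply hcon
    rw [Int.even_add, ← h1, ← h2]
    fin_cases i <;> fin_cases j <;> fin_cases k <;> simp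
  · rfl

/-- The twisted affine Lie algebra
`h ⊗ ℂ[t², t⁻²] ⊕ span {e, f} ⊗ t ℂ[t², t⁻²] ⊕ ℂ c ⊕ ℂ d`. -/
def gHat : LieSubalgebra ℂ Affine where
  carrier := {x | IsTwisted x.loop}
  zero_mem' := by simp [IsTwisted]
  add_mem' {x y} hx hy :=
    ⟨fun n hn => Submodule.add_mem _ (hx.1 n hn) (hy.1 n hn),
      fun n hn => Submodule.add_mem _ (hx.2 n hn) (hy.2 n hn)⟩
  smul_mem' r x hx :=
    ⟨fun n hn => Submodule.smul_mem _ r (hx.1 n hn),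
      fun n hn => Submodule.smul_mem _ r (hx.2 n hn)⟩
  lie_mem' {x y} hx hy := by
    have key : IsTwisted (x.loop * y.loop - y.loop * x.loop) := by
      have hx' := (isTwisted_iff _).mp hx
      have hy' := (isTwisted_iff _).mp hy
      rw [isTwisted_iff]
      constructor
      · intro n i j hne
        by_contra hcon
        apply hne
        have h1 : (x.loop * y.loop).coeff n i j = 0 := by
          by_contra h1; exact hcon (parity_mul hx'.1 hy'.1 n i j h1)
        have h2 : (y.loop * x.loop).coeff n i j = 0 := by
          by_contra h2; exact hcon (parity_mul hy'.1 hx'.1 n i j h2)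
        simp [h1, h2]
      · intro n
        simp [coeff_trace_mul_comm x.loop y.loop n]
    have hD : ∀ (r : ℂ) (z : Affine), IsTwisted z.loop → IsTwisted (r • D z.loop) :=
      fun r z hz =>
      ⟨fun n hn => Submodule.smul_mem _ r (Submodule.smul_mem _ _ (hz.1 n hn)),
        fun n hn => Submodule.smul_mem _ r (Submodule.smul_mem _ _ (hz.2 n hn))⟩
    have h1 := hD x.dPart y hy
    have h2 := hD y.dPart x hx
    exact ⟨fun n hn => Submodule.sub_mem _ (Submodule.add_mem _ (key.1 n hn) (h1.1 n hn))
        (h2.1 n hn),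
      fun n hn => Submodule.sub_mem _ (Submodule.add_mem _ (key.2 n hn) (h1.2 n hn)) (h2.2 n hn)⟩

theorem isTwisted_zero : IsTwisted 0 := by simp [IsTwisted]

theorem isTwisted_even {n : ℤ} (hn : Even n) : IsTwisted (tm n h) := by
  refine ⟨fun m _ => ?_, fun m hm => ?_⟩
  · simp only [tm, AddMonoidAlgebra.coeff_single, Finsupp.single_apply]
    split_ifs
    · exact Submodule.mem_span_singleton_self h
    · exact Submodule.zero_mem _
  · have hne : n ≠ m := by rintro rfl; exact Int.not_even_iff_odd.mpr hm hn
    simp only [tm, AddMonoidAlgebra.coeff_single, Finsupp.single_apply, if_neg hne]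
    exact Submodule.zero_mem _

theorem isTwisted_odd {n : ℤ} (hn : Odd n) {x : Matrix (Fin 2) (Fin 2) ℂ}
    (hx : x ∈ Submodule.span ℂ {e, f}) : IsTwisted (tm n x) := by
  refine ⟨fun m hm => ?_, fun m _ => ?_⟩
  · have hne : n ≠ m := by rintro rfl; exact Int.not_even_iff_odd.mpr hn hm
    simp only [tm, AddMonoidAlgebra.coeff_single, Finsupp.single_apply, if_neg hne]
    exact Submodule.zero_mem _
  · simp only [tm, AddMonoidAlgebra.coeff_single, Finsupp.single_apply]
    split_ifs
    · exact hx
    · exact Submodule.zero_mem _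

/-- The central element `c`. -/
def c : gHat := ⟨Affine.mk 0 1 0, isTwisted_zero⟩

/-- The degree operator `d`. -/
def d : gHat := ⟨Affine.mk 0 0 1, isTwisted_zero⟩

/-- `B(n) = (e + f) ⊗ tⁿ` for odd `n`, and `B(n) = 0` for even `n`. -/
def B (n : ℤ) : gHat :=
  if hn : Odd n then
    ⟨Affine.mk (tm n (e + f)) 0 0, isTwisted_odd hn ((mem_span_ef _).mpr (by simp [e, f]))⟩
  else 0

/-- `X(n) = (f - e) ⊗ tⁿ` for odd `n`, and `X(n) = h ⊗ tⁿ` for even `n`. -/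
def X (n : ℤ) : gHat :=
  if hn : Odd n then
    ⟨Affine.mk (tm n (f - e)) 0 0, isTwisted_odd hn ((mem_span_ef _).mpr (by simp [e, f]))⟩
  else
    ⟨Affine.mk (tm n h) 0 0, isTwisted_even (Int.not_odd_iff_even.mp hn)⟩

/-! ### Verma modules -/

/-- The Cartan subalgebra `𝔥 = ℂ h ⊕ ℂ c ⊕ ℂ d`; note that `X 0 = h ⊗ 1`. -/
def cartan : Submodule ℂ gHat := Submodule.span ℂ {X 0, c, d}

/-- The element `d`, as an element of the Cartan subalgebra. -/
def dCartan : cartan := ⟨d, Submodule.subset_span (by simp)⟩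

/-- `𝔫₊`, the span of the homogeneous elements of positive degree, where `x` has degree `n` if
`[d, x] = n x`. -/
def nPlus : Submodule ℂ gHat :=
  Submodule.span ℂ {x | ∃ n : ℤ, 0 < n ∧ ⁅d, x⁆ = (n : ℂ) • x}

/-- The universal enveloping algebra of the twisted affine Lie algebra. -/
abbrev U : Type := UniversalEnvelopingAlgebra ℂ gHat

/-- The inclusion of the Lie algebra into its universal enveloping algebra. -/
abbrev inc (x : gHat) : U := UniversalEnvelopingAlgebra.ι ℂ x

/-- The left ideal of `U` generated by `𝔫₊` and by the elements `y - Λ(y)`, `y ∈ 𝔥`. -/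
def vermaIdeal (Λ : Module.Dual ℂ cartan) : Submodule U U :=
  Submodule.span U
    ({u | ∃ x ∈ nPlus, u = inc x} ∪ {u | ∃ y : cartan, u = inc y - algebraMap ℂ U (Λ y)})

/-- The Verma module `M(Λ)` with highest weight `Λ`. -/
abbrev Verma (Λ : Module.Dual ℂ cartan) : Type := U ⧸ vermaIdeal Λ

/-- The highest weight vector `v_Λ` of `M(Λ)`. -/
def hwVector (Λ : Module.Dual ℂ cartan) : Verma Λ := (vermaIdeal Λ).mkQ 1

/-! ### Quasi-particles -/

/-- Laurent polynomials in `ζ₁, …, ζ_p`. -/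
abbrev LaurentPoly (p : ℕ) : Type := AddMonoidAlgebra ℂ (Fin p → ℤ)

/-- The monomial `ζ_k ^ m`. -/
def zeta (p : ℕ) (k : Fin p) (m : ℤ) : LaurentPoly p := AddMonoidAlgebra.single (Pi.single k m) 1

/-- The Laurent polynomial `∏_{k < l} (ζ_k ζ_l)⁻¹ (ζ_k + ζ_l)²`. -/
def factorPoly (p : ℕ) : LaurentPoly p :=
  ∏ kl ∈ (Finset.univ : Finset (Fin p × Fin p)).filter (fun kl => kl.1 < kl.2),
    zeta p kl.1 (-1) * zeta p kl.2 (-1) * (zeta p kl.1 1 + zeta p kl.2 1) ^ 2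

/-- The coefficient of `ζ₁^{i₁} ⋯ ζ_p^{i_p}` in the formal Laurent series
`∏_{k < l} (ζ_k ζ_l)⁻¹ (ζ_k + ζ_l)² X(ζ₁) ⋯ X(ζ_p)`. -/
def qpCoeff (p : ℕ) (i : Fin p → ℤ) : U :=
  (factorPoly p).coeff.sum fun a r => r • (List.ofFn fun k => inc (X (i k - a k))).prod

/-- The action of the quasi-particle `X^{(p)}(n)` on `M(Λ)`: the coefficient of `ζⁿ` in
`lim_{ζ_k → ζ} ∏_{k < l} (ζ_k ζ_l)⁻¹ (ζ_k + ζ_l)² X(ζ₁) ⋯ X(ζ_p)`, that is, the sum of the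
coefficients with `i₁ + ⋯ + i_p = n`. -/
def quasi {Λ : Module.Dual ℂ cartan} (p : ℕ) (n : ℤ) (v : Verma Λ) : Verma Λ :=
  ∑ᶠ i ∈ {i : Fin p → ℤ | ∑ k, i k = n}, qpCoeff p i • v

/-- The conditions on the parameters of a basis vector. Here `bs = [i₁, …, i_r]` and
`qs = [(p₁, j₁), …, (p_s, j_s)]`; list positions start from `0`, so that the entry at position `l`
is `(p_{l+1}, j_{l+1})`. -/
structure Admissible (bs : List ℤ) (qs : List (ℕ × ℤ)) : Prop where
  bs_sorted : bs.Pairwise (· ≤ ·)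
  bs_odd : ∀ i ∈ bs, Odd i ∧ i ≤ -1
  charge_pos : ∀ q ∈ qs, 1 ≤ q.1
  charge_sorted : qs.Pairwise (fun q q' => q.1 ≤ q'.1)
  last_initial : ∀ q ∈ qs.getLast?, q.2 ≤ -(q.1 : ℤ)
  initial : ∀ (l : ℕ) (hl : l + 1 < qs.length), qs[l].1 < qs[l + 1].1 →
    qs[l].2 ≤ -(qs[l].1 : ℤ) - 2 * (qs[l].1 : ℤ) * ((qs.length : ℤ) - ((l : ℤ) + 1))
  difference : ∀ (l : ℕ) (hl : l + 1 < qs.length), qs[l].1 = qs[l + 1].1 →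
    qs[l].2 ≤ -2 * (qs[l].1 : ℤ) + qs[l + 1].2

/-- The index set of the basis. -/
abbrev BasisIndex : Type := {x : List ℤ × List (ℕ × ℤ) // Admissible x.1 x.2}

/-- The vector `B(i₁) ⋯ B(i_r) X^{(p₁)}(j₁) ⋯ X^{(p_s)}(j_s) v_Λ`. -/
def basisVector (Λ : Module.Dual ℂ cartan) (x : BasisIndex) : Verma Λ :=
  (x.1.1.map fun i => inc (B i)).prod •
    x.1.2.foldr (fun q v => quasi q.1 q.2 v) (hwVector Λ)

end PrincipalSl2

end

/-! The elements of nonnegative degree, with `c` and `d`, form a subalgebra complementary to the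
span of all B(n), X(n) with n < 0, and M(Λ) is induced from a character of it. By a
Poincaré–Birkhoff–Witt argument (`InducingData.rep`, `toPoly_injective`, `toPoly_surjective`) M(Λ)
becomes the polynomial ring in variables b_a, x_a standing for B(-(2a+1)), X(-(a+1)); an element
acts as multiplication by a linear form, up to terms of degree no larger than that of the polynomial
acted on.

In leading order the X(n) commute, and the Laurent factor enters only through its value at ζ = 1, a
power of 4. So the leading term of X^{(p)}(-p-N) is a nonzero multiple of the coefficient of ζ^N in
x(ζ)^p, where x(ζ) = Σ x_a ζ^a (`hasTop_quasi`). A homogeneous basis perturbed by lower terms stays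
a basis, so the theorem reduces to a commutative one: with j_l = -p_l - e_l, the products over l of
the coefficients of ζ^{e_l} in x(ζ)^{p_l}, for admissible (p, e), form a basis of ℂ[x_0, x_1, …].

Spanning (`span_poly`): a functional killing these products has a symmetric generating polynomial G.
Its specialisations, with variables set equal in clusters of sizes p_l, have as coefficients the
values of the functional on the products. If the specialisations at more concentrated clusterings
vanish, then, G being symmetric, the given one is divisible by ∏ (z_k - z_l)^{2 min(p_k, p_l)}; its
lexicographically leading exponent is then admissible, so it vanishes too. Descending to clusters of
size one gives G = 0.

Independence (`linearIndependent_poly`): in a relation take a term with Σ p_l² least, and then e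
lexicographically least. A functional built from squared differences of the boxes in each column of
the diagram with rows p_l separates this term from all others.

Finiteness (`finite_qpCoeff`): (ζ₁ + ζ₂)² annihilates [X(ζ₁), X(ζ₂)], so the coefficients f(i) act
symmetrically in the indices. They kill v once the last index is large, hence once any index is. -/

noncomputable section

/-! ### The degree filtration of a polynomial ring -/

namespace MvPolynomial

variable {R κ : Type*} [CommRing R]

/-- The polynomials all of whose monomials have degree less than `d`. -/
def degLT (R κ : Type*) [CommRing R] (d : ℕ) : Submodule R (MvPolynomial κ R) :=
  restrictSupport R {m | m.degree < d}

theorem monomial_mem_degLT {m : κ →₀ ℕ} {d : ℕ} (h : m.degree < d) (r : R) :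
    monomial m r ∈ degLT R κ d :=
  (monomial_mem_restrictSupport R).mpr (Or.inl h)

theorem degLT_eq_span (d : ℕ) :
    degLT R κ d = Submodule.span R ((monomial · 1) '' {m : κ →₀ ℕ | m.degree < d}) :=
  restrictSupport_eq_span R _

theorem degLT_mono {d d' : ℕ} (h : d ≤ d') : degLT R κ d ≤ degLT R κ d' :=
  restrictSupport_mono R fun _ hm => lt_of_lt_of_le hm h

theorem degLT_zero : degLT R κ 0 = ⊥ := by
  simp [degLT_eq_span]

theorem mem_degLT_iff {d : ℕ} {f : MvPolynomial κ R} :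
    f ∈ degLT R κ d ↔ ∀ m, coeff m f ≠ 0 → m.degree < d := by
  simp only [degLT, mem_restrictSupport_iff, Set.subset_def, Finset.mem_coe, mem_support_iff,
    Set.mem_ofPred_eq]

theorem exists_mem_degLT (f : MvPolynomial κ R) : ∃ d, f ∈ degLT R κ d := by
  refine ⟨f.support.sup Finsupp.degree + 1, mem_degLT_iff.mpr fun m hm => ?_⟩
  exact Nat.lt_succ_of_le (Finset.le_sup (f := Finsupp.degree) (mem_support_iff.mpr hm))

theorem one_mem_degLT : (1 : MvPolynomial κ R) ∈ degLT R κ 1 :=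
  monomial_mem_degLT (by simp) 1

theorem X_mem_degLT (i : κ) : (X i : MvPolynomial κ R) ∈ degLT R κ 2 :=
  monomial_mem_degLT (by simp) 1

/-- The bound is strict, so only one factor carries the shift by one; this form still covers b = 0.
-/
theorem mul_mem_degLT {a b : ℕ} {f g : MvPolynomial κ R} (hf : f ∈ degLT R κ (a + 1))
    (hg : g ∈ degLT R κ b) : f * g ∈ degLT R κ (a + b) := by
  classical
  rw [mem_degLT_iff] at hf hg ⊢
  intro m hm
  rw [coeff_mul] at hm
  obtain ⟨x, hx, hne⟩ := Finset.exists_ne_zero_of_sum_ne_zero hm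
  have h1 := hf _ (left_ne_zero_of_mul hne)
  have h2 := hg _ (right_ne_zero_of_mul hne)
  rw [← Finset.HasAntidiagonal.mem_antidiagonal.mp hx, map_add]
  omega

theorem degLT_induction {M : Type*} [AddCommGroup M] [Module R M] {d : ℕ}
    (φ ψ : MvPolynomial κ R →ₗ[R] M)
    (h : ∀ m : κ →₀ ℕ, m.degree < d → φ (monomial m 1) = ψ (monomial m 1))
    {f : MvPolynomial κ R} (hf : f ∈ degLT R κ d) : φ f = ψ f := by
  rw [degLT_eq_span] at hf
  refine LinearMap.eqOn_span ?_ hf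
  rintro _ ⟨m, hm, rfl⟩
  exact h m hm

end MvPolynomial

/-! ### Modules induced from a one-dimensional module of a subalgebra

A Poincaré–Birkhoff–Witt theorem for the module induced from a character of the subalgebra
`ker coord`, which is complementary to the span of the vectors `vec i`. -/

open MvPolynomial

attribute [local instance] LieRing.ofAssociativeRing

/-- A Lie algebra with a family of vectors `vec i`, coordinates along it whose common kernel is a
subalgebra, and a character of that subalgebra. -/
structure InducingData (R L κ : Type*) [CommRing R] [LieRing L] [LieAlgebra R L] where
  /-- The vectors complementary to the subalgebra. -/
  vec : κ → L
  /-- The coordinates. -/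
  coord : L →ₗ[R] κ →₀ R
  /-- The character, extended by zero on the vectors `vec i`. -/
  char : L →ₗ[R] R
  coord_vec : ∀ i, coord (vec i) = Finsupp.single i 1
  char_vec : ∀ i, char (vec i) = 0
  coord_lie : ∀ x y, coord x = 0 → coord y = 0 → coord ⁅x, y⁆ = 0
  char_lie : ∀ x y, coord x = 0 → coord y = 0 → char ⁅x, y⁆ = 0

namespace InducingData

variable {R L κ : Type*} [CommRing R] [LieRing L] [LieAlgebra R L]
  (T : InducingData R L κ)

/-- The linear polynomial with coefficients the coordinates of `x`. -/
def top : L →ₗ[R] MvPolynomial κ R := Finsupp.linearCombination R X ∘ₗ T.coord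

@[simp] theorem top_vec (i : κ) : T.top (T.vec i) = X i := by
  simp [top, T.coord_vec]

theorem top_mem (x : L) : T.top x ∈ degLT R κ 2 := by
  rw [top, LinearMap.comp_apply, Finsupp.linearCombination_apply]
  exact Submodule.sum_mem _ fun i _ => Submodule.smul_mem _ _ (X_mem_degLT i)

variable [LinearOrder κ]

/-- The component of `x` along the `vec i` with `i ≤ k` is removed. -/
def gt (k : κ) : L →ₗ[R] L :=
  LinearMap.id - Finsupp.linearCombination R (fun i => if i ≤ k then T.vec i else 0) ∘ₗ T.coord

theorem gt_vec (k i : κ) : T.gt k (T.vec i) = if i ≤ k then 0 else T.vec i := by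
  simp only [gt, LinearMap.sub_apply, LinearMap.id_apply, LinearMap.comp_apply, T.coord_vec,
    Finsupp.linearCombination_single, one_smul]
  split_ifs <;> simp

theorem coord_gt (k : κ) (x : L) (i : κ) :
    T.coord (T.gt k x) i = if i ≤ k then 0 else T.coord x i := by
  classical
  simp only [gt, LinearMap.sub_apply, LinearMap.id_apply, LinearMap.comp_apply, map_sub,
    Finsupp.linearCombination_apply, Finsupp.sum, map_sum, map_smul, Finsupp.sub_apply]
  have : ∀ j, T.coord (if j ≤ k then T.vec j else 0) = if j ≤ k then Finsupp.single j 1 else 0 := by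
    intro j
    split_ifs
    · exact T.coord_vec j
    · exact map_zero _
  simp only [this, Finsupp.coe_finsetSum, Finset.sum_apply, Finsupp.smul_apply, smul_eq_mul]
  by_cases hi : T.coord x i = 0
  · rw [hi, Finset.sum_eq_zero]
    · simp
    · intro j _
      split_ifs
      · rw [Finsupp.single_apply]
        split_ifs with h
        · subst h; simp [hi]
        · simp
      · simp
  · rw [Finset.sum_eq_single_of_mem i (Finsupp.mem_support_iff.mpr hi)]
    · split_ifs <;> simp
    · intro j _ hj
      split_ifs <;> simp [hj]

theorem mem_span_of_sub_gt (k : κ) (x : L) :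
    x - T.gt k x ∈ Submodule.span R (T.vec '' {i | i ≤ k}) := by
  simp only [gt, LinearMap.sub_apply, LinearMap.id_apply, LinearMap.comp_apply, sub_sub_cancel,
    Finsupp.linearCombination_apply]
  refine Submodule.sum_mem _ fun i _ => Submodule.smul_mem _ _ ?_
  split_ifs with h
  · exact Submodule.subset_span ⟨i, h, rfl⟩
  · exact Submodule.zero_mem _

/-- A linear statement holds for `x` if it holds for `gt k x` and for all `vec i` with `i ≤ k`. -/
theorem eq_of_gt {M : Type*} [AddCommGroup M] [Module R M] (φ ψ : L →ₗ[R] M) (k : κ) (x : L)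
    (h1 : φ (T.gt k x) = ψ (T.gt k x)) (h2 : ∀ i ≤ k, φ (T.vec i) = ψ (T.vec i)) : φ x = ψ x := by
  have h3 : φ (x - T.gt k x) = ψ (x - T.gt k x) := by
    refine LinearMap.eqOn_span ?_ (T.mem_span_of_sub_gt k x)
    rintro _ ⟨i, hi, rfl⟩
    exact h2 i hi
  rw [map_sub, map_sub, h1] at h3
  exact sub_left_injective h3

-- The algebra is the direct sum of the kernel of `coord` and the span of the `vec i`.
omit [LinearOrder κ] in
theorem eq_of_coord {M : Type*} [AddCommGroup M] [Module R M] (φ ψ : L →ₗ[R] M) (x : L)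
    (h1 : ∀ y, T.coord y = 0 → φ y = ψ y) (h2 : ∀ i, φ (T.vec i) = ψ (T.vec i)) : φ x = ψ x := by
  have h : T.coord (x - Finsupp.linearCombination R T.vec (T.coord x)) = 0 := by
    rw [map_sub, sub_eq_zero, Finsupp.linearCombination_apply, Finsupp.sum, map_sum]
    simp only [map_smul, T.coord_vec, Finsupp.smul_single, smul_eq_mul, mul_one]
    exact (Finsupp.sum_single (T.coord x)).symm
  have h3 := h1 _ h
  rw [map_sub, map_sub] at h3
  have h4 : φ (Finsupp.linearCombination R T.vec (T.coord x)) =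
      ψ (Finsupp.linearCombination R T.vec (T.coord x)) := by
    simp only [Finsupp.linearCombination_apply, Finsupp.sum, map_sum, map_smul, h2]
  rw [h4] at h3
  exact sub_left_injective h3

/-- `x ↦ top x * f`. -/
def mulTop (f : MvPolynomial κ R) : L →ₗ[R] MvPolynomial κ R :=
  LinearMap.mulRight R f ∘ₗ T.top

omit [LinearOrder κ] in
@[simp] theorem mulTop_apply (f : MvPolynomial κ R) (x : L) : T.mulTop f x = T.top x * f := rfl

/-- The lower order part of the action of a vector on the monomial `m`, in terms of an action `A` on
polynomials of smaller degree. -/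
def lower (A : MvPolynomial κ R →ₗ[R] L →ₗ[R] MvPolynomial κ R) (m : κ →₀ ℕ) :
    L →ₗ[R] MvPolynomial κ R :=
  if h : m.support.Nonempty then
    let k := m.support.min' h
    let f : MvPolynomial κ R := monomial (m - Finsupp.single k 1) 1
    -- This is x·(z_k f) = z_k·(x·f) + [x, z_k]·f with the leading term removed. Components of x
    -- along `vec i`, i ≤ k, act by multiplication alone and are discarded by `gt`, so `A` is needed
    -- only in degrees below that of m.
    A.flip (T.vec k) ∘ₗ (A f - T.mulTop f) ∘ₗ T.gt k - A f ∘ₗ (LieAlgebra.ad R L (T.vec k)) ∘ₗ T.gt k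
  else (Algebra.linearMap R _) ∘ₗ T.char

/-- The action of `L` on polynomials of degree at most `d`. -/
def preAct : ℕ → MvPolynomial κ R →ₗ[R] L →ₗ[R] MvPolynomial κ R
  -- Only the monomial 1 matters at this stage, and there `lower` returns the character; values on
  -- other monomials do not enter `act`, so the zero action can be passed.
  | 0 => (basisMonomials κ R).constr R fun m => T.mulTop (monomial m 1) + T.lower 0 m
  | d + 1 => (basisMonomials κ R).constr R fun m =>
      if m.degree ≤ d then preAct d (monomial m 1)
      else T.mulTop (monomial m 1) + T.lower (preAct d) m

/-- The action of `L` on polynomials. -/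
def act : MvPolynomial κ R →ₗ[R] L →ₗ[R] MvPolynomial κ R :=
  (basisMonomials κ R).constr R fun m => T.preAct m.degree (monomial m 1)

omit [LinearOrder κ] in
theorem constr_monomial {M : Type*} [AddCommGroup M] [Module R M] (φ : (κ →₀ ℕ) → M)
    (m : κ →₀ ℕ) : (basisMonomials κ R).constr R φ (monomial m 1) = φ m := by
  have := (basisMonomials κ R).constr_basis R φ m
  rwa [coe_basisMonomials] at this

theorem preAct_eq_act (d : ℕ) {f : MvPolynomial κ R} (hf : f ∈ degLT R κ (d + 1)) :
    T.preAct d f = T.act f := by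
  refine degLT_induction _ _ (fun m hm => ?_) hf
  rw [act, constr_monomial]
  clear hf
  induction d with
  | zero => rw [show m.degree = 0 by omega]
  | succ d ih =>
    by_cases h : m.degree ≤ d
    · rw [preAct, constr_monomial, if_pos h]
      exact ih (by omega)
    · rw [show m.degree = d + 1 by omega]

theorem act_one (x : L) : T.act 1 x = T.top x + C (T.char x) := by
  have : (1 : MvPolynomial κ R) = monomial 0 1 := rfl
  rw [this, act, constr_monomial, show (0 : κ →₀ ℕ).degree = 0 from map_zero _, preAct,
    constr_monomial]
  simp [lower, algebraMap_eq]

/-- `k` is at most all variables of `m`. -/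
def IsLow (k : κ) (m : κ →₀ ℕ) : Prop := ∀ i ∈ m.support, k ≤ i

theorem IsLow.add {k i : κ} {m : κ →₀ ℕ} (h : IsLow k m) (hi : k ≤ i) :
    IsLow k (Finsupp.single i 1 + m) := by
  classical
  intro j hj
  rcases Finset.mem_union.mp (Finsupp.support_add hj) with h1 | h1
  · rw [Finsupp.support_single _ one_ne_zero, Finset.mem_singleton] at h1
    rwa [h1]
  · exact h j h1

theorem exists_isLow (m : κ →₀ ℕ) : m = 0 ∨ ∃ k m', IsLow k m' ∧ m = Finsupp.single k 1 + m' := by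
  classical
  rcases m.support.eq_empty_or_nonempty with h | h
  · exact Or.inl (Finsupp.support_eq_empty.mp h)
  · refine Or.inr ⟨m.support.min' h, m - Finsupp.single (m.support.min' h) 1, fun i hi => ?_, ?_⟩
    · exact Finset.min'_le _ _ (Finsupp.support_tsub hi)
    · rw [add_tsub_cancel_of_le]
      rw [Finsupp.single_le_iff, Nat.one_le_iff_ne_zero]
      exact Finsupp.mem_support_iff.mp (Finset.min'_mem _ h)

theorem lower_single_add (A : MvPolynomial κ R →ₗ[R] L →ₗ[R] MvPolynomial κ R) {k : κ}
    {m : κ →₀ ℕ} (h : IsLow k m) (x : L) :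
    T.lower A (Finsupp.single k 1 + m) x =
      A (A (monomial m 1) (T.gt k x) - T.top (T.gt k x) * monomial m 1) (T.vec k) +
        A (monomial m 1) ⁅T.gt k x, T.vec k⁆ := by
  have hs : (Finsupp.single k 1 + m).support.Nonempty :=
    ⟨k, by simp⟩
  have hk : (Finsupp.single k 1 + m).support.min' hs = k := by
    refine le_antisymm (Finset.min'_le _ _ (by simp)) ?_
    exact (h.add le_rfl) _ (Finset.min'_mem _ _)
  rw [lower, dif_pos hs]
  simp only [hk, add_tsub_cancel_left, LinearMap.sub_apply, LinearMap.comp_apply,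
    LinearMap.flip_apply, LieAlgebra.ad_apply, mulTop_apply]
  rw [← lie_skew (T.vec k), map_neg, sub_neg_eq_add]

omit [LinearOrder κ] in
theorem degree_single_add (k : κ) (m : κ →₀ ℕ) :
    (Finsupp.single k 1 + m).degree = m.degree + 1 := by
  rw [map_add, Finsupp.degree_single, add_comm]

/-- Beyond `top x * m` the recursion acts once or twice on polynomials of degree one lower, and the
inner one of two actions has its leading term subtracted. So the associated graded action is
multiplication by linear forms. -/
theorem preAct_sub_mem (d : ℕ) (m : κ →₀ ℕ) (hm : m.degree ≤ d) (x : L) :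
    T.preAct d (monomial m 1) x - T.top x * monomial m 1 ∈ degLT R κ (m.degree + 1) := by
  induction d generalizing m x with
  | zero =>
    obtain rfl : m = 0 := (Finsupp.degree_eq_zero_iff m).mp (by omega)
    rw [preAct, constr_monomial]
    simp only [lower, Finsupp.support_zero, Finset.not_nonempty_empty, dite_false,
      LinearMap.add_apply, mulTop_apply, add_sub_cancel_left]
    exact monomial_mem_degLT (by simp) _
  | succ d ih =>
    by_cases h : m.degree ≤ d
    · rw [T.preAct_eq_act (d + 1) (monomial_mem_degLT (by omega) 1),
        ← T.preAct_eq_act d (monomial_mem_degLT (by omega) 1)]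
      exact ih m h x
    · rw [preAct, constr_monomial, if_neg h, LinearMap.add_apply, mulTop_apply, add_sub_cancel_left]
      have ih' : ∀ (f : MvPolynomial κ R) (e : ℕ), f ∈ degLT R κ (e + 1) → e ≤ d → ∀ x,
          T.preAct d f x ∈ degLT R κ (e + 2) := by
        intro f e hf he x
        rw [degLT_eq_span] at hf
        induction hf using Submodule.span_induction with
        | mem f hf =>
          obtain ⟨m, hm, rfl⟩ := hf
          have hm' : m.degree < e + 1 := hm
          have h1 := degLT_mono (by omega : m.degree + 1 ≤ e + 2) (ih m (by omega) x)
          have h2 : T.top x * monomial m 1 ∈ degLT R κ (1 + (e + 1)) :=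
            mul_mem_degLT (T.top_mem x) (monomial_mem_degLT (by omega) _)
          rw [show 1 + (e + 1) = e + 2 by ring] at h2
          simpa using Submodule.add_mem _ h1 h2
        | zero => simp
        | add f g _ _ hf hg => rw [map_add]; exact Submodule.add_mem _ hf hg
        | smul r f _ hf => rw [map_smul]; exact Submodule.smul_mem _ r hf
      rcases exists_isLow m with rfl | ⟨k, m, hk, rfl⟩
      · simp at h
      · rw [degree_single_add] at hm h ⊢
        rw [lower_single_add _ _ hk]
        refine Submodule.add_mem _ ?_ ?_
        · exact ih' _ m.degree (ih m (by omega) _) (by omega) _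
        · exact ih' _ m.degree (monomial_mem_degLT (by omega) _) (by omega) _

theorem act_sub_mem {d : ℕ} {f : MvPolynomial κ R} (hf : f ∈ degLT R κ d) (x : L) :
    T.act f x - T.top x * f ∈ degLT R κ d := by
  rw [degLT_eq_span] at hf
  induction hf using Submodule.span_induction with
  | mem f hf =>
    obtain ⟨m, hm, rfl⟩ := hf
    have hm' : m.degree < d := hm
    have h := T.preAct_sub_mem m.degree m le_rfl x
    rw [T.preAct_eq_act _ (monomial_mem_degLT (by omega) 1)] at h
    exact degLT_mono (by omega) h
  | zero => simp
  | add f g _ _ hf hg =>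
    rw [map_add, mul_add, LinearMap.add_apply, add_sub_add_comm]
    exact Submodule.add_mem _ hf hg
  | smul r f _ hf =>
    rw [map_smul, mul_smul_comm, LinearMap.smul_apply, ← smul_sub]
    exact Submodule.smul_mem _ r hf

theorem act_single_add {k : κ} {m : κ →₀ ℕ} (h : IsLow k m) (x : L) :
    T.act (monomial (Finsupp.single k 1 + m) 1) x =
      T.top x * monomial (Finsupp.single k 1 + m) 1 +
      T.act (T.act (monomial m 1) (T.gt k x) - T.top (T.gt k x) * monomial m 1) (T.vec k) +
        T.act (monomial m 1) ⁅T.gt k x, T.vec k⁆ := by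
  have hm : (monomial m (1 : R)) ∈ degLT R κ (m.degree + 1) := monomial_mem_degLT (by omega) 1
  rw [act, constr_monomial, degree_single_add, preAct, constr_monomial, if_neg (by
    rw [degree_single_add]; omega), LinearMap.add_apply, lower_single_add _ _ h, mulTop_apply,
    T.preAct_eq_act m.degree hm, T.preAct_eq_act m.degree (T.act_sub_mem hm _), add_assoc]
  rfl

/-- For the least variable k of m one has i ≤ k, so `gt k` kills `vec i` and both correction terms
of the recursion vanish. -/
theorem act_vec_of_isLow {i : κ} {m : κ →₀ ℕ} (h : IsLow i m) :
    T.act (monomial m 1) (T.vec i) = monomial (Finsupp.single i 1 + m) 1 := by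
  have hX : X i * monomial m (1 : R) = monomial (Finsupp.single i 1 + m) 1 := by
    rw [X, monomial_mul, one_mul]
  rcases exists_isLow m with rfl | ⟨k, m, hk, rfl⟩
  · have := T.act_one (T.vec i)
    rw [T.char_vec, map_zero, add_zero, top_vec] at this
    rw [← hX]
    exact this.trans (mul_one _).symm
  · have hik : i ≤ k := h k (by simp)
    rw [T.act_single_add hk, T.gt_vec, if_pos hik]
    simp [hX]

theorem top_gt_mul_monomial (k : κ) (x : L) (m : κ →₀ ℕ) :
    T.top (T.gt k x) * monomial m 1 ∈ Submodule.span R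
      ((fun i => monomial (Finsupp.single i 1 + m) (1 : R)) '' {i | k < i}) := by
  rw [top, LinearMap.comp_apply, Finsupp.linearCombination_apply, Finsupp.sum, Finset.sum_mul]
  refine Submodule.sum_mem _ fun i hi => ?_
  rw [smul_mul_assoc, X, monomial_mul, one_mul]
  refine Submodule.smul_mem _ _ (Submodule.subset_span ⟨i, ?_, rfl⟩)
  rw [Finsupp.mem_support_iff, coord_gt] at hi
  by_contra hle
  exact hi (if_pos (not_lt.mp hle))

/-- The leading part of `gt k x` involves only variables above k, so multiplying m by it leaves k
low, and `vec k` acts on the result by multiplication. The recursion thereby becomes an exact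
commutation rule. -/
theorem act_gt {k : κ} {m : κ →₀ ℕ} (h : IsLow k m) (x : L) :
    T.act (monomial (Finsupp.single k 1 + m) 1) (T.gt k x) =
      T.act (T.act (monomial m 1) (T.gt k x)) (T.vec k) +
        T.act (monomial m 1) ⁅T.gt k x, T.vec k⁆ := by
  have hgt : T.gt k (T.gt k x) = T.gt k x := by
    refine T.eq_of_gt (T.gt k ∘ₗ T.gt k) (T.gt k) k x ?_ fun i hi => ?_
    · have : ∀ y, (∀ i ≤ k, T.coord y i = 0) → T.gt k y = y := by
        intro y hy
        rw [gt, LinearMap.sub_apply, LinearMap.id_apply, LinearMap.comp_apply,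
          Finsupp.linearCombination_apply, Finsupp.sum, Finset.sum_eq_zero, sub_zero]
        intro i _
        split_ifs with hi
        · rw [hy i hi, zero_smul]
        · rw [smul_zero]
      have h0 : T.gt k (T.gt k x) = T.gt k x :=
        this _ fun i hi => by rw [coord_gt, if_pos hi]
      rw [LinearMap.comp_apply, h0, h0]
    · rw [LinearMap.comp_apply, gt_vec, if_pos hi, map_zero]
  have key : T.act (T.top (T.gt k x) * monomial m 1) (T.vec k) =
      T.top (T.gt k x) * monomial (Finsupp.single k 1 + m) 1 := by
    have : ∀ f ∈ Submodule.span R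
      ((fun i => monomial (Finsupp.single i 1 + m) (1 : R)) '' {i | k < i}),
        T.act.flip (T.vec k) f = LinearMap.mulLeft R (X k) f := by
      intro f hf
      refine LinearMap.eqOn_span ?_ hf
      rintro _ ⟨i, hi, rfl⟩
      rw [LinearMap.flip_apply, T.act_vec_of_isLow (h.add (le_of_lt hi)), LinearMap.mulLeft_apply,
        X, monomial_mul, one_mul]
    have h2 := this _ (T.top_gt_mul_monomial k x m)
    rw [LinearMap.flip_apply, LinearMap.mulLeft_apply] at h2
    rw [h2, mul_left_comm, X, monomial_mul, one_mul]
  rw [T.act_single_add h, hgt, map_sub, LinearMap.sub_apply, key]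
  abel

/-- The commutation relation with a vector `vec j` which precedes all variables of `m`. -/
theorem act_comm_of_isLow {j : κ} {m : κ →₀ ℕ} (h : IsLow j m) (z : L) :
    T.act (T.act (monomial m 1) (T.vec j)) z =
      T.act (T.act (monomial m 1) z) (T.vec j) + T.act (monomial m 1) ⁅z, T.vec j⁆ := by
  rw [T.act_vec_of_isLow h]
  refine T.eq_of_gt (T.act (monomial (Finsupp.single j 1 + m) 1))
    (T.act.flip (T.vec j) ∘ₗ T.act (monomial m 1) -
      T.act (monomial m 1) ∘ₗ (LieAlgebra.ad R L (T.vec j))) j z ?_ (fun i hi => ?_) |>.trans ?_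
  · rw [T.act_gt h]
    simp only [LinearMap.sub_apply, LinearMap.comp_apply, LinearMap.flip_apply,
      LieAlgebra.ad_apply]
    rw [← lie_skew (T.vec j), map_neg, sub_neg_eq_add]
  · simp only [LinearMap.sub_apply, LinearMap.comp_apply, LinearMap.flip_apply,
      LieAlgebra.ad_apply]
    have hi' : IsLow i m := fun l hl => hi.trans (h l hl)
    rw [T.act_vec_of_isLow hi', T.act_vec_of_isLow (m := Finsupp.single j 1 + m)
      fun l hl => hi.trans ((h.add le_rfl) l hl)]
    rcases hi.eq_or_lt with rfl | hlt
    · rw [lie_self, map_zero, sub_zero, T.act_vec_of_isLow (h.add le_rfl)]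
    · have h1 := T.act_gt hi' (T.vec j)
      rw [T.gt_vec, if_neg (not_le.mpr hlt)] at h1
      rw [h1, add_sub_cancel_right, T.act_vec_of_isLow h, T.act_vec_of_isLow (hi'.add hi)]
  · simp only [LinearMap.sub_apply, LinearMap.comp_apply, LinearMap.flip_apply,
      LieAlgebra.ad_apply]
    rw [← lie_skew (T.vec j), map_neg, sub_neg_eq_add]

theorem act_ker_one {x : L} (h : T.coord x = 0) : T.act 1 x = C (T.char x) := by
  rw [act_one, top, LinearMap.comp_apply, h, map_zero, zero_add]

/-- The defect of the action from being a Lie algebra action. -/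
def defect (f : MvPolynomial κ R) : L →ₗ[R] L →ₗ[R] MvPolynomial κ R :=
  LinearMap.mk₂ R (fun x y => T.act (T.act f y) x - T.act (T.act f x) y - T.act f ⁅x, y⁆)
    (by intros; simp only [map_add, LinearMap.add_apply, add_lie]; abel)
    (by intros; simp only [map_smul, LinearMap.smul_apply, smul_lie, smul_sub])
    (by intros; simp only [map_add, LinearMap.add_apply, lie_add]; abel)
    (by intros; simp only [map_smul, LinearMap.smul_apply, lie_smul, smul_sub])

theorem defect_apply (f : MvPolynomial κ R) (x y : L) :
    T.defect f x y = T.act (T.act f y) x - T.act (T.act f x) y - T.act f ⁅x, y⁆ := rfl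

theorem defect_swap (f : MvPolynomial κ R) (x y : L) : T.defect f x y = - T.defect f y x := by
  rw [defect_apply, defect_apply, ← lie_skew x y, map_neg]
  abel

theorem defect_vec_right {j : κ} {m : κ →₀ ℕ} (h : IsLow j m) (z : L) :
    T.defect (monomial m 1) z (T.vec j) = 0 := by
  rw [defect_apply, T.act_comm_of_isLow h]
  abel

theorem defect_vec_left {j : κ} {m : κ →₀ ℕ} (h : IsLow j m) (z : L) :
    T.defect (monomial m 1) (T.vec j) z = 0 := by
  rw [defect_swap, T.defect_vec_right h, neg_zero]

/-- Induction on degree. On constants everything reduces to the character vanishing on brackets of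
the subalgebra. On z_k m both arguments may be replaced by their `gt k` parts, because the relation
with `vec i`, i ≤ k, is known; what remains cancels by the Jacobi identity. -/
theorem defect_eq_zero (d : ℕ) {f : MvPolynomial κ R} (hf : f ∈ degLT R κ d) (x y : L) :
    T.act (T.act f y) x = T.act (T.act f x) y + T.act f ⁅x, y⁆ := by
  induction d generalizing f x y with
  | zero =>
    rw [degLT_zero, Submodule.mem_bot] at hf
    simp [hf]
  | succ d ih =>
    refine degLT_induction (T.act.flip x ∘ₗ T.act.flip y)
      (T.act.flip y ∘ₗ T.act.flip x + T.act.flip ⁅x, y⁆) (fun m hm => ?_) hf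
    simp only [LinearMap.comp_apply, LinearMap.add_apply, LinearMap.flip_apply]
    suffices h : T.defect (monomial m 1) x y = 0 by
      rw [defect_apply, sub_sub, sub_eq_zero] at h
      exact h
    rcases exists_isLow m with rfl | ⟨k, m, hk, rfl⟩
    · have hlow : ∀ i, IsLow i (0 : κ →₀ ℕ) := fun i => by simp [IsLow]
      refine T.eq_of_coord (T.defect (monomial 0 1) x) 0 y (fun y hy => ?_)
        fun i => T.defect_vec_right (hlow i) x
      refine T.eq_of_coord ((T.defect (monomial 0 1)).flip y) 0 x (fun x hx => ?_)
        fun i => T.defect_vec_left (hlow i) y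
      have h1 : (monomial (0 : κ →₀ ℕ) (1 : R)) = 1 := rfl
      rw [LinearMap.flip_apply, defect_apply, h1, T.act_ker_one hx, T.act_ker_one hy,
        T.act_ker_one (T.coord_lie x y hx hy), T.char_lie x y hx hy, ← mul_one (C _),
        ← mul_one (C (T.char x)), ← smul_eq_C_mul, ← smul_eq_C_mul, map_smul, map_smul,
        LinearMap.smul_apply, LinearMap.smul_apply, T.act_ker_one hx, T.act_ker_one hy,
        smul_eq_C_mul, smul_eq_C_mul, mul_comm, map_zero, sub_self, sub_zero]
      rfl
    · have hk' : IsLow k (Finsupp.single k 1 + m) := hk.add le_rfl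
      rw [degree_single_add] at hm
      have hmd : (monomial m (1 : R)) ∈ degLT R κ d := monomial_mem_degLT (by omega) 1
      have step : ∀ x y, T.act (T.act (monomial (Finsupp.single k 1 + m) 1) (T.gt k y)) x =
          T.act (T.act (T.act (monomial m 1) (T.gt k y)) x) (T.vec k) +
          T.act (T.act (monomial m 1) (T.gt k y)) ⁅x, T.vec k⁆ +
          (T.act (T.act (monomial m 1) x) ⁅T.gt k y, T.vec k⁆ +
          T.act (monomial m 1) ⁅x, ⁅T.gt k y, T.vec k⁆⁆) := by
        intro x y
        rw [T.act_gt hk, map_add, LinearMap.add_apply]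
        congr 1
        -- Commutation with `vec k` is needed here on a polynomial one degree too high for the
        -- induction hypothesis. Its leading part is spanned by monomials z_i m with i > k, where
        -- `act_comm_of_isLow` applies; the remainder `g` is within reach of the induction.
        · obtain ⟨g, hg⟩ : ∃ g, g = T.act (monomial m 1) (T.gt k y) - T.top (T.gt k y) * monomial m 1 :=
            ⟨_, rfl⟩
          have hg' : g ∈ degLT R κ d := hg ▸ T.act_sub_mem hmd _
          rw [sub_eq_iff_eq_add.mp hg.symm]
          have h1 := ih hg' x (T.vec k)
          have h2 : ∀ f ∈ Submodule.span R
              ((fun i => monomial (Finsupp.single i 1 + m) (1 : R)) '' {i | k < i}),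
              (T.act.flip x ∘ₗ T.act.flip (T.vec k)) f =
              (T.act.flip (T.vec k) ∘ₗ T.act.flip x + T.act.flip ⁅x, T.vec k⁆) f := by
            intro f hf
            refine LinearMap.eqOn_span ?_ hf
            rintro _ ⟨i, hi, rfl⟩
            exact T.act_comm_of_isLow (hk.add (le_of_lt hi)) x
          have h3 := h2 _ (T.top_gt_mul_monomial k y m)
          simp only [LinearMap.comp_apply, LinearMap.add_apply, LinearMap.flip_apply] at h3
          simp only [map_add, LinearMap.add_apply, h1, h3]
          abel
        · exact ih hmd x _
      refine T.eq_of_gt (T.defect (monomial (Finsupp.single k 1 + m) 1) x) 0 k y ?_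
        fun i hi => T.defect_vec_right (fun l hl => hi.trans (hk' l hl)) x
      rw [defect_swap, LinearMap.zero_apply, neg_eq_zero]
      refine T.eq_of_gt (T.defect (monomial (Finsupp.single k 1 + m) 1) (T.gt k y)) 0 k x ?_
        fun i hi => T.defect_vec_right (fun l hl => hi.trans (hk' l hl)) _
      rw [defect_swap, LinearMap.zero_apply, neg_eq_zero]
      have h1 := step (T.gt k x) y
      have h2 := step (T.gt k y) x
      have h3 := T.act_comm_of_isLow hk ⁅T.gt k x, T.gt k y⁆
      have h4 := ih hmd (T.gt k x) (T.gt k y)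
      rw [T.act_vec_of_isLow hk] at h3
      rw [defect_apply, h1, h2, h3]
      generalize T.gt k x = a at *
      generalize T.gt k y = b at *
      rw [h4, map_add, LinearMap.add_apply, lie_lie a b, map_sub]
      abel

/-- The module on polynomials induced from the character. -/
def rep : L →ₗ⁅R⁆ Module.End R (MvPolynomial κ R) :=
  { toLinearMap := T.act.flip
    map_lie' := by
      intro x y
      refine LinearMap.ext fun f => ?_
      obtain ⟨d, hd⟩ := exists_mem_degLT f
      change T.act f ⁅x, y⁆ = T.act (T.act f y) x - T.act (T.act f x) y
      rw [T.defect_eq_zero d hd x y]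
      abel }

theorem rep_apply (x : L) (f : MvPolynomial κ R) : T.rep x f = T.act f x := rfl

theorem rep_sub_mem {d : ℕ} {f : MvPolynomial κ R} (hf : f ∈ degLT R κ d) (x : L) :
    T.rep x f - T.top x * f ∈ degLT R κ d := T.act_sub_mem hf x

theorem rep_one {x : L} (h : T.coord x = 0) :
    T.rep x (1 : MvPolynomial κ R) = C (T.char x) :=
  T.act_ker_one h

/-- The linear map to a module with a vector on which the subalgebra acts by the character. -/
def toModule {M : Type*} [AddCommGroup M] [Module R M] (φ : L →ₗ⁅R⁆ Module.End R M) (v : M) :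
    MvPolynomial κ R →ₗ[R] M :=
  (basisMonomials κ R).constr R fun m =>
    (m.toMultiset.sort (· ≤ ·)).foldr (fun i w => φ (T.vec i) w) v

/-! ### Universal property of the induced module -/

section ToModule

variable {M : Type*} [AddCommGroup M] [Module R M] (φ : L →ₗ⁅R⁆ Module.End R M) (v : M)

theorem toModule_one : T.toModule φ v 1 = v := by
  have : (1 : MvPolynomial κ R) = monomial 0 1 := rfl
  rw [this, toModule, constr_monomial]
  simp

theorem toModule_single_add {k : κ} {m : κ →₀ ℕ} (h : IsLow k m) :
    T.toModule φ v (monomial (Finsupp.single k 1 + m) 1) =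
      φ (T.vec k) (T.toModule φ v (monomial m 1)) := by
  rw [toModule, constr_monomial, constr_monomial, map_add, Finsupp.toMultiset_single, one_smul,
    Multiset.singleton_add, Multiset.sort_cons, List.foldr_cons]
  exact fun b hb => h b ((Finsupp.mem_toMultiset m b).mp hb)

/-- The rules that determine the action on polynomials hold in `M` as well: `vec k` with k lowest
prepends a letter, and `gt k x` passes it at the cost of a bracket. This map later serves as a left
inverse of `toPoly`. -/
theorem toModule_rep (hv : ∀ x, T.coord x = 0 → φ x v = T.char x • v) (x : L)
    (f : MvPolynomial κ R) : T.toModule φ v (T.rep x f) = φ x (T.toModule φ v f) := by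
  obtain ⟨d, hd⟩ := exists_mem_degLT f
  induction d generalizing f x with
  | zero =>
    rw [degLT_zero, Submodule.mem_bot] at hd
    simp [hd]
  | succ d ih =>
    refine degLT_induction (T.toModule φ v ∘ₗ T.rep x) (φ x ∘ₗ T.toModule φ v) (fun m hm => ?_) hd
    simp only [LinearMap.comp_apply]
    rcases exists_isLow m with rfl | ⟨k, m, hk, rfl⟩
    · have h1 : (monomial (0 : κ →₀ ℕ) (1 : R)) = 1 := rfl
      refine T.eq_of_coord (T.toModule φ v ∘ₗ T.act (monomial 0 1))
        ((φ : L →ₗ[R] Module.End R M).flip (T.toModule φ v (monomial 0 1))) x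
        (fun x hx => ?_) fun i => ?_
      · rw [LinearMap.comp_apply, h1, T.act_ker_one hx, LinearMap.flip_apply, toModule_one,
          ← mul_one (C _), ← smul_eq_C_mul, map_smul, toModule_one]
        exact (hv x hx).symm
      · rw [LinearMap.comp_apply, T.act_vec_of_isLow (by simp [IsLow]),
          toModule_single_add _ _ _ (by simp [IsLow])]
        rfl
    · rw [degree_single_add] at hm
      have hmd : (monomial m (1 : R)) ∈ degLT R κ d := monomial_mem_degLT (by omega) 1
      refine T.eq_of_gt (T.toModule φ v ∘ₗ T.act (monomial (Finsupp.single k 1 + m) 1))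
        ((φ : L →ₗ[R] Module.End R M).flip (T.toModule φ v (monomial (Finsupp.single k 1 + m) 1)))
        k x ?_ fun i hi => ?_
      · have hcomm : ∀ f ∈ Submodule.span R
            ((fun i => monomial (Finsupp.single i 1 + m) (1 : R)) '' {i | k < i}),
            (T.toModule φ v ∘ₗ T.act.flip (T.vec k)) f = (φ (T.vec k) ∘ₗ T.toModule φ v) f := by
          intro f hf
          refine LinearMap.eqOn_span ?_ hf
          rintro _ ⟨i, hi, rfl⟩
          have hi' := hk.add (le_of_lt hi)
          rw [LinearMap.comp_apply, LinearMap.flip_apply, T.act_vec_of_isLow hi',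
            toModule_single_add _ _ _ hi']
          rfl
        have h1 := hcomm _ (T.top_gt_mul_monomial k x m)
        have h2 := ih (T.vec k) _ (T.act_sub_mem hmd (T.gt k x))
        have h3 := ih ⁅T.gt k x, T.vec k⁆ _ hmd
        have h4 := ih (T.gt k x) _ hmd
        rw [rep_apply] at h2 h3 h4
        simp only [LinearMap.comp_apply, LinearMap.flip_apply] at h1
        have h5 : T.toModule φ v (T.act (T.act (monomial m 1) (T.gt k x)) (T.vec k)) =
            φ (T.vec k) (T.toModule φ v (T.act (monomial m 1) (T.gt k x))) := by
          rw [← sub_add_cancel (T.act (monomial m 1) (T.gt k x))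
            (T.top (T.gt k x) * monomial m 1), map_add, LinearMap.add_apply, map_add, map_add,
            map_add, h1, h2]
        rw [LinearMap.comp_apply, T.act_gt hk, map_add, h5, h3, h4, LinearMap.flip_apply,
          toModule_single_add _ _ _ hk]
        have h6 : φ ⁅T.gt k x, T.vec k⁆ = φ (T.gt k x) * φ (T.vec k) - φ (T.vec k) * φ (T.gt k x) := by
          rw [LieHom.map_lie]; rfl
        rw [h6]
        simp
      · have hi' : IsLow i (Finsupp.single k 1 + m) :=
          fun l hl => hi.trans ((hk.add le_rfl) l hl)
        rw [LinearMap.comp_apply, T.act_vec_of_isLow hi', toModule_single_add _ _ _ hi']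
        rfl

end ToModule

end InducingData

/-! ### Products over pairs -/

/-- A symmetric factor depends only on the unordered pair, and σ permutes unordered pairs; the
bijection sorts the image pair. -/
theorem Finset.prod_lt_comp_perm {ι M : Type*} [Fintype ι] [LinearOrder ι] [CommMonoid M]
    (F : ι → ι → M) (hF : ∀ a b, F a b = F b a) (σ : Equiv.Perm ι) :
    ∏ q : ι × ι with q.1 < q.2, F (σ q.1) (σ q.2) = ∏ q : ι × ι with q.1 < q.2, F q.1 q.2 := by
  refine Finset.prod_bij' (fun q _ => if σ q.1 < σ q.2 then (σ q.1, σ q.2) else (σ q.2, σ q.1))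
    (fun q _ => if σ.symm q.1 < σ.symm q.2 then (σ.symm q.1, σ.symm q.2)
      else (σ.symm q.2, σ.symm q.1)) ?_ ?_ ?_ ?_ ?_
  · rintro ⟨a, b⟩ hab
    simp only [Finset.mem_filter, Finset.mem_univ, true_and] at hab ⊢
    split_ifs with h
    · exact h
    · exact lt_of_le_of_ne (not_lt.mp h) fun h' => hab.ne' (σ.injective h')
  · rintro ⟨a, b⟩ hab
    simp only [Finset.mem_filter, Finset.mem_univ, true_and] at hab ⊢
    split_ifs with h
    · exact h
    · exact lt_of_le_of_ne (not_lt.mp h) fun h' => hab.ne' (σ.symm.injective h')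
  · rintro ⟨a, b⟩ hab
    simp only [Finset.mem_filter, Finset.mem_univ, true_and] at hab
    split_ifs with h h' h' <;> simp_all [not_lt.mpr hab.le]
  · rintro ⟨a, b⟩ hab
    simp only [Finset.mem_filter, Finset.mem_univ, true_and] at hab
    split_ifs with h h' h' <;> simp_all [not_lt.mpr hab.le]
  · rintro ⟨a, b⟩ _
    dsimp only
    split_ifs
    · rfl
    · exact hF _ _

/-! ### Renaming variables -/

namespace MvPolynomial

variable {T ι : Type*} [Fintype T] [DecidableEq T]

/-- The exponents which `τ` maps to `e`. -/
def fiberExponents (τ : T → ι) (e : ι →₀ ℕ) : Finset (T →₀ ℕ) := by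
  classical
  exact (Finset.finsuppAntidiag Finset.univ e.degree).filter fun i => i.mapDomain τ = e

theorem mem_finsuppAntidiag_univ {n : ℕ} {i : T →₀ ℕ} :
    i ∈ Finset.finsuppAntidiag Finset.univ n ↔ i.degree = n := by
  rw [Finset.mem_finsuppAntidiag, Finsupp.degree_eq_sum]
  simp

@[simp] theorem mem_fiberExponents {τ : T → ι} {e : ι →₀ ℕ} {i : T →₀ ℕ} :
    i ∈ fiberExponents τ e ↔ i.mapDomain τ = e := by
  classical
  rw [fiberExponents, Finset.mem_filter, mem_finsuppAntidiag_univ, and_iff_right_iff_imp]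
  rintro rfl
  exact (Finsupp.degree_mapDomain τ i).symm

theorem coeff_rename_eq_sum {R : Type*} [CommSemiring R] (τ : T → ι) (G : MvPolynomial T R)
    (e : ι →₀ ℕ) : coeff e (rename τ G) = ∑ i ∈ fiberExponents τ e, coeff i G := by
  classical
  induction G using MvPolynomial.induction_on' with
  | monomial m r =>
    rw [rename_monomial, coeff_monomial]
    simp only [coeff_monomial, Finset.sum_ite_eq, mem_fiberExponents]
  | add p q hp hq => simp only [map_add, coeff_add, hp, hq, Finset.sum_add_distrib]

theorem rename_comp_apply {R : Type*} [CommSemiring R] {σ τ υ : Type*} (f : σ → τ) (g : τ → υ)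
    (p : MvPolynomial σ R) : rename g (rename f p) = rename (fun x => g (f x)) p :=
  rename_rename f g p

end MvPolynomial

/-! ### The commutative problem: a basis of `ℂ[x₀, x₁, …]` -/

namespace QuasiParticle

open MvPolynomial

/-! ### Coefficients of powers of the generating function -/

/-- The monomial `∏ x_{i t}`. -/
def word {T : Type*} [Fintype T] (i : T → ℕ) : MvPolynomial ℕ ℂ := ∏ t, X (i t)

theorem word_comp_equiv {T T' : Type*} [Fintype T] [Fintype T'] (ε : T' ≃ T) (i : T → ℕ) :
    word (fun t => i (ε t)) = word i :=
  Equiv.prod_comp ε fun t => (X (i t) : MvPolynomial ℕ ℂ)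

/-- The multiplicities of the values of `i`. -/
def content {T : Type*} [Fintype T] (i : T → ℕ) : ℕ →₀ ℕ := ∑ t, Finsupp.single (i t) 1

theorem word_eq_monomial {T : Type*} [Fintype T] (i : T → ℕ) : word i = monomial (content i) 1 := by
  rw [word, content, monomial_sum_one]
  rfl

theorem content_comp_equiv {T T' : Type*} [Fintype T] [Fintype T'] (ε : T' ≃ T) (i : T → ℕ) :
    content (fun t => i (ε t)) = content i :=
  Equiv.sum_comp ε fun t => Finsupp.single (i t) 1

theorem content_apply {T : Type*} [Fintype T] (i : T → ℕ) (a : ℕ) :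
    content i a = Fintype.card {t // i t = a} := by
  classical
  rw [content, Finsupp.finsetSum_apply, Fintype.card_subtype, Finset.card_filter]
  exact Finset.sum_congr rfl fun t _ => by rw [Finsupp.single_apply]

/-- The fibres over each value are equinumerous, and bijections between them glue. This makes
`dualFun` independent of the word chosen for a monomial. -/
theorem exists_equiv_of_content_eq {T T' : Type*} [Fintype T] [Fintype T'] {i : T → ℕ}
    {j : T' → ℕ} (h : content i = content j) : ∃ ε : T ≃ T', ∀ t, j (ε t) = i t := by
  classical
  have h' : ∀ a, Nonempty ({t // i t = a} ≃ {t // j t = a}) := fun a =>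
    ⟨Fintype.equivOfCardEq (by rw [← content_apply, ← content_apply, h])⟩
  exact ⟨Equiv.ofFiberEquiv fun a => (h' a).some, fun t => Equiv.ofFiberEquiv_map _ t⟩

/-- The coefficient of `ζⁿ` in `(∑ x_a ζ^a) ^ p`. -/
def powCoeff (p n : ℕ) : MvPolynomial ℕ ℂ :=
  ∑ i ∈ Finset.piAntidiag (Finset.univ : Finset (Fin p)) n, word i

/-- The boxes of a diagram with rows of lengths `c l`. -/
abbrev Box {ι : Type*} (c : ι → ℕ) : Type _ := Σ l, Fin (c l)

theorem mapDomain_fst_apply {ι : Type*} [Fintype ι] (c : ι → ℕ)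
    (i : Box c →₀ ℕ) (l : ι) : i.mapDomain Sigma.fst l = ∑ k, i ⟨l, k⟩ := by
  classical
  rw [Finsupp.mapDomain, Finsupp.sum_fintype _ _ (by simp), Finsupp.finsetSum_apply,
    Fintype.sum_sigma, Finset.sum_eq_single l]
  · simp
  · intro l' _ h
    exact Finset.sum_eq_zero fun k _ => by simp [h]
  · simp

/-- Expanding the product assigns an exponent to every box, with the exponents of row l adding up to
`e l`. -/
theorem prod_powCoeff {ι : Type*} [Fintype ι] [DecidableEq ι] (c : ι → ℕ) (e : ι →₀ ℕ) :
    ∏ l, powCoeff (c l) (e l) = ∑ i ∈ fiberExponents (Sigma.fst : Box c → ι) e, word i := by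
  simp only [powCoeff]
  rw [Finset.prod_univ_sum]
  refine Finset.sum_bij' (fun i _ => Finsupp.equivFunOnFinite.symm fun b : Box c => i b.1 b.2)
    (fun i _ l k => i ⟨l, k⟩) ?_ ?_ ?_ ?_ ?_
  · intro i hi
    rw [mem_fiberExponents]
    ext l
    rw [mapDomain_fst_apply]
    exact (Finset.mem_piAntidiag.mp (Fintype.mem_piFinset.mp hi l)).1
  · intro i hi
    rw [mem_fiberExponents] at hi
    refine Fintype.mem_piFinset.mpr fun l => Finset.mem_piAntidiag.mpr ⟨?_, by simp⟩
    rw [← hi, mapDomain_fst_apply]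
  · intros; rfl
  · intros; ext; rfl
  · intro i _
    simp only [word, Fintype.prod_sigma]
    rfl

/-! ### The polynomial attached to a linear functional -/

variable {T : Type*} [Fintype T] [DecidableEq T]

/-- The part of degree `n` of the generating function of the values of `g` on words. -/
def genPoly (g : MvPolynomial ℕ ℂ →ₗ[ℂ] ℂ) (T : Type*) [Fintype T] [DecidableEq T] (n : ℕ) :
    MvPolynomial T ℂ :=
  ∑ i ∈ Finset.finsuppAntidiag Finset.univ n, monomial i (g (word i))

theorem coeff_genPoly (g : MvPolynomial ℕ ℂ →ₗ[ℂ] ℂ) (n : ℕ) (i : T →₀ ℕ) :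
    coeff i (genPoly g T n) = if i.degree = n then g (word i) else 0 := by
  simp only [genPoly, coeff_sum, coeff_monomial, Finset.sum_ite_eq', mem_finsuppAntidiag_univ]

theorem rename_genPoly (g : MvPolynomial ℕ ℂ →ₗ[ℂ] ℂ) (n : ℕ) {T' : Type*} [Fintype T']
    [DecidableEq T'] (ε : T ≃ T') : rename ε (genPoly g T n) = genPoly g T' n := by
  ext i
  obtain ⟨j, rfl⟩ : ∃ j : T →₀ ℕ, j.mapDomain ε = i :=
    ⟨i.mapDomain ε.symm, by rw [← Finsupp.mapDomain_comp]; simp⟩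
  rw [coeff_rename_mapDomain _ ε.injective, coeff_genPoly, coeff_genPoly, Finsupp.degree_mapDomain,
    ← word_comp_equiv ε]
  simp only [Finsupp.mapDomain_apply ε.injective]

/-- Setting variables equal adds exponents within clusters, so coefficients collect into powers of
the generating function. Vanishing of `g` on products thus becomes vanishing of coefficients of a
specialisation. -/
theorem coeff_rename_genPoly {ι : Type*} [Fintype ι] [DecidableEq ι]
    (g : MvPolynomial ℕ ℂ →ₗ[ℂ] ℂ) (n : ℕ) (τ : T → ι) (c : ι → ℕ)
    (hc : ∀ l, Fintype.card {t // τ t = l} = c l) (e : ι →₀ ℕ) :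
    coeff e (rename τ (genPoly g T n)) =
      if e.degree = n then g (∏ l, powCoeff (c l) (e l)) else 0 := by
  obtain ⟨ε, hε⟩ : ∃ ε : Box c ≃ T, ∀ b, τ (ε b) = b.1 := by
    refine ⟨(Equiv.sigmaCongrRight fun l =>
      (Fintype.equivFinOfCardEq (hc l)).symm).trans (Equiv.sigmaFiberEquiv τ), fun b => ?_⟩
    exact ((Fintype.equivFinOfCardEq (hc b.1)).symm b.2).2
  rw [← rename_genPoly g n ε, rename_comp_apply]
  simp only [hε]
  rw [coeff_rename_eq_sum, prod_powCoeff, map_sum]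
  split_ifs with h
  · refine Finset.sum_congr rfl fun i hi => ?_
    rw [mem_fiberExponents] at hi
    rw [coeff_genPoly, if_pos]
    rw [← h, ← hi, Finsupp.degree_mapDomain]
  · refine Finset.sum_eq_zero fun i hi => ?_
    rw [mem_fiberExponents] at hi
    rw [coeff_genPoly, if_neg]
    rwa [← hi, Finsupp.degree_mapDomain] at h

end QuasiParticle

namespace MvPolynomial

/-! ### Divisibility by differences of variables -/

section Merge

variable {σ : Type*} [DecidableEq σ]

/-- The map which sends `u` to `l` and fixes everything else. -/
def merge (u l : σ) : σ → σ := Function.update id u l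

theorem merge_self (u l : σ) : merge u l u = l := Function.update_self _ _ _

theorem merge_of_ne {u l x : σ} (h : x ≠ u) : merge u l x = x := Function.update_of_ne h _ _

/-- Modulo X u - X l the substitution `merge u l` is the identity, so whatever it kills is zero in
the quotient. -/
theorem X_sub_X_dvd_iff {u l : σ} (P : MvPolynomial σ ℂ) :
    X u - X l ∣ P ↔ rename (merge u l) P = 0 := by
  constructor
  · rintro ⟨Q, rfl⟩
    rw [map_mul, map_sub, rename_X, rename_X, merge_self]
    by_cases h : l = u
    · rw [h, merge_self, sub_self, zero_mul]
    · rw [merge_of_ne h, sub_self, zero_mul]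
  · intro h
    rw [← Ideal.mem_span_singleton, ← Ideal.Quotient.eq_zero_iff_mem]
    have key : (Ideal.Quotient.mkₐ ℂ (Ideal.span {(X u - X l : MvPolynomial σ ℂ)})).comp
        (rename (merge u l)) = Ideal.Quotient.mkₐ ℂ _ := by
      ext x
      simp only [AlgHom.comp_apply, rename_X]
      by_cases hx : x = u
      · rw [hx, merge_self, eq_comm]
        refine Ideal.Quotient.eq.mpr (Ideal.mem_span_singleton_self _)
      · rw [merge_of_ne hx]
    have := congrArg (fun φ => φ P) key
    simp only [AlgHom.comp_apply, h, map_zero] at this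
    exact this.symm

omit [DecidableEq σ] in
theorem X_sub_X_ne_zero {u l : σ} (h : u ≠ l) : (X u - X l : MvPolynomial σ ℂ) ≠ 0 :=
  sub_ne_zero.mpr fun h' => h (X_injective h')

theorem prime_X_sub_X {u l : σ} (h : u ≠ l) : Prime (X u - X l : MvPolynomial σ ℂ) := by
  refine ⟨X_sub_X_ne_zero h, fun hu => ?_, fun P Q hPQ => ?_⟩
  · have h1 : rename (merge u l) (1 : MvPolynomial σ ℂ) = 0 :=
      (X_sub_X_dvd_iff 1).mp hu.dvd
    rw [map_one] at h1
    exact one_ne_zero h1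
  · simp only [X_sub_X_dvd_iff, map_mul, mul_eq_zero] at hPQ ⊢
    exact hPQ

theorem isRelPrime_X_sub_X {a b c d : σ} (hab : a ≠ b) (h : merge a b c ≠ merge a b d) :
    IsRelPrime (X a - X b : MvPolynomial σ ℂ) (X c - X d) := by
  rw [(prime_X_sub_X hab).irreducible.isRelPrime_iff_not_dvd, X_sub_X_dvd_iff, map_sub, rename_X,
    rename_X]
  exact X_sub_X_ne_zero h

end Merge

theorem pderiv_rename_eq_sum {T ι : Type*} [Fintype T] [DecidableEq ι] (τ : T → ι)
    (G : MvPolynomial T ℂ) (l : ι) :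
    pderiv l (rename τ G) = ∑ t with τ t = l, rename τ (pderiv t G) := by
  classical
  induction G using MvPolynomial.induction_on with
  | C a => simp
  | add p q hp hq => simp only [map_add, hp, hq, Finset.sum_add_distrib]
  | mul_X p t hp =>
    rw [map_mul, rename_X, Derivation.leibniz, hp, pderiv_X]
    simp only [Derivation.leibniz, pderiv_X, map_add, smul_eq_mul, map_mul, rename_X,
      Finset.sum_add_distrib, Finset.mul_sum]
    congr 1
    rw [← Finset.mul_sum]
    congr 1
    simp only [Pi.single_apply]
    by_cases h : τ t = l
    · rw [if_pos h, Finset.sum_eq_single_of_mem t (by simp [h])]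
      · simp
      · intro b _ hb; simp [hb.symm]
    · rw [if_neg h, Finset.sum_eq_zero]
      intro b hb
      have : t ≠ b := by rintro rfl; exact h (Finset.mem_filter.mp hb).2
      simp [this]

end MvPolynomial

namespace QuasiParticle

open MvPolynomial

/-! ### Symmetric polynomials and clusters of variables -/

section Clusters

variable {T : Type} [Fintype T] [DecidableEq T]

/-- The size of the fibre of `τ` over `l`. -/
def fiberCard {ι : Type*} [DecidableEq ι] (τ : T → ι) (l : ι) : ℕ := Fintype.card {t // τ t = l}

omit [DecidableEq T] in
theorem fiberCard_eq {ι : Type*} [DecidableEq ι] (τ : T → ι) (l : ι) :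
    fiberCard τ l = (Finset.univ.filter fun t => τ t = l).card := Fintype.card_subtype _

/-- A convex function of the sizes of the fibres. -/
def potential {ι : Type*} [DecidableEq ι] (τ : T → ι) : ℕ := ∑ t, 3 ^ fiberCard τ (τ t)

omit [DecidableEq T] in
theorem potential_le {ι : Type*} [DecidableEq ι] (τ : T → ι) :
    potential τ ≤ Fintype.card T * 3 ^ Fintype.card T := by
  refine (Finset.sum_le_card_nsmul _ _ (3 ^ Fintype.card T) fun t _ => ?_).trans ?_
  · exact Nat.pow_le_pow_right (by norm_num) (Fintype.card_subtype_le _)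
  · simp

/-- The fibre over `l'` is dissolved into single points, and `u` is moved to the fibre over `l`. -/
def moveTo {ι : Type*} [DecidableEq ι] (τ : T → ι) (l l' : ι) (u : T) : T → ι ⊕ T :=
  fun t => if t = u then Sum.inl l else if τ t = l' then Sum.inr t else Sum.inl (τ t)

/-- With c, c' the sizes over l, l': the enlarged fibre contributes 3^(c+1) for the new point and
gains 2·3^c for each of the c old ones, while dissolving the other loses at most c'·3^c' ≤ c·3^c. -/
theorem potential_lt_moveTo {ι : Type*} [DecidableEq ι] (τ : T → ι) {l l' : ι} (h : l ≠ l')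
    (hc : fiberCard τ l' ≤ fiberCard τ l) (u : T) (hu : τ u = l') :
    potential τ < potential (moveTo τ l l' u) := by
  have hfib : fiberCard (moveTo τ l l' u) (Sum.inl l) = fiberCard τ l + 1 := by
    rw [fiberCard_eq, fiberCard_eq, ← Finset.card_insert_of_notMem (a := u) (by simp [hu, h.symm])]
    congr 1
    ext t
    simp only [moveTo, Finset.mem_filter, Finset.mem_univ, true_and, Finset.mem_insert]
    by_cases h1 : t = u
    · simp [h1]
    · by_cases h2 : τ t = l'
      · simp [h1, h2, h.symm]
      · simp [h1, h2]
  have hfib' : ∀ x, x ≠ l → x ≠ l' →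
      fiberCard (moveTo τ l l' u) (Sum.inl x) = fiberCard τ x := by
    intro x hx hx'
    rw [fiberCard_eq, fiberCard_eq]
    congr 1
    ext t
    rw [Finset.mem_filter, Finset.mem_filter]
    simp only [moveTo, Finset.mem_univ, true_and]
    by_cases h1 : t = u
    · simp [h1, hu, hx.symm, hx'.symm]
    · by_cases h2 : τ t = l'
      · simp [h1, h2, hx'.symm]
      · simp [h1, h2]
  have hA : ∀ t, 3 ^ fiberCard τ (τ t) + (if t = u then 3 ^ (fiberCard τ l + 1) else 0) +
      (if τ t = l then 2 * 3 ^ fiberCard τ l else 0) ≤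
      3 ^ fiberCard (moveTo τ l l' u) (moveTo τ l l' u t) +
        if τ t = l' then 3 ^ fiberCard τ l' else 0 := by
    intro t
    by_cases h1 : t = u
    · subst h1
      rw [if_pos rfl, if_neg (by rw [hu]; exact h.symm), if_pos hu, hu]
      simp only [moveTo, if_true]
      rw [hfib]
      omega
    · by_cases h2 : τ t = l'
      · simp [h1, h2, h.symm]
      · have hm : moveTo τ l l' u t = Sum.inl (τ t) := by simp [moveTo, h1, h2]
        rw [hm, if_neg h1, if_neg h2]
        by_cases h3 : τ t = l
        · rw [if_pos h3, h3, hfib, pow_succ]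
          omega
        · rw [if_neg h3, hfib' _ h3 h2]
  have hS := Finset.sum_le_sum fun t (_ : t ∈ Finset.univ) => hA t
  simp only [Finset.sum_add_distrib, Finset.sum_ite, Finset.sum_const, smul_eq_mul, mul_zero,
    add_zero,
    Finset.filter_eq', Finset.mem_univ, if_true,
    Finset.card_singleton, one_mul, ← fiberCard_eq] at hS
  have h3 : fiberCard τ l' * 3 ^ fiberCard τ l' ≤ fiberCard τ l * 3 ^ fiberCard τ l :=
    Nat.mul_le_mul hc (Nat.pow_le_pow_right (by norm_num) hc)
  have h4 : 0 < 3 ^ (fiberCard τ l + 1) := by positivity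
  have h5 : fiberCard τ l * (2 * 3 ^ fiberCard τ l) = 2 * (fiberCard τ l * 3 ^ fiberCard τ l) := by
    ring
  change ∑ t, _ < ∑ t, _
  rw [h5] at hS
  linarith [Nat.zero_le (fiberCard τ l * 3 ^ fiberCard τ l)]

variable {G : MvPolynomial T ℂ}

/-- The fibre over `l'` is dissolved into single points. -/
def dissolve {ι : Type*} [DecidableEq ι] (τ : T → ι) (l' : ι) : T → ι ⊕ T :=
  fun t => if τ t = l' then Sum.inr t else Sum.inl (τ t)

omit [Fintype T] in
theorem merge_dissolve {ι : Type*} [DecidableEq ι] (τ : T → ι) (l l' : ι) (u : T) (hu : τ u = l')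
    (t : T) : merge (Sum.inr u) (Sum.inl l) (dissolve τ l' t) = moveTo τ l l' u t := by
  by_cases h1 : t = u
  · subst h1
    simp [dissolve, moveTo, hu, merge_self]
  · by_cases h2 : τ t = l'
    · simp only [dissolve, moveTo, h1, h2, if_true, if_false]
      exact merge_of_ne (by simpa using h1)
    · simp only [dissolve, moveTo, h1, h2, if_false]
      exact merge_of_ne (by simp)

/-- By the chain rule the specialised partial derivatives over one cluster add up to a derivative of
zero; by symmetry of G they are equal, hence zero. This is the source of the double zeros. -/
theorem rename_pderiv_eq_zero (hG : ∀ π : Equiv.Perm T, rename π G = G) {ι : Type*} [DecidableEq ι]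
    (τ : T → ι) (h : rename τ G = 0) (u : T) : rename τ (pderiv u G) = 0 := by
  have h1 := pderiv_rename_eq_sum τ G (τ u)
  rw [h, map_zero] at h1
  have h2 : ∀ t ∈ Finset.univ.filter (fun t => τ t = τ u),
      rename τ (pderiv t G) = rename τ (pderiv u G) := by
    intro t ht
    have ht' : τ t = τ u := (Finset.mem_filter.mp ht).2
    have h3 : pderiv (Equiv.swap t u u) (rename (Equiv.swap t u) G) =
        rename (Equiv.swap t u) (pderiv u G) := pderiv_rename (Equiv.swap t u).injective _ _
    rw [hG, Equiv.swap_apply_right] at h3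
    rw [h3, rename_comp_apply]
    congr 2
    funext x
    rcases eq_or_ne x t with rfl | hx
    · rw [Equiv.swap_apply_left, ht']
    · rcases eq_or_ne x u with rfl | hx'
      · rw [Equiv.swap_apply_right, ht']
      · rw [Equiv.swap_apply_of_ne_of_ne hx hx']
  rw [Finset.sum_congr rfl h2, Finset.sum_const, eq_comm, smul_eq_zero] at h1
  refine h1.resolve_left ?_
  exact Finset.card_ne_zero.mpr ⟨u, by simp⟩

/-- When z_u is set equal to z_l, the polynomial vanishes, and so does its derivative in z_u by
`rename_pderiv_eq_zero`. -/
theorem sq_dvd_rename_dissolve (hG : ∀ π : Equiv.Perm T, rename π G = G) {ι : Type*}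
    [DecidableEq ι] (τ : T → ι) (l l' : ι) (u : T) (hu : τ u = l')
    (h : rename (moveTo τ l l' u) G = 0) :
    (X (Sum.inr u) - X (Sum.inl l)) ^ 2 ∣ rename (dissolve τ l') G := by
  have hm : ∀ P : MvPolynomial T ℂ, rename (merge (Sum.inr u) (Sum.inl l))
      (rename (dissolve τ l') P) = rename (moveTo τ l l' u) P := by
    intro P
    rw [rename_comp_apply]
    simp only [merge_dissolve τ l l' u hu]
  obtain ⟨H, hH⟩ : X (Sum.inr u) - X (Sum.inl l) ∣ rename (dissolve τ l') G := by
    rw [X_sub_X_dvd_iff, hm, h]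
  have hd := congrArg (pderiv (Sum.inr u)) hH
  rw [pderiv_rename_eq_sum, Finset.sum_eq_single u] at hd
  · rw [Derivation.leibniz, map_sub, pderiv_X_self, pderiv_X_of_ne (by simp), sub_zero,
      smul_eq_mul, smul_eq_mul, mul_one] at hd
    have h2 := congrArg (rename (merge (Sum.inr u) (Sum.inl l))) hd
    rw [hm, rename_pderiv_eq_zero hG _ h, map_add, map_mul, map_sub, rename_X, rename_X, merge_self,
      merge_of_ne (by simp), sub_self, zero_mul, zero_add, eq_comm, ← X_sub_X_dvd_iff] at h2
    rw [hH, sq]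
    exact mul_dvd_mul_left _ h2
  · intro t ht htu
    have := (Finset.mem_filter.mp ht).2
    simp only [dissolve] at this
    split_ifs at this
    exact absurd (Sum.inr_injective this) htu
  · intro hu'
    exact absurd (Finset.mem_filter.mpr ⟨Finset.mem_univ u, by simp [dissolve, hu]⟩) hu'

/-- Each point u of the dissolved fibre yields a factor (z_u - z_l)². These are coprime for distinct
u, so their product divides; setting all z_u equal to z_l' restores τ. -/
theorem pow_dvd_rename (hG : ∀ π : Equiv.Perm T, rename π G = G) {ι : Type*}
    [DecidableEq ι] (τ : T → ι) (l l' : ι)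
    (h : ∀ u, τ u = l' → rename (moveTo τ l l' u) G = 0) :
    (X l' - X l) ^ (2 * fiberCard τ l') ∣ rename τ G := by
  have h1 : ∏ u with τ u = l', (X (Sum.inr u) - X (Sum.inl l) : MvPolynomial (ι ⊕ T) ℂ) ^ 2 ∣
      rename (dissolve τ l') G := by
    refine Finset.prod_dvd_of_isRelPrime (fun u hu u' hu' huu' => ?_) fun u hu => ?_
    · refine IsRelPrime.pow (isRelPrime_X_sub_X (by simp) ?_)
      rw [merge_of_ne (by simpa using huu'.symm), merge_of_ne (by simp)]
      simp
    · have hu' := (Finset.mem_filter.mp hu).2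
      exact sq_dvd_rename_dissolve hG τ l l' u hu' (h u hu')
  have h2 := map_dvd (rename (Sum.elim id fun _ => l')) h1
  rw [rename_comp_apply, map_prod] at h2
  simp only [map_pow, map_sub, rename_X, Sum.elim_inl, Sum.elim_inr, id, Finset.prod_const,
    ← fiberCard_eq, ← pow_mul] at h2
  have h3 : (fun t => Sum.elim id (fun _ => l') (dissolve τ l' t)) = τ := by
    funext t
    by_cases ht : τ t = l' <;> simp [dissolve, ht]
  rwa [h3] at h2

/-- The product over pairs of a power of the difference of the variables. -/
def disc {ι : Type*} [Fintype ι] [LinearOrder ι] (c : ι → ℕ) : MvPolynomial ι ℂ :=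
  ∏ q : ι × ι with q.1 < q.2, (X q.1 - X q.2) ^ (2 * min (c q.1) (c q.2))

theorem disc_ne_zero {ι : Type*} [Fintype ι] [LinearOrder ι] (c : ι → ℕ) : disc c ≠ 0 :=
  Finset.prod_ne_zero_iff.mpr fun _ hq =>
    pow_ne_zero _ (X_sub_X_ne_zero (Finset.mem_filter.mp hq).2.ne)

theorem rename_disc {ι : Type*} [Fintype ι] [LinearOrder ι] (c : ι → ℕ) (σ : Equiv.Perm ι)
    (h : ∀ l, c (σ l) = c l) : rename σ (disc c) = disc c := by
  rw [disc, map_prod, ← Finset.prod_lt_comp_perm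
    (fun a b => (X a - X b : MvPolynomial ι ℂ) ^ (2 * min (c a) (c b))) (fun a b => ?_) σ]
  · refine Finset.prod_congr rfl fun q _ => ?_
    simp only [map_pow, map_sub, rename_X, h]
  · rw [min_comm, pow_mul, pow_mul, ← neg_sub, neg_sq]

/-- For each pair the smaller cluster is dissolved against the larger one, whence the minimum in the
exponent; differences belonging to distinct pairs are coprime. -/
theorem disc_dvd_rename (hG : ∀ π : Equiv.Perm T, rename π G = G) {ι : Type*} [Fintype ι]
    [LinearOrder ι] (τ : T → ι)
    (h : ∀ l l' u, l ≠ l' → fiberCard τ l' ≤ fiberCard τ l → τ u = l' →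
      rename (moveTo τ l l' u) G = 0) : disc (fiberCard τ) ∣ rename τ G := by
  refine Finset.prod_dvd_of_isRelPrime (fun q hq q' hq' hqq' => ?_) fun q hq => ?_
  · have h1 := (Finset.mem_filter.mp hq).2
    have h2 := (Finset.mem_filter.mp hq').2
    refine IsRelPrime.pow (isRelPrime_X_sub_X h1.ne ?_)
    obtain ⟨a, b⟩ := q
    obtain ⟨c, d⟩ := q'
    dsimp only at *
    by_cases hc : c = a
    · subst hc
      rw [merge_self, merge_of_ne h2.ne']
      rintro rfl
      exact hqq' rfl
    · rw [merge_of_ne hc]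
      by_cases hd : d = a
      · subst hd
        rw [merge_self]
        exact (h2.trans h1).ne
      · rw [merge_of_ne hd]
        exact h2.ne
  · have h1 := (Finset.mem_filter.mp hq).2
    rcases le_total (fiberCard τ q.1) (fiberCard τ q.2) with hle | hle
    · rw [min_eq_left hle]
      exact pow_dvd_rename hG τ q.2 q.1 fun u hu => h _ _ u h1.ne' hle hu
    · rw [min_eq_right hle, pow_mul, ← neg_sub, neg_sq, ← pow_mul]
      exact pow_dvd_rename hG τ q.1 q.2 fun u hu => h _ _ u h1.ne hle hu

end Clusters

/-! ### Leading exponents -/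

section Lex

variable {s : ℕ}

/-- The conditions on the shifted energies of quasi-particles of charges `c`. -/
structure IsAdm (c : Fin s → ℕ) (e : Fin s →₀ ℕ) : Prop where
  ground_le : ∀ l, 2 * c l * (s - 1 - l) ≤ e l
  difference : ∀ l l' : Fin s, (l : ℕ) + 1 = l' → c l = c l' → e l' + 2 * c l ≤ e l

/-- The lowest shifted energies of quasi-particles of charges `c`. -/
def ground (c : Fin s → ℕ) : Fin s →₀ ℕ :=
  Finsupp.equivFunOnFinite.symm fun l => 2 * c l * (s - 1 - l)

theorem ground_apply (c : Fin s → ℕ) (l : Fin s) : ground c l = 2 * c l * (s - 1 - l) := rfl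

theorem lex_lt_of {q q' : Fin s →₀ ℕ} (l : Fin s) (h : ∀ j < l, q j = q' j) (hl : q l < q' l) :
    toLex q < toLex q' := Finsupp.Lex.lt_iff.mpr ⟨l, h, hl⟩

theorem degree_X_sub_X {a b : Fin s} (h : a < b) :
    MonomialOrder.lex.degree (X a - X b : MvPolynomial (Fin s) ℂ) = Finsupp.single a 1 := by
  rw [MonomialOrder.degree_sub_of_lt, MonomialOrder.degree_X]
  rw [MonomialOrder.degree_X, MonomialOrder.degree_X, MonomialOrder.lex_lt_iff]
  exact Finsupp.Lex.single_lt_iff.mpr h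

theorem monic_X_sub_X {a b : Fin s} (h : a < b) :
    MonomialOrder.lex.Monic (X a - X b : MvPolynomial (Fin s) ℂ) := by
  rw [MonomialOrder.Monic, MonomialOrder.leadingCoeff_sub_of_lt, MonomialOrder.leadingCoeff_X]
  rw [MonomialOrder.degree_X, MonomialOrder.degree_X, MonomialOrder.lex_lt_iff]
  exact Finsupp.Lex.single_lt_iff.mpr h

theorem monic_disc (c : Fin s → ℕ) : MonomialOrder.lex.Monic (disc c) :=
  MonomialOrder.Monic.prod fun _ hq => (monic_X_sub_X (Finset.mem_filter.mp hq).2).pow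

/-- For a < b the factor leads with z_a^(2 c a), and a has s - 1 - a partners to its right. This is
the origin of the initial condition in the theorem. -/
theorem degree_disc {c : Fin s → ℕ} (hc : Monotone c) :
    MonomialOrder.lex.degree (disc c) = ground c := by
  rw [disc, MonomialOrder.degree_prod fun q hq => pow_ne_zero _
    (X_sub_X_ne_zero (Finset.mem_filter.mp hq).2.ne)]
  have h1 : ∀ q ∈ (Finset.univ : Finset (Fin s × Fin s)).filter (fun q => q.1 < q.2),
      MonomialOrder.lex.degree ((X q.1 - X q.2 : MvPolynomial (Fin s) ℂ) ^
        (2 * min (c q.1) (c q.2))) = Finsupp.single q.1 (2 * c q.1) := by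
    intro q hq
    have hlt := (Finset.mem_filter.mp hq).2
    rw [MonomialOrder.degree_pow, degree_X_sub_X hlt, min_eq_left (hc hlt.le), Finsupp.smul_single,
      smul_eq_mul, mul_one]
  rw [Finset.sum_congr rfl h1]
  ext l
  rw [Finsupp.finsetSum_apply, Finset.sum_filter, Fintype.sum_prod_type, Finset.sum_eq_single l]
  · simp only [Finsupp.single_eq_same]
    rw [← Finset.sum_filter, Finset.sum_const, smul_eq_mul, ground_apply, mul_comm]
    congr 1
    have : (Finset.univ.filter fun x => l < x) = Finset.Ioi l := by ext; simp
    rw [this, Fin.card_Ioi]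
  · intro b _ hb
    exact Finset.sum_eq_zero fun x _ => by split_ifs <;> simp [hb]
  · simp

/-- Leading exponents add, so F leads with `ground c` plus the leading exponent q of the quotient.
The quotient inherits the symmetry between equal charges, so q decreases weakly there, and
consecutive ground energies of equal charge differ by 2c. -/
theorem isAdm_degree {c : Fin s → ℕ} (hc : Monotone c) {F : MvPolynomial (Fin s) ℂ} (hF : F ≠ 0)
    (hsym : ∀ σ : Equiv.Perm (Fin s), (∀ l, c (σ l) = c l) → rename σ F = F)
    (hdvd : disc c ∣ F) : IsAdm c (MonomialOrder.lex.degree F) := by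
  obtain ⟨Q, rfl⟩ := hdvd
  have hQ : Q ≠ 0 := right_ne_zero_of_mul hF
  have hdeg := MonomialOrder.degree_mul (m := MonomialOrder.lex) (disc_ne_zero c) hQ
  rw [hdeg, degree_disc hc]
  refine ⟨fun l => by simp [ground_apply], fun l l' hl hcl => ?_⟩
  have hswap : ∀ x, c (Equiv.swap l l' x) = c x := by
    intro x
    rcases eq_or_ne x l with rfl | hx
    · rw [Equiv.swap_apply_left, hcl]
    · rcases eq_or_ne x l' with rfl | hx'
      · rw [Equiv.swap_apply_right, hcl]
      · rw [Equiv.swap_apply_of_ne_of_ne hx hx']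
  have hsymQ : rename (Equiv.swap l l') Q = Q := by
    have h1 := hsym _ hswap
    rw [map_mul, rename_disc c _ hswap] at h1
    exact mul_left_cancel₀ (disc_ne_zero c) h1
  set q := MonomialOrder.lex.degree Q with hq
  have hle : q l' ≤ q l := by
    -- Otherwise the exponent with l and l' exchanged, which also lies in the support, would be
    -- lexicographically larger.
    by_contra hlt
    rw [not_le] at hlt
    have hmem : q.mapDomain (Equiv.swap l l') ∈ Q.support := by
      rw [mem_support_iff, ← hsymQ, coeff_rename_mapDomain _ (Equiv.injective _),
        ← mem_support_iff]
      exact MonomialOrder.degree_mem_support hQ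
    have h1 := MonomialOrder.le_degree (m := MonomialOrder.lex) hmem
    rw [MonomialOrder.lex_le_iff] at h1
    have happ : ∀ x, q.mapDomain (Equiv.swap l l') x = q (Equiv.swap l l' x) := by
      intro x
      conv_lhs => rw [← Equiv.swap_apply_self l l' x]
      rw [Finsupp.mapDomain_apply (Equiv.injective _)]
    refine absurd h1 (not_le.mpr (lex_lt_of l (fun j hj => ?_) ?_))
    · rw [happ, Equiv.swap_apply_of_ne_of_ne hj.ne]
      intro h
      rw [h, Fin.lt_def] at hj
      omega
    · rw [happ, Equiv.swap_apply_left]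
      exact hlt
  rw [Finsupp.add_apply, Finsupp.add_apply, ground_apply, ground_apply, ← hcl]
  have h2 : s - 1 - (l : ℕ) = (s - 1 - (l' : ℕ)) + 1 := by omega
  rw [h2]
  have h3 : 2 * c l * (s - 1 - (l' : ℕ) + 1) = 2 * c l * (s - 1 - (l' : ℕ)) + 2 * c l := by ring
  omega

end Lex

/-! ### Spanning -/

section Spanning

variable {T : Type} [Fintype T] [DecidableEq T] {G : MvPolynomial T ℂ}

-- A permutation of clusters that preserves sizes lifts to a permutation of the points, under which
-- G is invariant.
omit [DecidableEq T] in
theorem rename_perm_rename (hG : ∀ π : Equiv.Perm T, rename π G = G) {ι : Type*} [DecidableEq ι]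
    (τ : T → ι) (σ : Equiv.Perm ι) (hσ : ∀ l, fiberCard τ (σ l) = fiberCard τ l) :
    rename σ (rename τ G) = rename τ G := by
  have key : ∀ l, Nonempty ({t // σ (τ t) = l} ≃ {t // τ t = l}) := by
    intro l
    refine ⟨Fintype.equivOfCardEq ?_⟩
    change _ = fiberCard τ l
    rw [← σ.apply_symm_apply l, hσ]
    exact Fintype.card_congr (Equiv.subtypeEquivRight fun t => σ.injective.eq_iff)
  let π : Equiv.Perm T := Equiv.ofFiberEquiv fun l => (key l).some
  have hπ : ∀ t, τ (π t) = σ (τ t) := fun t => Equiv.ofFiberEquiv_map _ t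
  rw [rename_comp_apply]
  simp only [← hπ]
  rw [← rename_comp_apply, hG]

omit [DecidableEq T] in
theorem fiberCard_comp {ι ι' : Type*} [DecidableEq ι] [DecidableEq ι'] (τ : T → ι) (f : ι → ι')
    (t : T) (hf : ∀ t', f (τ t') = f (τ t) → τ t' = τ t) :
    fiberCard (fun t => f (τ t)) (f (τ t)) = fiberCard τ (τ t) :=
  Fintype.card_congr (Equiv.subtypeEquivRight fun t' => ⟨fun h => hf t' h, fun h => congrArg f h⟩)

omit [DecidableEq T] in
/-- Every map is, up to an injective relabelling, one onto `Fin s` with weakly increasing sizes of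
fibres. -/
theorem exists_sorted {ι : Type*} [DecidableEq ι] (τ : T → ι) :
    ∃ (s : ℕ) (τ' : T → Fin s) (f : Fin s → ι), Function.Injective f ∧ (∀ t, f (τ' t) = τ t) ∧
      (∀ l, 0 < fiberCard τ' l) ∧ Monotone (fiberCard τ') := by
  classical
  let R := Set.range τ
  let ε : R ≃ Fin (Fintype.card R) := Fintype.equivFin R
  let τ₀ : T → Fin (Fintype.card R) := fun t => ε ⟨τ t, t, rfl⟩
  let σ := Tuple.sort (fiberCard τ₀)
  have hfib : ∀ l, fiberCard (fun t => σ.symm (τ₀ t)) l = fiberCard τ₀ (σ l) := fun l =>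
    Fintype.card_congr (Equiv.subtypeEquivRight fun t => by rw [Equiv.symm_apply_eq])
  refine ⟨_, fun t => σ.symm (τ₀ t), fun l => (ε.symm (σ l)).1, ?_, fun t => ?_, fun l => ?_, ?_⟩
  · exact Subtype.val_injective.comp (ε.symm.injective.comp σ.injective)
  · simp [τ₀]
  · rw [hfib]
    obtain ⟨t, ht⟩ := (ε.symm (σ l)).2
    refine Fintype.card_pos_iff.mpr ⟨⟨t, ?_⟩⟩
    simp [τ₀, ht]
  · have h := Tuple.monotone_sort (fiberCard τ₀)
    intro a b hab
    rw [hfib, hfib]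
    exact h hab

/-- Descending induction on the potential: once all more concentrated specialisations vanish,
divisibility by `disc` would make the leading exponent of a nonzero specialisation admissible, which
`h` excludes. The identity map specialises nothing and gives G itself. -/
theorem eq_zero_of_clusters (hG : ∀ π : Equiv.Perm T, rename π G = G)
    (h : ∀ (s : ℕ) (τ : T → Fin s), (∀ l, 0 < fiberCard τ l) → Monotone (fiberCard τ) →
      ∀ e, IsAdm (fiberCard τ) e → coeff e (rename τ G) = 0) : G = 0 := by
  -- The counter n measures the distance from the upper bound of `potential_le`, so n = 0 is
  -- vacuous.
  have key : ∀ (n : ℕ) (ι : Type) [DecidableEq ι] (τ : T → ι),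
      Fintype.card T * 3 ^ Fintype.card T < potential τ + n → rename τ G = 0 := by
    intro n
    induction n with
    | zero =>
      intro ι _ τ hlt
      exact absurd hlt (not_lt.mpr (potential_le τ))
    | succ n ih =>
      intro ι _ τ hlt
      obtain ⟨s, τ', f, hf, hτ', hpos, hmono⟩ := exists_sorted τ
      have hpot : potential τ' = potential τ := by
        have h1 : τ = fun t => f (τ' t) := funext fun t => (hτ' t).symm
        rw [h1]
        exact Finset.sum_congr rfl fun t _ => by rw [fiberCard_comp τ' f t fun _ h => hf h]
      have hdvd : disc (fiberCard τ') ∣ rename τ' G := by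
        refine disc_dvd_rename hG τ' fun l l' u hll hle hu => ih _ _ ?_
        have := potential_lt_moveTo τ' hll hle u hu
        omega
      have h0 : rename τ' G = 0 := by
        by_contra hne
        have hadm := isAdm_degree hmono hne (fun σ hσ => rename_perm_rename hG τ' σ hσ) hdvd
        exact MonomialOrder.coeff_degree_ne_zero_iff.mpr hne (h s τ' hpos hmono _ hadm)
      have h1 : τ = fun t => f (τ' t) := funext fun t => (hτ' t).symm
      rw [h1, ← rename_comp_apply, h0, map_zero]
  have := key (Fintype.card T * 3 ^ Fintype.card T + 1) T id (by omega)
  rwa [rename_id_apply] at this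

/-- The products of coefficients of powers which belong to admissible indices. -/
def clusterProd {s : ℕ} (c : Fin s → ℕ) (e : Fin s →₀ ℕ) : MvPolynomial ℕ ℂ :=
  ∏ l, powCoeff (c l) (e l)

/-- The charges and shifted energies of the quasi-particles in an element of the basis. -/
structure ClusterIndex where
  /-- The number of quasi-particles. -/
  s : ℕ
  /-- The charges. -/
  c : Fin s → ℕ
  /-- The shifted energies. -/
  e : Fin s →₀ ℕ
  pos : ∀ l, 0 < c l
  mono : Monotone c
  adm : IsAdm c e

/-- The polynomial attached to an index. -/
def ClusterIndex.poly (x : ClusterIndex) : MvPolynomial ℕ ℂ := clusterProd x.c x.e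

/-- A functional that kills the products has vanishing generating polynomials by
`eq_zero_of_clusters`, and their coefficients are its values on all monomials. -/
theorem span_poly : Submodule.span ℂ (Set.range ClusterIndex.poly) = ⊤ := by
  by_contra hne
  obtain ⟨g, hg0, hg⟩ := Submodule.exists_le_ker_of_lt_top _ (lt_top_iff_ne_top.mpr hne)
  have hgen : ∀ N n, genPoly g (Fin N) n = 0 := by
    intro N n
    refine eq_zero_of_clusters (fun π => rename_genPoly g n π) fun s τ hpos hmono e he => ?_
    rw [coeff_rename_genPoly g n τ (fiberCard τ) fun _ => rfl]
    split_ifs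
    · exact hg (Submodule.subset_span ⟨⟨s, fiberCard τ, e, hpos, hmono, he⟩, rfl⟩)
    · rfl
  have hword : ∀ N (i : Fin N → ℕ), g (word i) = 0 := by
    intro N i
    have h := coeff_genPoly g (Finsupp.equivFunOnFinite.symm i).degree
      (Finsupp.equivFunOnFinite.symm i)
    rw [hgen, if_pos rfl, coeff_zero] at h
    exact h.symm
  refine hg0 ((basisMonomials ℕ ℂ).ext fun m => ?_)
  rw [coe_basisMonomials, LinearMap.zero_apply]
  obtain ⟨L, hL⟩ : ∃ L : List ℕ, (L : Multiset ℕ) = Finsupp.toMultiset m := Quot.exists_rep _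
  have h2 := hword L.length L.get
  rwa [word_eq_monomial, show content L.get = m from ?_] at h2
  apply Finsupp.orderIsoMultiset.injective
  rw [Finsupp.coe_orderIsoMultiset, ← hL, content, map_sum]
  simp only [Finsupp.toMultiset_single, one_smul]
  rw [Finset.sum_eq_multiset_sum]
  change (Multiset.map ((fun a => ({a} : Multiset ℕ)) ∘ L.get) _).sum = _
  rw [← Multiset.map_map, Multiset.sum_map_singleton, Fin.univ_val_map, List.ofFn_get]

end Spanning

/-! ### Linear functionals attached to polynomials -/

section DualFun

variable {B : Type*} [Fintype B] [DecidableEq B]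

/-- The sum of the coefficients of `M` at all bijective relabellings of `i`. -/
def symCoeff (M : MvPolynomial B ℂ) {T : Type*} [Fintype T] [DecidableEq T] (i : T → ℕ) : ℂ :=
  ∑ π : T ≃ B, coeff (Finsupp.equivFunOnFinite.symm fun b => i (π.symm b)) M

theorem symCoeff_comp_equiv (M : MvPolynomial B ℂ) {T T' : Type*} [Fintype T] [DecidableEq T]
    [Fintype T'] [DecidableEq T'] (ε : T ≃ T') (j : T' → ℕ) :
    symCoeff M (fun t => j (ε t)) = symCoeff M j := by
  refine Fintype.sum_equiv (Equiv.equivCongr ε (Equiv.refl B)) _ _ fun π => ?_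
  rfl

open Classical in
/-- The functional whose value on a word is the symmetrised coefficient of `M`. -/
def dualFun (M : MvPolynomial B ℂ) : MvPolynomial ℕ ℂ →ₗ[ℂ] ℂ :=
  (basisMonomials ℕ ℂ).constr ℂ fun m =>
    if h : ∃ i : B → ℕ, content i = m then symCoeff M h.choose else 0

theorem dualFun_word (M : MvPolynomial B ℂ) {T : Type*} [Fintype T] [DecidableEq T] (i : T → ℕ) :
    dualFun M (word i) = symCoeff M i := by
  rw [word_eq_monomial, dualFun, InducingData.constr_monomial]
  split_ifs with h
  · obtain ⟨ε, hε⟩ := exists_equiv_of_content_eq h.choose_spec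
    rw [← symCoeff_comp_equiv M ε i]
    simp only [hε]
  · rw [symCoeff, Finset.sum_eq_zero]
    intro π _
    exact absurd ⟨fun b => i (π.symm b), content_comp_equiv π.symm i⟩ h

/-- Summing over exponents before bijections identifies the variables of M along the rows of c. -/
theorem dualFun_clusterProd (M : MvPolynomial B ℂ) {s : ℕ} (c : Fin s → ℕ) (e : Fin s →₀ ℕ) :
    dualFun M (clusterProd c e) =
      ∑ π : Box c ≃ B, coeff e (rename (fun b => (π.symm b).1) M) := by
  rw [clusterProd, prod_powCoeff, map_sum]
  simp only [dualFun_word, symCoeff]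
  rw [Finset.sum_comm]
  refine Finset.sum_congr rfl fun π _ => ?_
  rw [coeff_rename_eq_sum]
  refine Finset.sum_bij' (fun i _ => i.mapDomain π) (fun i _ => i.mapDomain π.symm) ?_ ?_ ?_ ?_ ?_
  · intro i hi
    rw [mem_fiberExponents] at hi ⊢
    rw [← Finsupp.mapDomain_comp, ← hi]
    congr 1
    funext b
    simp
  · intro i hi
    rw [mem_fiberExponents] at hi ⊢
    rw [← Finsupp.mapDomain_comp, ← hi]
    rfl
  · intro i _
    rw [← Finsupp.mapDomain_comp]
    simp
  · intro i _
    rw [← Finsupp.mapDomain_comp]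
    simp
  · intro i _
    congr 1
    ext b
    conv_rhs => rw [← π.apply_symm_apply b, Finsupp.mapDomain_apply π.injective]
    rfl

end DualFun

/-! ### Combinatorics of columns -/

/-- The first n odd numbers sum to n², and n distinct odd numbers attain this only if they are the
first n. -/
theorem sq_card_le_sum (S : Finset ℕ) : S.card ^ 2 ≤ ∑ x ∈ S, (2 * x + 1) ∧
    (∑ x ∈ S, (2 * x + 1) ≤ S.card ^ 2 → ∀ x ∈ S, x < S.card) := by
  induction S using Finset.induction_on_max with
  | empty => simp
  | insert a S hS ih =>
    have ha : a ∉ S := fun h => lt_irrefl _ (hS a h)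
    have hcard : S.card ≤ a := by
      have := Finset.card_le_card (show S ⊆ Finset.range a from
        fun x hx => Finset.mem_range.mpr (hS x hx))
      rwa [Finset.card_range] at this
    rw [Finset.card_insert_of_notMem ha, Finset.sum_insert ha]
    refine ⟨by nlinarith [ih.1], fun hle x hx => ?_⟩
    have h1 : a = S.card := by nlinarith [ih.1]
    rcases Finset.mem_insert.mp hx with rfl | hx
    · omega
    · have := ih.2 (by nlinarith) x hx
      omega

theorem sq_le_sum_of_injective {n : ℕ} {f : Fin n → ℕ} (hf : Function.Injective f) :
    n ^ 2 ≤ ∑ k, (2 * f k + 1) ∧ (∑ k, (2 * f k + 1) ≤ n ^ 2 → ∀ k, f k < n) := by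
  have h := sq_card_le_sum (Finset.univ.image f)
  rw [Finset.card_image_of_injective _ hf, Finset.sum_image fun _ _ _ _ h => hf h,
    Finset.card_univ, Fintype.card_fin] at h
  exact ⟨h.1, fun hle k => h.2 hle _ (Finset.mem_image_of_mem f (Finset.mem_univ k))⟩

theorem sum_box {s : ℕ} (c : Fin s → ℕ) : ∑ b : Box c, (2 * (b.2 : ℕ) + 1) = ∑ l, c l ^ 2 := by
  rw [Fintype.sum_sigma]
  refine Finset.sum_congr rfl fun l _ => ?_
  rw [Fin.sum_univ_eq_sum_range fun k => 2 * k + 1]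
  induction c l with
  | zero => rfl
  | succ n ih => rw [Finset.sum_range_succ, ih]; ring

/-- A relabelling of boxes under which distinct boxes of one column lie in distinct rows. -/
def ColInjective {s s' : ℕ} {c : Fin s → ℕ} {c' : Fin s' → ℕ} (π : Box c' ≃ Box c) : Prop :=
  ∀ b b' : Box c, (b.2 : ℕ) = b'.2 → (π.symm b).1 = (π.symm b').1 → b = b'

section Columns

variable {s s' : ℕ} {c : Fin s → ℕ} {c' : Fin s' → ℕ} {π : Box c' ≃ Box c}

theorem ColInjective.row_injective (h : ColInjective π) (j : Fin s') :
    Function.Injective fun k : Fin (c' j) => ((π ⟨j, k⟩).2 : ℕ) := by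
  intro k k' hk
  have h1 := h (π ⟨j, k⟩) (π ⟨j, k'⟩) hk (by simp)
  have h2 := π.injective h1
  simpa using h2

/-- The boxes of row j of c' come from distinct columns of c, so their weights 2k + 1 sum to at
least (c' j)². The total weight is Σ (c l)², so `hle` forces equality in every row. -/
theorem ColInjective.col_lt (h : ColInjective π) (hle : ∑ l, c l ^ 2 ≤ ∑ j, c' j ^ 2)
    (b : Box c') : ((π b).2 : ℕ) < c' b.1 := by
  rw [← sum_box c, ← Equiv.sum_comp π, Fintype.sum_sigma] at hle
  have h1 : ∀ j ∈ Finset.univ, c' j ^ 2 ≤ ∑ k, (2 * ((π ⟨j, k⟩).2 : ℕ) + 1) :=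
    fun j _ => (sq_le_sum_of_injective (h.row_injective j)).1
  have h2 := (Finset.sum_eq_sum_iff_of_le h1).mp (le_antisymm (Finset.sum_le_sum h1) hle)
  obtain ⟨j, k⟩ := b
  exact (sq_le_sum_of_injective (h.row_injective j)).2 (h2 j (Finset.mem_univ j)).ge k

/-- The number of rows of length more than `k` is the number of boxes in column `k`. -/
theorem card_col {s : ℕ} (c : Fin s → ℕ) (k : ℕ) :
    (Finset.univ.filter fun l => k < c l).card =
      (Finset.univ.filter fun b : Box c => (b.2 : ℕ) = k).card := by
  refine Finset.card_bij' (fun l hl => ⟨l, ⟨k, (Finset.mem_filter.mp hl).2⟩⟩) (fun b _ => b.1)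
    ?_ ?_ ?_ ?_
  · intro l _; simp
  · rintro ⟨l, m⟩ hb
    have := (Finset.mem_filter.mp hb).2
    simp only [Finset.mem_filter, Finset.mem_univ, true_and]
    exact this ▸ m.2
  · intros; rfl
  · rintro ⟨l, m⟩ hb
    have := (Finset.mem_filter.mp hb).2
    subst this
    rfl

/-- By `col_lt` column k of c embeds into the set of rows of c' longer than k. Both diagrams have
equally many boxes, so none of these inequalities is strict. -/
theorem ColInjective.card_eq (h : ColInjective π) (hle : ∑ l, c l ^ 2 ≤ ∑ j, c' j ^ 2) (k : ℕ) :
    (Finset.univ.filter fun l => k < c l).card = (Finset.univ.filter fun l => k < c' l).card := by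
  have key : ∀ k, (Finset.univ.filter fun l => k < c l).card ≤
      (Finset.univ.filter fun l => k < c' l).card := by
    intro k
    rw [card_col]
    refine Finset.card_le_card_of_injOn (fun b => (π.symm b).1) ?_ ?_
    · intro b hb
      have h1 := h.col_lt hle (π.symm b)
      have h2 := (Finset.mem_filter.mp hb).2
      rw [Equiv.apply_symm_apply, h2] at h1
      simpa using h1
    · intro b hb b' hb' hbb
      have h1 := (Finset.mem_filter.mp hb).2
      have h2 := (Finset.mem_filter.mp hb').2
      exact h b b' (h1.trans h2.symm) hbb
  have hbox : Fintype.card (Box c') = Fintype.card (Box c) := Fintype.card_congr π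
  have hsum : ∀ {s : ℕ} (c : Fin s → ℕ) (K : ℕ), (∀ l, c l ≤ K) →
      ∑ k ∈ Finset.range K, (Finset.univ.filter fun l => k < c l).card = Fintype.card (Box c) := by
    intro s c K hK
    simp only [Finset.card_filter]
    rw [Finset.sum_comm, Fintype.card_sigma]
    refine Finset.sum_congr rfl fun l _ => ?_
    rw [← Finset.card_filter, Fintype.card_fin]
    have : (Finset.range K).filter (fun k => k < c l) = Finset.range (c l) := by
      ext k
      simp only [Finset.mem_filter, Finset.mem_range, and_iff_right_iff_imp]
      exact fun hk => lt_of_lt_of_le hk (hK l)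
    rw [this, Finset.card_range]
  let K := Finset.univ.sup c + Finset.univ.sup c' + k + 1
  have h1 := hsum c K fun l => (Finset.le_sup (Finset.mem_univ l)).trans (by omega)
  have h2 := hsum c' K fun l => (Finset.le_sup (Finset.mem_univ l)).trans (by omega)
  exact (Finset.sum_eq_sum_iff_of_le fun k _ => key k).mp (h1.trans (hbox.symm.trans h2.symm)) k
    (Finset.mem_range.mpr (by omega))

end Columns

theorem eq_of_card_eq {s : ℕ} {c c' : Fin s → ℕ} (hc : Monotone c) (hc' : Monotone c')
    (h : ∀ k, (Finset.univ.filter fun l => k < c l).card =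
      (Finset.univ.filter fun l => k < c' l).card) : c = c' := by
  have key : ∀ {c c' : Fin s → ℕ}, Monotone c → Monotone c' →
      (∀ k, (Finset.univ.filter fun l => k < c l).card =
        (Finset.univ.filter fun l => k < c' l).card) → ∀ l, c l ≤ c' l := by
    intro c c' hc hc' h l
    by_contra hlt
    rw [not_le] at hlt
    have h1 : (Finset.univ.filter fun x => c' l < c' x) ⊂
        (Finset.univ.filter fun x => c' l < c x) := by
      refine Finset.ssubset_iff_subset_ne.mpr ⟨fun x hx => ?_, fun heq => ?_⟩
      · have hx' := (Finset.mem_filter.mp hx).2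
        have hlx : l ≤ x := by
          by_contra hxl
          exact absurd (hc' (not_le.mp hxl).le) (not_le.mpr hx')
        exact Finset.mem_filter.mpr ⟨Finset.mem_univ _, lt_of_lt_of_le hlt (hc hlx)⟩
      · have : l ∈ (Finset.univ.filter fun x => c' l < c' x) := by
          rw [heq]
          exact Finset.mem_filter.mpr ⟨Finset.mem_univ _, hlt⟩
        exact lt_irrefl _ (Finset.mem_filter.mp this).2
    exact absurd (h (c' l)) (Finset.card_lt_card h1).ne'
  exact funext fun l => le_antisymm (key hc hc' h l) (key hc' hc (fun k => (h k).symm) l)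

/-- Moving exponents to rows of the same or larger length does not increase the exponent
lexicographically. -/
theorem toLex_sum_single_le {s : ℕ} {c : Fin s → ℕ} (hc : Monotone c) (q : Fin s →₀ ℕ)
    (hq : ∀ l l', l ≤ l' → c l = c l' → q l' ≤ q l) (μ : Fin s → Fin s)
    (h1 : ∀ l, c l ≤ c (μ l)) (h2 : ∀ l l', c l = c l' → μ l = μ l' → l = l') :
    toLex (∑ l, Finsupp.single (μ l) (q l)) ≤ toLex q := by
  by_contra hlt
  obtain ⟨i, hi, hlt'⟩ := Finsupp.Lex.lt_iff.mp (not_le.mp hlt)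
  simp only [ofLex_toLex] at hi hlt'
  have hr : ∀ j, (∑ l, Finsupp.single (μ l) (q l)) j = ∑ l with μ l = j, q l := by
    intro j
    rw [Finsupp.finsetSum_apply, Finset.sum_filter]
    exact Finset.sum_congr rfl fun l _ => by rw [Finsupp.single_apply]
  have hsum : ∑ j ∈ Finset.Iic i, q j < ∑ j ∈ Finset.Iic i, (∑ l, Finsupp.single (μ l) (q l)) j := by
    refine Finset.sum_lt_sum (fun j hj => ?_) ⟨i, by simp, hlt'⟩
    rcases (Finset.mem_Iic.mp hj).eq_or_lt with rfl | hj
    · exact hlt'.le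
    · exact (hi j hj).le
  simp only [hr] at hsum
  have hfib : ∑ j ∈ Finset.Iic i, ∑ l with μ l = j, q l = ∑ l with μ l ≤ i, q l := by
    rw [← Finset.sum_fiberwise_of_maps_to (s := Finset.univ.filter fun l => μ l ≤ i)
      (t := Finset.Iic i) (g := μ) (f := fun l => q l) fun l hl => by simpa using hl]
    refine Finset.sum_congr rfl fun j hj => Finset.sum_congr ?_ fun _ _ => rfl
    ext l
    have := Finset.mem_Iic.mp hj
    simp only [Finset.mem_filter, Finset.mem_univ, true_and]
    exact ⟨fun h => ⟨h ▸ this, h⟩, fun h => h.2⟩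
  rw [hfib] at hsum
  -- Rows that μ brings into the initial segment from outside have the length of row i and exponent
  -- at most q i. As μ is injective on rows of that length, at least as many such rows leave, each
  -- with exponent at least q i; so the partial sum cannot have grown.
  set S : Finset (Fin s) := Finset.univ.filter fun l => μ l ≤ i with hS
  set I : Finset (Fin s) := Finset.Iic i with hI
  have hSI : ∀ l ∈ S \ I, c l = c i ∧ q l ≤ q i := by
    intro l hl
    rw [Finset.mem_sdiff, hS, hI, Finset.mem_filter, Finset.mem_Iic, not_le] at hl
    have h3 : c l = c i := le_antisymm ((h1 l).trans (hc hl.1.2)) (hc hl.2.le)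
    exact ⟨h3, hq i l hl.2.le h3.symm⟩
  set C : Finset (Fin s) := Finset.univ.filter fun l => c l = c i with hC
  have hS' : S \ I ⊆ (C ∩ S) \ (C ∩ I) := by
    intro l hl
    have := hSI l hl
    rw [Finset.mem_sdiff] at hl
    simp [hC, this.1, hl.1, hl.2]
  have hI' : (C ∩ I) \ (C ∩ S) ⊆ I \ S := by
    intro l hl
    simp only [Finset.mem_sdiff, Finset.mem_inter, not_and] at hl ⊢
    exact ⟨hl.1.2, hl.2 hl.1.1⟩
  have hμ : (C ∩ S).card ≤ (C ∩ I).card := by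
    refine Finset.card_le_card_of_injOn μ (fun l hl => ?_) fun l hl l' hl' hll => ?_
    · simp only [hC, hS, hI, Finset.coe_inter, Set.mem_inter_iff, Finset.mem_coe,
        Finset.mem_filter, Finset.mem_univ, true_and, Finset.mem_Iic] at hl ⊢
      exact ⟨le_antisymm (hc hl.2) (hl.1 ▸ h1 l), hl.2⟩
    · have h3 := (Finset.mem_filter.mp (Finset.mem_inter.mp hl).1).2
      have h4 := (Finset.mem_filter.mp (Finset.mem_inter.mp hl').1).2
      exact h2 l l' (h3.trans h4.symm) hll
  have hcard := Finset.card_sdiff_le_card_sdiff_iff.mpr hμ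
  have e1 := Finset.sum_inter_add_sum_sdiff S I (fun l => q l)
  have e2 := Finset.sum_inter_add_sum_sdiff I S (fun l => q l)
  rw [Finset.inter_comm] at e2
  have b1 : ∑ l ∈ S \ I, q l ≤ ((C ∩ S) \ (C ∩ I)).card * q i := by
    refine (Finset.sum_le_card_nsmul _ _ (q i) fun l hl => (hSI l hl).2).trans ?_
    exact Nat.mul_le_mul_right _ (Finset.card_le_card hS')
  have b2 : ((C ∩ I) \ (C ∩ S)).card * q i ≤ ∑ l ∈ I \ S, q l := by
    refine le_trans ?_ (Finset.sum_le_sum_of_subset hI')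
    refine Finset.card_nsmul_le_sum _ _ (q i) fun l hl => ?_
    have hl' := (Finset.mem_inter.mp (Finset.mem_sdiff.mp hl).1)
    exact hq l i (Finset.mem_Iic.mp hl'.2) (Finset.mem_filter.mp hl'.1).2
  have b3 := Nat.mul_le_mul_right (q i) hcard
  omega

/-! ### Independence -/

theorem prod_prod_ne_eq_prod_lt {ι M : Type*} [Fintype ι] [LinearOrder ι] [CommMonoid M]
    (G : ι → ι → M) (hG : ∀ a, G a a = 1) :
    ∏ q : ι × ι, G q.1 q.2 = ∏ q : ι × ι with q.1 < q.2, G q.1 q.2 * G q.2 q.1 := by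
  rw [Finset.prod_mul_distrib, Finset.prod_filter, Finset.prod_filter,
    ← Equiv.prod_comp (Equiv.prodComm ι ι) (fun q => if q.1 < q.2 then G q.2 q.1 else 1),
    ← Finset.prod_mul_distrib]
  refine Finset.prod_congr rfl fun q _ => ?_
  obtain ⟨a, b⟩ := q
  rcases lt_trichotomy a b with h | rfl | h
  · simp [h, h.not_gt]
  · simp [hG]
  · simp [h, h.not_gt]

open Classical in
/-- The factor attached to a pair of boxes; it is `1` unless the boxes are distinct and lie in the
same column. -/
def colFactor {s : ℕ} {c : Fin s → ℕ} {κ : Type*} (ν : Box c → κ) (a b : Box c) :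
    MvPolynomial κ ℂ :=
  if a ≠ b ∧ (a.2 : ℕ) = b.2 then C Complex.I * (X (ν a) - X (ν b)) else 1

theorem rename_colFactor {s : ℕ} {c : Fin s → ℕ} {κ κ' : Type*} (ν : Box c → κ) (f : κ → κ')
    (a b : Box c) : rename f (colFactor ν a b) = colFactor (f ∘ ν) a b := by
  unfold colFactor
  split_ifs <;> simp

theorem card_eq_min (m n : ℕ) :
    (Finset.univ.filter fun k : Fin m × Fin n => (k.1 : ℕ) = k.2).card = min m n := by
  have h : ∀ k : Fin m, (∑ k' : Fin n, if (k : ℕ) = k' then 1 else 0) =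
      if (k : ℕ) < n then 1 else 0 := fun k => by
    rw [Fin.sum_univ_eq_sum_range (fun x => if (k : ℕ) = x then 1 else 0) n, Finset.sum_ite_eq]
    simp
  rw [Finset.card_filter, Fintype.sum_prod_type]
  simp only [h]
  rw [Fin.sum_univ_eq_sum_range (fun x => if x < n then 1 else 0) m, ← Finset.card_filter,
    ← Finset.card_range (min m n)]
  congr 1
  ext x
  simp

theorem prod_colFactor_row {s : ℕ} (c : Fin s → ℕ) (l l' : Fin s) :
    ∏ k : Fin (c l), ∏ k' : Fin (c l'), colFactor (c := c) Sigma.fst ⟨l, k⟩ ⟨l', k'⟩ =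
      if l = l' then 1 else (C Complex.I * (X l - X l')) ^ min (c l) (c l') := by
  rw [← Fintype.prod_prod_type']
  split_ifs with h
  · subst h
    refine Finset.prod_eq_one fun k _ => ?_
    rw [colFactor, if_neg]
    rintro ⟨h1, h2⟩
    have h3 : k.1 = k.2 := Fin.ext h2
    exact h1 (by rw [h3])
  · rw [← card_eq_min, ← Finset.prod_const, Finset.prod_filter]
    refine Finset.prod_congr rfl fun k _ => ?_
    have hne : (⟨l, k.1⟩ : Box c) ≠ ⟨l', k.2⟩ := fun h' => h (congrArg Sigma.fst h')
    simp only [colFactor, hne, ne_eq, not_false_eq_true, true_and]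

/-- The scalar i turns the product over the two orders of a pair into a square with sign +1, so the
boxes need not be ordered. -/
theorem mul_I_sub_mul {ι : Type*} (a b : ι) :
    (C Complex.I * (X a - X b)) * (C Complex.I * (X b - X a)) =
      (X a - X b : MvPolynomial ι ℂ) ^ 2 := by
  have : (C Complex.I * C Complex.I : MvPolynomial ι ℂ) = -1 := by
    rw [← C_mul, Complex.I_mul_I, C_neg, C_1]
  generalize (C Complex.I : MvPolynomial ι ℂ) = z at *
  linear_combination (X a - X b) * (X b - X a) * this

/-- Two rows share as many columns as the shorter one has boxes, and each shared column contributes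
a squared difference; boxes of one row never share a column. -/
theorem prod_colFactor {s : ℕ} (c : Fin s → ℕ) :
    ∏ q : Box c × Box c, colFactor Sigma.fst q.1 q.2 = disc c := by
  have h2 : ∏ q : Box c × Box c, colFactor (c := c) Sigma.fst q.1 q.2 = ∏ p : Fin s × Fin s,
      ∏ k : Fin (c p.1), ∏ k' : Fin (c p.2), colFactor (c := c) Sigma.fst ⟨p.1, k⟩ ⟨p.2, k'⟩ := by
    rw [Fintype.prod_prod_type, Fintype.prod_prod_type, Fintype.prod_sigma]
    refine Finset.prod_congr rfl fun l _ => ?_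
    simp only [Fintype.prod_sigma]
    exact Finset.prod_comm
  simp only [prod_colFactor_row] at h2
  rw [h2, prod_prod_ne_eq_prod_lt (fun a b : Fin s => if a = b then 1 else
    (C Complex.I * (X a - X b : MvPolynomial (Fin s) ℂ)) ^ min (c a) (c b)) (fun a => if_pos rfl)]
  refine Finset.prod_congr rfl fun q hq => ?_
  have hlt := (Finset.mem_filter.mp hq).2
  rw [if_neg hlt.ne, if_neg hlt.ne', min_comm (c q.2), ← mul_pow, mul_I_sub_mul, ← pow_mul]

/-- The last box in row `l`. -/
def lastBox {s : ℕ} {c : Fin s → ℕ} (hc : ∀ l, 0 < c l) (l : Fin s) : Box c :=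
  ⟨l, ⟨c l - 1, Nat.sub_lt (hc l) one_pos⟩⟩

/-- The polynomial in the boxes which detects the exponent `ground c + q`. -/
def boxPoly {s : ℕ} {c : Fin s → ℕ} (hc : ∀ l, 0 < c l) (q : Fin s →₀ ℕ) :
    MvPolynomial (Box c) ℂ :=
  (∏ p : Box c × Box c, colFactor id p.1 p.2) *
    monomial (∑ l, Finsupp.single (lastBox hc l) (q l)) 1

section

variable {s s' : ℕ} {c : Fin s → ℕ} {c' : Fin s' → ℕ} (hc : ∀ l, 0 < c l) (q : Fin s →₀ ℕ)

theorem rename_boxPoly_of_not (π : Box c' ≃ Box c) (h : ¬ ColInjective π) :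
    rename (fun b => (π.symm b).1) (boxPoly hc q) = 0 := by
  simp only [ColInjective, not_forall] at h
  obtain ⟨b, b', h1, h2, h3⟩ := h
  rw [boxPoly, map_mul, map_prod, Finset.prod_eq_zero (Finset.mem_univ (b, b')), zero_mul]
  rw [rename_colFactor, colFactor, if_pos ⟨h3, h1⟩]
  simp [h2]

/-- Combining the new row of a box with its old column, possible by `col_lt`, is a column-preserving
permutation of the boxes, so it merely permutes the factors. -/
theorem rename_boxPoly {π : Box c ≃ Box c} (h : ColInjective π) :
    rename (fun b => (π.symm b).1) (boxPoly hc q) =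
      disc c * monomial (∑ l, Finsupp.single (π.symm (lastBox hc l)).1 (q l)) 1 := by
  rw [boxPoly, map_mul, map_prod, rename_monomial, Finsupp.mapDomain_finsetSum]
  simp only [Finsupp.mapDomain_single]
  congr 1
  have hlt : ∀ b : Box c, (b.2 : ℕ) < c (π.symm b).1 := fun b => by
    have := h.col_lt le_rfl (π.symm b)
    rwa [Equiv.apply_symm_apply] at this
  let τ : Box c → Box c := fun b => ⟨(π.symm b).1, ⟨b.2, hlt b⟩⟩
  have hτ2 : ∀ b, ((τ b).2 : ℕ) = b.2 := fun b => rfl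
  have hτ : Function.Bijective τ := Finite.injective_iff_bijective.mp fun b b' hbb => by
    have h1 : (τ b).1 = (τ b').1 := by rw [hbb]
    exact h b b' (by rw [← hτ2 b, ← hτ2 b', hbb]) h1
  let τ' := Equiv.ofBijective τ hτ
  rw [← prod_colFactor c, ← Equiv.prod_comp (τ'.prodCongr τ')
    (fun p => colFactor Sigma.fst p.1 p.2)]
  refine Finset.prod_congr rfl fun p _ => ?_
  rw [rename_colFactor]
  have hne : τ p.1 ≠ τ p.2 ↔ p.1 ≠ p.2 := hτ.1.ne_iff
  change _ = colFactor Sigma.fst (τ p.1) (τ p.2)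
  simp only [colFactor, hne, hτ2]
  rfl

-- At these exponents every bijection contributes 0 or 1, and the identity contributes 1 at `ground
-- c + q`, so the sum over bijections cannot cancel.
open Classical in
theorem coeff_rename_boxPoly (hm : Monotone c)
    (hq : ∀ l l', l ≤ l' → c l = c l' → q l' ≤ q l) (π : Box c ≃ Box c) (e : Fin s →₀ ℕ)
    (he : toLex (ground c + q) ≤ toLex e) :
    ∃ P : Prop, coeff e (rename (fun b => (π.symm b).1) (boxPoly hc q)) =
      (if e = ground c + q ∧ P then 1 else 0) ∧ (π = Equiv.refl _ → P) := by
  by_cases h : ColInjective π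
  swap
  · refine ⟨False, by simp [rename_boxPoly_of_not hc q π h], fun hπ => h ?_⟩
    subst hπ
    rintro ⟨l, k⟩ ⟨l', k'⟩ h1 h2
    obtain rfl : l = l' := h2
    have h3 : k = k' := Fin.ext h1
    rw [h3]
  set r := ∑ l, Finsupp.single (π.symm (lastBox hc l)).1 (q l) with hr
  -- The last box of row l lies in column c l - 1, so it moves to a row of length at least c l; last
  -- boxes of equally long rows share a column and move to distinct rows. Hence the choice of last
  -- boxes in `boxPoly`.
  have hrq : toLex r ≤ toLex q := by
    refine toLex_sum_single_le hm q hq (fun l => (π.symm (lastBox hc l)).1) (fun l => ?_)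
      fun l l' h1 h2 => ?_
    · have := h.col_lt le_rfl (π.symm (lastBox hc l))
      rw [Equiv.apply_symm_apply] at this
      have h3 : ((lastBox hc l).2 : ℕ) = c l - 1 := rfl
      rw [h3] at this
      have := hc l
      omega
    · refine congrArg Sigma.fst (h (lastBox hc l) (lastBox hc l') ?_ h2)
      show c l - 1 = c l' - 1
      rw [h1]
  have hmon : MonomialOrder.lex.Monic (disc c * monomial r (1 : ℂ)) :=
    (monic_disc c).mul MonomialOrder.monic_monomial_one
  have hdeg : MonomialOrder.lex.degree (disc c * monomial r (1 : ℂ)) = ground c + r := by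
    rw [MonomialOrder.degree_mul (disc_ne_zero c) (by simp), degree_disc hm,
      MonomialOrder.degree_monomial, if_neg one_ne_zero]
  refine ⟨r = q, ?_, fun hπ => ?_⟩
  · rw [rename_boxPoly hc q h, ← hr]
    split_ifs with hP
    · obtain ⟨rfl, hP⟩ := hP
      rw [← hP, ← hdeg]
      exact hmon
    · refine MonomialOrder.coeff_eq_zero_of_lt (m := MonomialOrder.lex) ?_
      rw [hdeg, MonomialOrder.lex_lt_iff]
      have h2 : toLex (ground c + r) ≤ toLex (ground c + q) := by
        rw [toLex_add, toLex_add]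
        exact add_le_add_right hrq _
      refine lt_of_le_of_ne (h2.trans he) fun heq => hP ?_
      have h3 : toLex (ground c + q) = toLex e := le_antisymm he (heq ▸ h2)
      have h4 : ground c + q = e := h3
      have h5 : ground c + r = e := heq
      exact ⟨h4.symm, add_left_cancel (h5.trans h4.symm)⟩
  · subst hπ
    rw [hr]
    exact (Finsupp.univ_sum_single q)

theorem dualFun_boxPoly_of_lt (hm : Monotone c)
    (hq : ∀ l l', l ≤ l' → c l = c l' → q l' ≤ q l) (e : Fin s →₀ ℕ)
    (he : toLex (ground c + q) < toLex e) : dualFun (boxPoly hc q) (clusterProd c e) = 0 := by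
  rw [dualFun_clusterProd]
  refine Finset.sum_eq_zero fun π _ => ?_
  obtain ⟨P, h, -⟩ := coeff_rename_boxPoly hc q hm hq π e he.le
  rw [h, if_neg]
  rintro ⟨rfl, -⟩
  exact lt_irrefl _ he

theorem dualFun_boxPoly_ne_zero (hm : Monotone c)
    (hq : ∀ l l', l ≤ l' → c l = c l' → q l' ≤ q l) :
    dualFun (boxPoly hc q) (clusterProd c (ground c + q)) ≠ 0 := by
  rw [dualFun_clusterProd]
  choose P h hP using fun π => coeff_rename_boxPoly hc q hm hq π (ground c + q) le_rfl
  classical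
  simp only [h, true_and]
  rw [Finset.sum_boole, Nat.cast_ne_zero]
  exact (Finset.card_pos.mpr ⟨Equiv.refl _, by simpa using hP _ rfl⟩).ne'

theorem dualFun_boxPoly_of_sum_le (hm : Monotone c) (hc' : ∀ l, 0 < c' l) (hm' : Monotone c')
    (hle : ∑ l, c l ^ 2 ≤ ∑ l, c' l ^ 2) (hne : ∀ h : s' = s, c' ≠ fun l => c (l.cast h))
    (e : Fin s' →₀ ℕ) : dualFun (boxPoly hc q) (clusterProd c' e) = 0 := by
  rw [dualFun_clusterProd]
  refine Finset.sum_eq_zero fun π _ => ?_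
  rw [rename_boxPoly_of_not, coeff_zero]
  intro h
  have hcard := h.card_eq hle
  have hs := hcard 0
  simp only [hc, hc', Finset.filter_true, Finset.card_univ, Fintype.card_fin] at hs
  subst hs
  exact hne rfl (eq_of_card_eq hm' hm fun k => (hcard k).symm)

end

/-- Ground energies of neighbours of equal charge differ by exactly the required gap, so the
difference condition says that the excess q decreases weakly there. -/
theorem IsAdm.exists_eq_ground_add {s : ℕ} {c : Fin s → ℕ} {e : Fin s →₀ ℕ} (hm : Monotone c)
    (h : IsAdm c e) :
    ∃ q, e = ground c + q ∧ ∀ l l', l ≤ l' → c l = c l' → q l' ≤ q l := by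
  obtain ⟨q, hq⟩ : ∃ q, e = ground c + q := le_iff_exists_add.mp fun l => h.ground_le l
  refine ⟨q, hq, fun l l' hll => ?_⟩
  obtain ⟨l', hl'⟩ := l'
  have key : ∀ n (hn : n < s), (l : ℕ) ≤ n → c l = c ⟨n, hn⟩ → q ⟨n, hn⟩ ≤ q l := by
    intro n
    induction n with
    | zero =>
      intro hn hle _
      have : l = ⟨0, hn⟩ := Fin.ext (Nat.le_zero.mp hle)
      rw [this]
    | succ n ih =>
      intro hn hle hcl
      rcases hle.eq_or_lt with heq | hlt
      · have : l = ⟨n + 1, hn⟩ := Fin.ext heq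
        rw [this]
      · have hn' : n < s := by omega
        have hc1 : c l ≤ c ⟨n, hn'⟩ := hm (Fin.mk_le_mk.mpr (Nat.lt_succ_iff.mp hlt))
        have hc2 : c ⟨n, hn'⟩ ≤ c ⟨n + 1, hn⟩ := hm (Fin.mk_le_mk.mpr n.le_succ)
        have hc3 : c l = c ⟨n, hn'⟩ := le_antisymm hc1 (hcl ▸ hc2)
        refine le_trans ?_ (ih hn' (Nat.lt_succ_iff.mp hlt) hc3)
        have hd := h.difference ⟨n, hn'⟩ ⟨n + 1, hn⟩ rfl (hc3.symm.trans hcl)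
        rw [hq, Finsupp.add_apply, Finsupp.add_apply, ground_apply, ground_apply, ← hcl, ← hc3]
          at hd
        simp only at hd
        obtain ⟨m, hm⟩ : ∃ m, s = n + 2 + m := ⟨s - (n + 2), by omega⟩
        have e1 : s - 1 - n = m + 1 := by omega
        have e2 : s - 1 - (n + 1) = m := by omega
        rw [e1, e2] at hd
        nlinarith
  exact key l' hl' hll

/-- The functional of a term with Σ c² least, and e lexicographically least for its charges, kills
every other term of the relation: `dualFun_boxPoly_of_sum_le` handles other charges and
`dualFun_boxPoly_of_lt` the same charges. -/
theorem linearIndependent_poly : LinearIndependent ℂ ClusterIndex.poly := by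
  classical
  rw [linearIndependent_iff']
  intro S g hg
  by_contra hcon
  push Not at hcon
  set S' := S.filter fun x => g x ≠ 0 with hS'
  have hne : S'.Nonempty := by
    obtain ⟨x, hx, hgx⟩ := hcon
    exact ⟨x, Finset.mem_filter.mpr ⟨hx, hgx⟩⟩
  obtain ⟨x₀, hx₀, hmin⟩ := S'.exists_min_image (fun x => ∑ l, x.c l ^ 2) hne
  obtain ⟨s, c, e₀, hc, hm, hadm₀⟩ := x₀
  let E := {e : Fin s →₀ ℕ // IsAdm c e}
  let mkE : E → ClusterIndex := fun e => ⟨s, c, e.1, hc, hm, e.2⟩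
  have hmkE : Function.Injective mkE := by
    intro a b hab
    simp only [mkE, ClusterIndex.mk.injEq, heq_eq_eq, true_and] at hab
    exact Subtype.ext hab
  obtain ⟨⟨e, hadm⟩, heS, hemin⟩ := (S'.preimage mkE hmkE.injOn).exists_min_image
    (fun e => toLex e.1) ⟨⟨e₀, hadm₀⟩, Finset.mem_preimage.mpr hx₀⟩
  rw [Finset.mem_preimage] at heS
  obtain ⟨q, hq, hanti⟩ := hadm.exists_eq_ground_add hm
  have h0 := congrArg (dualFun (boxPoly hc q)) hg
  rw [map_sum, map_zero, Finset.sum_eq_single (mkE ⟨e, hadm⟩)] at h0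
  · rw [map_smul, smul_eq_mul, mul_eq_zero] at h0
    rcases h0 with h0 | h0
    · exact (Finset.mem_filter.mp heS).2 h0
    · refine dualFun_boxPoly_ne_zero hc q hm hanti ?_
      rw [← hq]
      exact h0
  · rintro y hyS hne
    by_cases hgy : g y = 0
    · simp [hgy]
    have hyS' : y ∈ S' := Finset.mem_filter.mpr ⟨hyS, hgy⟩
    rw [map_smul, smul_eq_mul, mul_eq_zero]
    right
    obtain ⟨s', c', e', hc', hm', hadm'⟩ := y
    by_cases heq : ∃ h : s' = s, c' = fun l => c (l.cast h)
    · obtain ⟨rfl, heq⟩ := heq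
      obtain rfl : c' = c := heq
      have h1 : toLex e ≤ toLex e' := hemin ⟨e', hadm'⟩ (Finset.mem_preimage.mpr hyS')
      have h2 : toLex e ≠ toLex e' := fun h => hne (by
        have h3 : e = e' := h
        subst h3
        rfl)
      refine dualFun_boxPoly_of_lt hc q hm hanti e' ?_
      rw [← hq]
      exact lt_of_le_of_ne h1 h2
    · push Not at heq
      exact dualFun_boxPoly_of_sum_le hc q hm hc' hm' (hmin _ hyS') heq e'
  · intro h
    exact absurd (Finset.mem_filter.mp heS).1 h

end QuasiParticle

/-! ### Universal enveloping algebras -/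

namespace UniversalEnvelopingAlgebra

variable {R L : Type*} [CommRing R] [LieRing L] [LieAlgebra R L]

/-- The elements satisfying C form a subalgebra containing L, and by the universal property the
identity factors through it. -/
theorem induction {C : UniversalEnvelopingAlgebra R L → Prop}
    (algebraMap : ∀ r, C (algebraMap R _ r)) (ι : ∀ x, C (ι R x))
    (mul : ∀ a b, C a → C b → C (a * b)) (add : ∀ a b, C a → C b → C (a + b))
    (u : UniversalEnvelopingAlgebra R L) : C u := by
  let S : Subalgebra R (UniversalEnvelopingAlgebra R L) :=
    { carrier := {u | C u}
      mul_mem' := fun {a b} => mul a b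
      add_mem' := fun {a b} => add a b
      algebraMap_mem' := algebraMap }
  let φ : L →ₗ⁅R⁆ S :=
    { toFun := fun x => ⟨UniversalEnvelopingAlgebra.ι R x, ι x⟩
      map_add' := fun x y => Subtype.ext (map_add _ x y)
      map_smul' := fun r x => Subtype.ext (map_smul _ r x)
      map_lie' := fun {x y} => Subtype.ext (LieHom.map_lie (UniversalEnvelopingAlgebra.ι R) x y) }
  have h : S.val.comp (lift R φ) = AlgHom.id R _ := by
    refine hom_ext R (LieHom.ext fun x => ?_)
    have := lift_ι_apply (R := R) φ x
    change ((lift R φ (UniversalEnvelopingAlgebra.ι R x) : S) : UniversalEnvelopingAlgebra R L) = _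
    rw [this]
    rfl
  have h2 := congrArg (fun F => F u) h
  change ((lift R φ u : S) : UniversalEnvelopingAlgebra R L) = u at h2
  rw [← h2]
  exact (lift R φ u).2

theorem ι_lie (x y : L) : ι R ⁅x, y⁆ = ι R x * ι R y - ι R y * ι R x := by
  rw [LieHom.map_lie, LieRing.of_associative_ring_bracket]

end UniversalEnvelopingAlgebra

/-! ### From the twisted affine algebra to the polynomial model -/

namespace PrincipalSl2

open MvPolynomial

/-! ### Loops with coefficients in nonnegative degrees -/

theorem coeff_mul_eq_zero {a b : Loop} {N K n : ℤ} (ha : ∀ m < N, a.coeff m = 0)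
    (hb : ∀ m < K, b.coeff m = 0) (hn : n < N + K) : (a * b).coeff n = 0 := by
  rw [AddMonoidAlgebra.coeff_mul, Finsupp.sum]
  refine Finset.sum_eq_zero fun m hm => Finset.sum_eq_zero fun l hl => ?_
  rw [Finsupp.mem_support_iff] at hm hl
  have h1 : N ≤ m := not_lt.mp fun h => hm (ha m h)
  have h2 : K ≤ l := not_lt.mp fun h => hl (hb l h)
  dsimp only
  rw [if_neg (by omega)]

theorem coeff_zero_mul {a b : Loop} (ha : ∀ m < 0, a.coeff m = 0) (hb : ∀ m < 0, b.coeff m = 0) :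
    (a * b).coeff 0 = a.coeff 0 * b.coeff 0 := by
  rw [AddMonoidAlgebra.coeff_mul, Finsupp.sum, Finset.sum_eq_single 0]
  · rw [Finsupp.sum, Finset.sum_eq_single 0]
    · simp
    · intro l _ hl
      simp [hl]
    · intro h
      rw [Finsupp.notMem_support_iff] at h
      simp [h]
  · intro m hm hm0
    refine Finset.sum_eq_zero fun l hl => ?_
    rw [Finsupp.mem_support_iff] at hm hl
    have h1 : 0 ≤ m := not_lt.mp fun h => hm (ha m h)
    have h2 : 0 ≤ l := not_lt.mp fun h => hl (hb l h)
    dsimp only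
    rw [if_neg (by omega)]
  · intro h
    rw [Finsupp.notMem_support_iff] at h
    simp [h]

/-- The loop part of an element. -/
def loop : gHat →ₗ[ℂ] Loop where
  toFun x := x.1.loop
  map_add' _ _ := rfl
  map_smul' _ _ := rfl

/-- The coefficient of `c`. -/
def cPart : gHat →ₗ[ℂ] ℂ where
  toFun x := x.1.cPart
  map_add' _ _ := rfl
  map_smul' _ _ := rfl

/-- The coefficient of `d`. -/
def dPart : gHat →ₗ[ℂ] ℂ where
  toFun x := x.1.dPart
  map_add' _ _ := rfl
  map_smul' _ _ := rfl

/-- The coefficient of `tⁿ`. -/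
def coeff (n : ℤ) : gHat →ₗ[ℂ] Matrix (Fin 2) (Fin 2) ℂ where
  toFun x := (loop x).coeff n
  map_add' _ _ := rfl
  map_smul' _ _ := rfl

theorem coeff_apply (n : ℤ) (x : gHat) : coeff n x = (loop x).coeff n := rfl

theorem gHat_ext {x y : gHat} (h1 : ∀ n, coeff n x = coeff n y) (h2 : cPart x = cPart y)
    (h3 : dPart x = dPart y) : x = y := by
  refine Subtype.ext (Affine.ext ?_ h2 h3)
  ext n i j
  exact congrFun₂ (h1 n) i j

theorem loop_lie (x y : gHat) : loop ⁅x, y⁆ =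
    loop x * loop y - loop y * loop x + dPart x • D (loop y) - dPart y • D (loop x) := rfl

theorem cPart_lie (x y : gHat) : cPart ⁅x, y⁆ = (1 / 2 : ℂ) * tr0 (D (loop x) * loop y) := rfl

theorem dPart_lie (x y : gHat) : dPart ⁅x, y⁆ = 0 := rfl

theorem coeff_even {n : ℤ} (hn : Even n) (x : gHat) : coeff n x = coeff n x 0 0 • h := by
  obtain ⟨r, hr⟩ := Submodule.mem_span_singleton.mp (x.2.1 n hn)
  change r • h = coeff n x at hr
  rw [← hr]
  simp [h]

theorem coeff_odd {n : ℤ} (hn : Odd n) (x : gHat) :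
    coeff n x = ((coeff n x 0 1 + coeff n x 1 0) / 2) • (e + f) +
      ((coeff n x 1 0 - coeff n x 0 1) / 2) • (f - e) := by
  obtain ⟨r, s, hr⟩ := Submodule.mem_span_pair.mp (x.2.2 n hn)
  change r • e + s • f = coeff n x at hr
  rw [← hr]
  ext i j
  fin_cases i <;> fin_cases j <;> simp [e, f] <;> ring

theorem loop_B {n : ℤ} (hn : Odd n) : loop (B n) = tm n (e + f) := by
  rw [B, dif_pos hn]; rfl

theorem loop_X (n : ℤ) : loop (X n) = tm n (if Odd n then f - e else h) := by
  rw [X]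
  split_ifs <;> rfl

theorem coeff_B {n : ℤ} (hn : Odd n) (m : ℤ) : coeff m (B n) = if n = m then e + f else 0 := by
  rw [coeff_apply, loop_B hn, AddMonoidAlgebra.coeff_single, Finsupp.single_apply]

theorem coeff_X (n m : ℤ) :
    coeff m (X n) = if n = m then (if Odd n then f - e else h) else 0 := by
  rw [coeff_apply, loop_X, AddMonoidAlgebra.coeff_single, Finsupp.single_apply]

@[simp] theorem cPart_B (n : ℤ) : cPart (B n) = 0 := by
  rw [B]; split_ifs <;> rfl

@[simp] theorem dPart_B (n : ℤ) : dPart (B n) = 0 := by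
  rw [B]; split_ifs <;> rfl

@[simp] theorem cPart_X (n : ℤ) : cPart (X n) = 0 := by
  rw [X]; split_ifs <;> rfl

@[simp] theorem dPart_X (n : ℤ) : dPart (X n) = 0 := by
  rw [X]; split_ifs <;> rfl

@[simp] theorem coeff_c (n : ℤ) : coeff n c = 0 := rfl
@[simp] theorem cPart_c : cPart c = 1 := rfl
@[simp] theorem dPart_c : dPart c = 0 := rfl
@[simp] theorem coeff_d (n : ℤ) : coeff n d = 0 := rfl
@[simp] theorem cPart_d : cPart d = 0 := rfl
@[simp] theorem dPart_d : dPart d = 1 := rfl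

/-! ### The positive part -/

/-- `x` is a combination of `c`, `d` and elements of nonnegative degree. -/
def IsNonneg (x : gHat) : Prop := ∀ n < 0, coeff n x = 0

/-- The degree zero loop parts are multiples of h and commute, and the cocycle pairs only degree
zero terms, which `D` kills. Hence any functional on the Cartan subalgebra extends to a character of
the nonnegative part. -/
theorem IsNonneg.lie {x y : gHat} (hx : IsNonneg x) (hy : IsNonneg y) :
    IsNonneg ⁅x, y⁆ ∧ coeff 0 ⁅x, y⁆ = 0 ∧ cPart ⁅x, y⁆ = 0 := by
  have hx' : ∀ m < 0, (loop x).coeff m = 0 := hx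
  have hy' : ∀ m < 0, (loop y).coeff m = 0 := hy
  have hD : ∀ m < 0, (D (loop x)).coeff m = 0 := fun m hm => by rw [D_coeff, hx' m hm, smul_zero]
  refine ⟨fun n hn => ?_, ?_, ?_⟩
  · rw [coeff_apply, loop_lie]
    simp only [AddMonoidAlgebra.coeff_add, AddMonoidAlgebra.coeff_sub, Finsupp.add_apply,
      Finsupp.sub_apply, AddMonoidAlgebra.coeff_smul, Finsupp.smul_apply, D_coeff, hx' n hn,
      hy' n hn, coeff_mul_eq_zero hx' hy' (by simpa using hn),
      coeff_mul_eq_zero hy' hx' (by simpa using hn)]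
    simp
  · rw [coeff_apply, loop_lie]
    simp only [AddMonoidAlgebra.coeff_add, AddMonoidAlgebra.coeff_sub, Finsupp.add_apply,
      Finsupp.sub_apply, AddMonoidAlgebra.coeff_smul, Finsupp.smul_apply, D_coeff,
      coeff_zero_mul hx' hy', coeff_zero_mul hy' hx']
    rw [← coeff_apply, ← coeff_apply, coeff_even Even.zero x, coeff_even Even.zero y]
    simp [smul_comm (coeff 0 y 0 0)]
  · rw [cPart_lie]
    change 1 / 2 * ((D (loop x) * loop y).coeff 0).trace = 0
    rw [coeff_zero_mul hD hy', D_coeff]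
    simp

theorem mem_nPlus_iff (x : gHat) :
    x ∈ nPlus ↔ IsNonneg x ∧ coeff 0 x = 0 ∧ cPart x = 0 ∧ dPart x = 0 := by
  constructor
  · intro hx
    induction hx using Submodule.span_induction with
    | mem x hx =>
      obtain ⟨n, hn, hx⟩ := hx
      have hne : (n : ℂ) ≠ 0 := by exact_mod_cast hn.ne'
      have h1 : ∀ m : ℤ, m ≠ n → coeff m x = 0 := by
        intro m hm
        have h2 : coeff m ⁅d, x⁆ = (m : ℂ) • coeff m x := by
          rw [coeff_apply, loop_lie]
          have h3 : loop d = 0 := rfl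
          simp [h3, D_coeff, coeff_apply]
        rw [hx, map_smul, ← sub_eq_zero, ← sub_smul, smul_eq_zero] at h2
        refine h2.resolve_left ?_
        rw [sub_eq_zero]
        exact_mod_cast hm.symm
      refine ⟨fun m hm => h1 m (by omega), h1 0 (by omega), ?_, ?_⟩
      · have h2 : cPart ⁅d, x⁆ = 0 := by
          rw [cPart_lie]
          have h3 : loop d = 0 := rfl
          simp [h3]
        rw [hx, map_smul, smul_eq_zero] at h2
        exact h2.resolve_left hne
      · have h2 := dPart_lie d x
        rw [hx, map_smul, smul_eq_zero] at h2
        exact h2.resolve_left hne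
    | zero => simp [IsNonneg]
    | add x y _ _ hx hy =>
      exact ⟨fun n hn => by rw [map_add, hx.1 n hn, hy.1 n hn, add_zero],
        by rw [map_add, hx.2.1, hy.2.1, add_zero], by rw [map_add, hx.2.2.1, hy.2.2.1, add_zero],
        by rw [map_add, hx.2.2.2, hy.2.2.2, add_zero]⟩
    | smul r x _ hx =>
      exact ⟨fun n hn => by rw [map_smul, hx.1 n hn, smul_zero],
        by rw [map_smul, hx.2.1, smul_zero], by rw [map_smul, hx.2.2.1, smul_zero],
        by rw [map_smul, hx.2.2.2, smul_zero]⟩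
  · rintro ⟨h1, h2, h3, h4⟩
    have hsum : x = ∑ n ∈ (loop x).coeff.support,
        if Odd n then ((coeff n x 0 1 + coeff n x 1 0) / 2) • B n +
          ((coeff n x 1 0 - coeff n x 0 1) / 2) • X n else coeff n x 0 0 • X n := by
      have hz : ∀ n : ℤ, coeff n x = if Odd n then
          ((coeff n x 0 1 + coeff n x 1 0) / 2) • coeff n (B n) +
          ((coeff n x 1 0 - coeff n x 0 1) / 2) • coeff n (X n)
          else coeff n x 0 0 • coeff n (X n) := by
        intro n
        split_ifs with hn
        · rw [coeff_B hn, coeff_X, if_pos rfl, if_pos rfl, if_pos hn, ← coeff_odd hn]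
        · rw [coeff_X, if_pos rfl, if_neg hn, ← coeff_even (Int.not_odd_iff_even.mp hn)]
      refine gHat_ext (fun m => ?_) ?_ ?_
      · rw [map_sum, Finset.sum_eq_single m]
        · conv_lhs => rw [hz m]
          split_ifs <;> simp
        · intro n _ hn
          split_ifs with ho
          · simp [coeff_B ho, coeff_X, hn]
          · simp [coeff_X, hn]
        · intro hm
          have : coeff m x = 0 := Finsupp.notMem_support_iff.mp hm
          simp [this]
      · rw [h3, map_sum, Finset.sum_eq_zero]
        intro n _
        split_ifs <;> simp
      · rw [h4, map_sum, Finset.sum_eq_zero]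
        intro n _
        split_ifs <;> simp
    rw [hsum]
    refine Submodule.sum_mem _ fun n hn => ?_
    have hpos : 0 < n := by
      rw [Finsupp.mem_support_iff] at hn
      rcases lt_trichotomy n 0 with h | h | h
      · exact absurd (h1 n h) hn
      · subst h; exact absurd h2 hn
      · exact h
    have hd : ∀ y : gHat, (∀ m, m ≠ n → coeff m y = 0) → cPart y = 0 → dPart y = 0 →
        y ∈ nPlus := by
      intro y hy hy2 hy3
      refine Submodule.subset_span ⟨n, hpos, ?_⟩
      have h3 : loop d = 0 := rfl
      refine gHat_ext (fun m => ?_) ?_ ?_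
      · rw [map_smul, coeff_apply, loop_lie]
        simp only [h3, dPart_d, hy3]
        rcases eq_or_ne m n with rfl | hm
        · simp [D_coeff, coeff_apply]
        · have := hy m hm
          rw [coeff_apply] at this
          simp [D_coeff, coeff_apply, this]
      · rw [map_smul, hy2, cPart_lie, h3]
        simp
      · rw [map_smul, hy3, dPart_lie]
        simp
    have hX : X n ∈ nPlus := hd _ (fun m hm => by rw [coeff_X, if_neg hm.symm]) (by simp) (by simp)
    split_ifs with ho
    · exact Submodule.add_mem _ (Submodule.smul_mem _ _ (hd _
        (fun m hm => by rw [coeff_B ho, if_neg hm.symm]) (by simp) (by simp)))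
        (Submodule.smul_mem _ _ hX)
    · exact Submodule.smul_mem _ _ hX

/-! ### Verma modules as polynomial rings -/

/-- The degrees of the vectors `B(-(2a+1))` and `X(-(a+1))`. -/
def genDeg : ℕ ⊕ ℕ → ℤ := Sum.elim (fun a => -(2 * a + 1)) (fun a => -(a + 1))

theorem genDeg_neg (i : ℕ ⊕ ℕ) : genDeg i < 0 := by
  rcases i with a | a <;> simp only [genDeg, Sum.elim_inl, Sum.elim_inr] <;> omega

theorem odd_genDeg_inl (a : ℕ) : Odd (-(2 * a + 1) : ℤ) := (odd_two_mul_add_one (a : ℤ)).neg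

/-- The coordinates along `e + f`, respectively along `h` and `f - e`. -/
def genCoord : ℕ ⊕ ℕ → Matrix (Fin 2) (Fin 2) ℂ →ₗ[ℂ] ℂ :=
  Sum.elim
    (fun _ => (2⁻¹ : ℂ) • (Matrix.entryLinearMap ℂ ℂ 0 1 + Matrix.entryLinearMap ℂ ℂ 1 0))
    (fun _ => Matrix.entryLinearMap ℂ ℂ 0 0 +
      (2⁻¹ : ℂ) • (Matrix.entryLinearMap ℂ ℂ 1 0 - Matrix.entryLinearMap ℂ ℂ 0 1))

theorem finite_genCoord (x : gHat) :
    (Function.support fun i => genCoord i (coeff (genDeg i) x)).Finite := by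
  have h : (genDeg ⁻¹' ((loop x).coeff.support : Set ℤ)).Finite := by
    refine Set.Finite.preimage' (Finset.finite_toSet _) fun n _ => ?_
    refine ((Set.finite_singleton (Sum.inl ((-n - 1) / 2).toNat)).union
      (Set.finite_singleton (Sum.inr (-n - 1).toNat))).subset ?_
    rintro (a | a) ha
    · left
      have h1 : -(2 * (a : ℤ) + 1) = n := ha
      exact congrArg Sum.inl (by omega)
    · right
      have h1 : -((a : ℤ) + 1) = n := ha
      exact congrArg Sum.inr (by omega)
  refine h.subset fun i hi => ?_
  rw [Function.mem_support] at hi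
  rw [Set.mem_preimage, Finset.mem_coe, Finsupp.mem_support_iff]
  intro h0
  have h1 : coeff (genDeg i) x = 0 := h0
  rw [h1, map_zero] at hi
  exact hi rfl

/-- The coordinates of an element along `B(n)`, `X(n)`, `n < 0`. -/
def coord : gHat →ₗ[ℂ] (ℕ ⊕ ℕ) →₀ ℂ where
  toFun x := Finsupp.ofSupportFinite _ (finite_genCoord x)
  map_add' x y := by
    ext i
    simp [Finsupp.ofSupportFinite_coe]
  map_smul' r x := by
    ext i
    simp [Finsupp.ofSupportFinite_coe]

theorem coord_apply (x : gHat) (i : ℕ ⊕ ℕ) : coord x i = genCoord i (coeff (genDeg i) x) := rfl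

theorem coord_eq_zero_iff (x : gHat) : coord x = 0 ↔ IsNonneg x := by
  constructor
  · intro hx n hn
    have hX : genCoord (Sum.inr 0) (coeff n x) = 0 := by
      have h1 := DFunLike.congr_fun hx (Sum.inr (-n - 1).toNat)
      rw [coord_apply] at h1
      have h2 : genDeg (Sum.inr (-n - 1).toNat) = n := by
        simp only [genDeg, Sum.elim_inr]; omega
      rw [h2] at h1
      exact h1
    simp only [genCoord, Sum.elim_inr, LinearMap.add_apply, LinearMap.smul_apply,
      LinearMap.sub_apply, Matrix.entryLinearMap_apply, smul_eq_mul] at hX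
    rcases Int.even_or_odd n with he | ho
    · rw [coeff_even he] at hX ⊢
      have : coeff n x 0 0 = 0 := by simpa [h] using hX
      rw [this, zero_smul]
    · have hB : genCoord (Sum.inl 0) (coeff n x) = 0 := by
        have h1 := DFunLike.congr_fun hx (Sum.inl ((-n - 1) / 2).toNat)
        rw [coord_apply] at h1
        have h2 : genDeg (Sum.inl ((-n - 1) / 2).toNat) = n := by
          obtain ⟨k, rfl⟩ := ho
          simp only [genDeg, Sum.elim_inl]; omega
        rw [h2] at h1
        exact h1
      simp only [genCoord, Sum.elim_inl, LinearMap.add_apply, LinearMap.smul_apply,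
        Matrix.entryLinearMap_apply, smul_eq_mul] at hB
      have h00 : coeff n x 0 0 = 0 := ((mem_span_ef _).mp (x.2.2 n ho)).1
      rw [h00, zero_add] at hX
      rw [coeff_odd ho, div_eq_inv_mul, div_eq_inv_mul, hX, hB]
      simp
  · intro hx
    ext i
    rw [coord_apply, hx _ (genDeg_neg i), map_zero, Finsupp.zero_apply]

/-- The vectors `B(n)`, `X(n)` of negative degree. -/
def genVec : ℕ ⊕ ℕ → gHat := Sum.elim (fun a => B (-(2 * a + 1))) (fun a => X (-(a + 1)))

theorem coord_B (a : ℕ) : coord (B (-(2 * a + 1))) = Finsupp.single (Sum.inl a) 1 := by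
  ext i
  rw [coord_apply, coeff_B (odd_genDeg_inl a)]
  rcases i with b | b
  · rw [Finsupp.single_apply]
    by_cases hab : a = b
    · subst hab
      simp [genDeg, genCoord, e, f]
      norm_num
    · rw [if_neg (by simp only [genDeg, Sum.elim_inl]; omega), if_neg (by simpa using hab),
        map_zero]
  · have h0 : Finsupp.single (Sum.inl a : ℕ ⊕ ℕ) (1 : ℂ) (Sum.inr b) = 0 := by simp
    rw [h0]
    split_ifs <;> simp [genCoord, e, f]

theorem coord_X (a : ℕ) : coord (X (-(a + 1))) = Finsupp.single (Sum.inr a) 1 := by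
  ext i
  rw [coord_apply, coeff_X]
  rcases i with b | b
  · have h0 : Finsupp.single (Sum.inr a : ℕ ⊕ ℕ) (1 : ℂ) (Sum.inl b) = 0 := by simp
    rw [h0]
    split_ifs with h1 h2 <;> simp [genCoord, e, f, h]
  · rw [Finsupp.single_apply]
    by_cases hab : a = b
    · subst hab
      have h0 : -((a : ℤ) + 1) = genDeg (Sum.inr a) := rfl
      rw [if_pos h0, if_pos rfl]
      split_ifs
      · simp [genCoord, e, f]
        norm_num
      · simp [genCoord, h]
    · rw [if_neg (by simp only [genDeg, Sum.elim_inr]; omega), if_neg (by simpa using hab),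
        map_zero]

variable (Λ : Module.Dual ℂ cartan)

theorem X_mem_cartan : X 0 ∈ cartan := Submodule.subset_span (by simp)
theorem c_mem_cartan : c ∈ cartan := Submodule.subset_span (by simp)
theorem d_mem_cartan : d ∈ cartan := Submodule.subset_span (by simp)

/-- The component in the Cartan subalgebra. -/
def cartanPart : gHat →ₗ[ℂ] cartan :=
  LinearMap.smulRight (Matrix.entryLinearMap ℂ ℂ 0 0 ∘ₗ coeff 0) (⟨X 0, X_mem_cartan⟩ : cartan) +
  LinearMap.smulRight cPart (⟨c, c_mem_cartan⟩ : cartan) +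
  LinearMap.smulRight dPart (⟨d, d_mem_cartan⟩ : cartan)

theorem coe_cartanPart (x : gHat) :
    (cartanPart x : gHat) = coeff 0 x 0 0 • X 0 + cPart x • c + dPart x • d := rfl

theorem cartanPart_coe (y : cartan) : cartanPart y = y := by
  have key : ∀ x ∈ cartan, (cartanPart x : gHat) = x := by
    intro x hx
    refine LinearMap.eqOn_span (f := cartan.subtype ∘ₗ cartanPart) (g := LinearMap.id) ?_ hx
    have hX0 : coeff 0 (X 0) = h := by simp [coeff_X]
    have h00 : h 0 0 = 1 := by simp [h]
    rintro z (rfl | rfl | rfl)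
    · change (cartanPart (X 0) : gHat) = X 0
      simp [coe_cartanPart, hX0, h00]
    · change (cartanPart c : gHat) = c
      simp [coe_cartanPart]
    · change (cartanPart d : gHat) = d
      simp [coe_cartanPart]
  exact Subtype.ext (key y y.2)

theorem IsNonneg.sub_cartanPart_mem {x : gHat} (hx : IsNonneg x) :
    x - cartanPart x ∈ nPlus := by
  rw [mem_nPlus_iff, coe_cartanPart]
  refine ⟨fun n hn => ?_, ?_, ?_, ?_⟩
  · simp [hx n hn, coeff_X, hn.ne']
  · rw [map_sub, coeff_even Even.zero x]
    simp [coeff_X, h]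
  · simp
  · simp

theorem coord_of_mem_cartan {y : gHat} (hy : y ∈ cartan) : IsNonneg y := by
  intro n hn
  have := cartanPart_coe ⟨y, hy⟩
  rw [Subtype.ext_iff, coe_cartanPart] at this
  change _ = y at this
  rw [← this]
  simp [coeff_X, hn.ne']

/-- The data by which the Verma module is induced. -/
def inducingData : InducingData ℂ gHat (ℕ ⊕ ℕ) where
  vec := genVec
  coord := coord
  char := Λ ∘ₗ cartanPart
  coord_vec := by
    rintro (a | a)
    · exact coord_B a
    · exact coord_X a
  char_vec := by
    have h0 : ∀ x : gHat, coeff 0 x = 0 → cPart x = 0 → dPart x = 0 → cartanPart x = 0 := by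
      intro x h1 h2 h3
      exact Subtype.ext (by rw [coe_cartanPart, h1, h2, h3]; simp)
    rintro (a | a)
    · change Λ (cartanPart (B _)) = 0
      rw [h0, map_zero]
      · rw [coeff_B (odd_genDeg_inl a), if_neg (by omega)]
      · simp
      · simp
    · change Λ (cartanPart (X _)) = 0
      rw [h0, map_zero]
      · rw [coeff_X, if_neg (by omega)]
      · simp
      · simp
  coord_lie x y hx hy := by
    rw [coord_eq_zero_iff] at *
    exact (hx.lie hy).1
  char_lie x y hx hy := by
    rw [coord_eq_zero_iff] at *
    have h1 := hx.lie hy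
    change Λ (cartanPart _) = 0
    have : cartanPart ⁅x, y⁆ = 0 :=
      Subtype.ext (by rw [coe_cartanPart, h1.2.1, h1.2.2, dPart_lie]; simp)
    rw [this, map_zero]

/-- A linear order of the generators. -/
abbrev genOrder : LinearOrder (ℕ ⊕ ℕ) := LinearOrder.lift' (toLex : ℕ ⊕ ℕ → ℕ ⊕ₗ ℕ) toLex.injective

/-- The action on polynomials which models the Verma module. -/
def polyRep : gHat →ₗ⁅ℂ⁆ Module.End ℂ (MvPolynomial (ℕ ⊕ ℕ) ℂ) :=
  letI := genOrder
  (inducingData Λ).rep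

theorem polyRep_sub_mem {n : ℕ} {p : MvPolynomial (ℕ ⊕ ℕ) ℂ} (hp : p ∈ degLT ℂ (ℕ ⊕ ℕ) n)
    (x : gHat) : polyRep Λ x p - (inducingData Λ).top x * p ∈ degLT ℂ (ℕ ⊕ ℕ) n :=
  letI := genOrder
  (inducingData Λ).rep_sub_mem hp x

theorem polyRep_one {x : gHat} (hx : IsNonneg x) : polyRep Λ x 1 = C (Λ (cartanPart x)) :=
  letI := genOrder
  (inducingData Λ).rep_one ((coord_eq_zero_iff x).mpr hx)

/-- The action of the universal enveloping algebra on polynomials. -/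
def polyAct : U →ₐ[ℂ] Module.End ℂ (MvPolynomial (ℕ ⊕ ℕ) ℂ) :=
  UniversalEnvelopingAlgebra.lift ℂ (polyRep Λ)

theorem polyAct_inc (x : gHat) : polyAct Λ (inc x) = polyRep Λ x :=
  UniversalEnvelopingAlgebra.lift_ι_apply ℂ _ x

theorem vermaIdeal_le {u : U} (hu : u ∈ vermaIdeal Λ) : polyAct Λ u 1 = 0 := by
  induction hu using Submodule.span_induction with
  | mem u hu =>
    rcases hu with ⟨x, hx, rfl⟩ | ⟨y, rfl⟩
    · rw [mem_nPlus_iff] at hx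
      have : cartanPart x = 0 :=
        Subtype.ext (by rw [coe_cartanPart, hx.2.1, hx.2.2.1, hx.2.2.2]; simp)
      rw [polyAct_inc, polyRep_one Λ hx.1, this, map_zero, C_0]
    · rw [map_sub, polyAct_inc, LinearMap.sub_apply, polyRep_one Λ (coord_of_mem_cartan y.2),
        cartanPart_coe, AlgHom.commutes, Module.algebraMap_end_apply, smul_eq_C_mul, mul_one,
        sub_self]
  | zero => simp
  | add u u' _ _ hu hu' => rw [map_add, LinearMap.add_apply, hu, hu', add_zero]
  | smul a u _ hu => rw [smul_eq_mul, map_mul, Module.End.mul_apply, hu, map_zero]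

/-- The map from the Verma module to polynomials. -/
def toPoly : Verma Λ →ₗ[ℂ] MvPolynomial (ℕ ⊕ ℕ) ℂ :=
  ((vermaIdeal Λ).restrictScalars ℂ).liftQ
    ((LinearMap.applyₗ (1 : MvPolynomial (ℕ ⊕ ℕ) ℂ)) ∘ₗ (polyAct Λ).toLinearMap)
    fun _ hu => vermaIdeal_le Λ hu

theorem toPoly_mk (u : U) : toPoly Λ ((vermaIdeal Λ).mkQ u) = polyAct Λ u 1 := rfl

theorem toPoly_hwVector : toPoly Λ (hwVector Λ) = 1 := by
  rw [hwVector, toPoly_mk, map_one (polyAct Λ)]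
  rfl

theorem toPoly_smul (u : U) (v : Verma Λ) : toPoly Λ (u • v) = polyAct Λ u (toPoly Λ v) := by
  obtain ⟨w, rfl⟩ := (vermaIdeal Λ).mkQ_surjective v
  rw [← map_smul, toPoly_mk, toPoly_mk, smul_eq_mul, map_mul, Module.End.mul_apply]

theorem inc_smul_hwVector {x : gHat} (hx : IsNonneg x) :
    inc x • hwVector Λ = Λ (cartanPart x) • hwVector Λ := by
  have h1 : inc (x - cartanPart x) ∈ vermaIdeal Λ :=
    Submodule.subset_span (Or.inl ⟨_, hx.sub_cartanPart_mem, rfl⟩)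
  have h2 : inc (cartanPart x) - algebraMap ℂ U (Λ (cartanPart x)) ∈ vermaIdeal Λ :=
    Submodule.subset_span (Or.inr ⟨_, rfl⟩)
  have h3 := Submodule.add_mem _ h1 h2
  have h4 : inc (x - cartanPart x) = inc x - inc (cartanPart x) :=
    map_sub (UniversalEnvelopingAlgebra.ι ℂ : gHat →ₗ⁅ℂ⁆ U).toLinearMap _ _
  rw [h4, sub_add_sub_cancel, ← Submodule.Quotient.mk_eq_zero, Submodule.Quotient.mk_sub,
    sub_eq_zero] at h3
  rw [hwVector, ← map_smul, smul_eq_mul, mul_one, Submodule.mkQ_apply, h3,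
    Algebra.algebraMap_eq_smul_one]
  rfl

/-- The universal property gives an equivariant map θ back to the Verma module with θ 1 = v_Λ. Then
θ ∘ `toPoly` is U-linear and fixes the generator. -/
theorem toPoly_injective : Function.Injective (toPoly Λ) := by
  let := genOrder
  let φ : gHat →ₗ⁅ℂ⁆ Module.End ℂ (Verma Λ) :=
    ((Algebra.lsmul ℂ ℂ (Verma Λ) : U →ₐ[ℂ] Module.End ℂ (Verma Λ)) :
      U →ₗ⁅ℂ⁆ Module.End ℂ (Verma Λ)).comp (UniversalEnvelopingAlgebra.ι ℂ)
  have hφ : ∀ x v, φ x v = inc x • v := fun x v => rfl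
  let θ := (inducingData Λ).toModule φ (hwVector Λ)
  have hθ : ∀ x p, θ (polyRep Λ x p) = inc x • θ p := by
    refine (inducingData Λ).toModule_rep φ (hwVector Λ) fun x hx => ?_
    rw [hφ]
    exact inc_smul_hwVector Λ ((coord_eq_zero_iff x).mp hx)
  have hU : ∀ (u : U) p, θ (polyAct Λ u p) = u • θ p := by
    intro u
    induction u using UniversalEnvelopingAlgebra.induction with
    | algebraMap r => intro p; simp [Module.algebraMap_end_apply]
    | ι x => intro p; rw [polyAct_inc, hθ]
    | mul a b ha hb => intro p; rw [map_mul, Module.End.mul_apply, ha, hb, mul_smul]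
    | add a b ha hb => intro p; rw [map_add, LinearMap.add_apply, map_add, ha, hb, add_smul]
  refine Function.LeftInverse.injective (g := θ) fun v => ?_
  obtain ⟨u, rfl⟩ := (vermaIdeal Λ).mkQ_surjective v
  rw [toPoly_mk, hU]
  have : θ 1 = hwVector Λ := (inducingData Λ).toModule_one φ _
  rw [this, hwVector, ← map_smul, smul_eq_mul, mul_one]

/-- Acting with `genVec i` on a preimage of m' produces X_i m' up to terms of degree already
attained. -/
theorem toPoly_surjective : Function.Surjective (toPoly Λ) := by
  suffices h : ∀ n, degLT ℂ (ℕ ⊕ ℕ) n ≤ LinearMap.range (toPoly Λ) by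
    intro p
    obtain ⟨n, hn⟩ := exists_mem_degLT p
    exact h n hn
  intro n
  induction n with
  | zero => rw [degLT_zero]; exact bot_le
  | succ n ih =>
    rw [degLT_eq_span, Submodule.span_le]
    rintro _ ⟨m, hm, rfl⟩
    rcases eq_or_ne m 0 with rfl | hm0
    · exact ⟨hwVector Λ, toPoly_hwVector Λ⟩
    · obtain ⟨i, hi⟩ := Finsupp.support_nonempty_iff.mpr hm0
      have hm1 : m = Finsupp.single i 1 + (m - Finsupp.single i 1) := by
        rw [add_tsub_cancel_of_le]
        rw [Finsupp.single_le_iff]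
        exact Nat.one_le_iff_ne_zero.mpr (Finsupp.mem_support_iff.mp hi)
      set m' := m - Finsupp.single i 1
      have hdeg : m'.degree < n := by
        have h1 := congrArg Finsupp.degree hm1
        rw [map_add, Finsupp.degree_single] at h1
        have h2 : m.degree < n + 1 := hm
        omega
      have hf := monomial_mem_degLT hdeg (1 : ℂ)
      obtain ⟨w, hw⟩ := ih hf
      have h1 := ih (polyRep_sub_mem Λ hf (genVec i))
      have h2 : (inducingData Λ).top (genVec i) = MvPolynomial.X i := (inducingData Λ).top_vec i
      rw [h2, ← hw, ← polyAct_inc, ← toPoly_smul, hw] at h1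
      have h3 : monomial m (1 : ℂ) = MvPolynomial.X i * monomial m' 1 := by
        rw [MvPolynomial.X, monomial_mul, one_mul, ← hm1]
      change monomial m (1 : ℂ) ∈ _
      rw [h3]
      have h4 := Submodule.sub_mem _ (LinearMap.mem_range_self (toPoly Λ) (inc (genVec i) • w)) h1
      rwa [sub_sub_cancel] at h4

end PrincipalSl2

namespace PrincipalSl2

/-! ### Smoothness of Verma modules -/

theorem exists_forall_lt_coeff_eq_zero (y : gHat) :
    ∃ K : ℤ, 0 ≤ K ∧ ∀ n < -K, coeff n y = 0 := by
  obtain ⟨K, hK⟩ := (loop y).coeff.support.bddBelow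
  refine ⟨|K|, abs_nonneg K, fun n hn => ?_⟩
  by_contra h0
  have h1 := hK (Finset.mem_coe.mpr (Finsupp.mem_support_iff.mpr h0))
  have h2 := neg_abs_le K
  omega

/-- `v` is annihilated by all elements of sufficiently large degree. -/
def IsSmooth {Λ : Module.Dual ℂ cartan} (v : Verma Λ) : Prop :=
  ∃ N : ℤ, ∀ x : gHat, (∀ n < N, coeff n x = 0) → cPart x = 0 → dPart x = 0 → inc x • v = 0

variable {Λ : Module.Dual ℂ cartan}

theorem inc_lie (x y : gHat) : inc ⁅x, y⁆ = inc x * inc y - inc y * inc x :=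
  UniversalEnvelopingAlgebra.ι_lie x y

theorem inc_smul_inc_smul (x y : gHat) (v : Verma Λ) :
    inc x • inc y • v = inc y • inc x • v + inc ⁅x, y⁆ • v := by
  rw [inc_lie, sub_smul, mul_smul, mul_smul, add_sub_cancel]

theorem IsSmooth.smul (u : U) {v : Verma Λ} (hv : IsSmooth v) : IsSmooth (u • v) := by
  induction u using UniversalEnvelopingAlgebra.induction generalizing v with
  | algebraMap r =>
    obtain ⟨N, hN⟩ := hv
    refine ⟨N, fun x h1 h2 h3 => ?_⟩
    rw [← mul_smul, ← Algebra.commutes, mul_smul, hN x h1 h2 h3, smul_zero]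
  | mul a b ha hb => rw [mul_smul]; exact ha (hb hv)
  | add a b ha hb =>
    obtain ⟨N, hN⟩ := ha hv
    obtain ⟨N', hN'⟩ := hb hv
    refine ⟨max N N', fun x h1 h2 h3 => ?_⟩
    rw [add_smul, smul_add, hN x (fun n hn => h1 n (lt_max_of_lt_left hn)) h2 h3,
      hN' x (fun n hn => h1 n (lt_max_of_lt_right hn)) h2 h3, add_zero]
  | ι y =>
    obtain ⟨N, hN⟩ := hv
    obtain ⟨K, hK, hy⟩ := exists_forall_lt_coeff_eq_zero y
    -- With this bound the loop part of ⁅x, y⁆ starts in degree at least max N 1; this is at least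
    -- N, and its positivity removes the central term.
    refine ⟨max N 1 + K, fun x h1 h2 h3 => ?_⟩
    have hx : ∀ n < max N 1 + K, (loop x).coeff n = 0 := h1
    have hy' : ∀ n < -K, (loop y).coeff n = 0 := hy
    rw [inc_smul_inc_smul, hN x (fun n hn => h1 n (by omega)) h2 h3, smul_zero, zero_add]
    refine hN _ (fun n hn => ?_) ?_ (dPart_lie x y)
    · rw [coeff_apply, loop_lie, h3]
      simp only [AddMonoidAlgebra.coeff_add, AddMonoidAlgebra.coeff_sub, Finsupp.add_apply,
        Finsupp.sub_apply, AddMonoidAlgebra.coeff_smul, Finsupp.smul_apply, D_coeff,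
        hx n (by omega), coeff_mul_eq_zero hx hy' (n := n) (by omega),
        coeff_mul_eq_zero hy' hx (n := n) (by omega)]
      simp
    · rw [cPart_lie]
      have hD : ∀ n < max N 1 + K, (D (loop x)).coeff n = 0 := fun n hn => by
        rw [D_coeff, hx n hn, smul_zero]
      change 1 / 2 * ((D (loop x) * loop y).coeff 0).trace = 0
      rw [coeff_mul_eq_zero hD hy' (by omega)]
      simp

theorem isSmooth (v : Verma Λ) : IsSmooth v := by
  obtain ⟨u, rfl⟩ := (vermaIdeal Λ).mkQ_surjective v
  have h1 : (vermaIdeal Λ).mkQ u = u • hwVector Λ := by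
    rw [hwVector, ← map_smul, smul_eq_mul, mul_one]
  rw [h1]
  refine IsSmooth.smul u ⟨1, fun x hx h2 h3 => ?_⟩
  have h4 : IsNonneg x := fun n hn => hx n (by omega)
  have h5 : cartanPart x = 0 :=
    Subtype.ext (by rw [coe_cartanPart, hx 0 one_pos, h2, h3]; simp)
  rw [inc_smul_hwVector Λ h4, h5, map_zero, zero_smul]

theorem exists_forall_X_smul_eq_zero (v : Verma Λ) : ∃ N : ℤ, ∀ n ≥ N, inc (X n) • v = 0 := by
  obtain ⟨N, hN⟩ := isSmooth v
  exact ⟨N, fun n hn => hN _ (fun m hm => by rw [coeff_X, if_neg (by omega)]) (by simp) (by simp)⟩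

/-! ### The commutation relation of `X(ζ)` with itself -/

theorem lie_X_X (m n : ℤ) :
    ⁅X m, X n⁆ =
      ((-1 : ℂ) ^ m) • ((if m + n = 0 then (m : ℂ) else 0) • c - (2 : ℂ) • B (m + n)) := by
  have hloop : loop ⁅X m, X n⁆ = tm (m + n)
      ((if Odd m then f - e else h) * (if Odd n then f - e else h) -
        (if Odd n then f - e else h) * (if Odd m then f - e else h)) := by
    rw [loop_lie, loop_X, loop_X, dPart_X, dPart_X, zero_smul, zero_smul, add_zero, sub_zero,
      AddMonoidAlgebra.single_mul_single, AddMonoidAlgebra.single_mul_single, add_comm n m,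
      ← AddMonoidAlgebra.single_sub]
  have hpow : (-1 : ℂ) ^ m = if Odd m then -1 else 1 := by
    split_ifs with hm
    · exact hm.neg_one_zpow
    · exact (Int.not_odd_iff_even.mp hm).neg_one_zpow
  refine gHat_ext (fun k => ?_) ?_ ?_
  · rw [coeff_apply, hloop, AddMonoidAlgebra.coeff_single, Finsupp.single_apply, map_smul, map_sub,
      map_smul, map_smul, coeff_c, hpow]
    by_cases hmn : Odd (m + n)
    · rw [coeff_B hmn]
      rw [Int.odd_add] at hmn
      by_cases hk : m + n = k
      · rw [if_pos hk, if_pos hk]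
        by_cases hm : Odd m
        · have hn : ¬ Odd n := Int.not_odd_iff_even.mpr (hmn.mp hm)
          rw [if_pos hm, if_neg hn, if_pos hm]
          ext i j
          fin_cases i <;> fin_cases j <;> simp [e, f, h] <;> norm_num
        · have hn : Odd n := Int.not_even_iff_odd.mp fun h => hm (hmn.mpr h)
          rw [if_neg hm, if_pos hn, if_neg hm]
          ext i j
          fin_cases i <;> fin_cases j <;> simp [e, f, h] <;> norm_num
      · rw [if_neg hk, if_neg hk]
        simp
    · have hB : B (m + n) = 0 := by rw [B, dif_neg hmn]
      have hmn' : Odd m ↔ Odd n := by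
        rw [Int.odd_add, ← Int.not_odd_iff_even] at hmn
        tauto
      simp [hB, hmn']
  · rw [cPart_lie, loop_X, loop_X, map_smul, map_sub, map_smul, map_smul, cPart_c, cPart_B, hpow]
    change 1 / 2 * ((D (tm m _) * tm n _).coeff 0).trace = _
    rw [D_tm, AddMonoidAlgebra.single_mul_single, AddMonoidAlgebra.coeff_single,
      Finsupp.single_apply]
    by_cases hmn : m + n = 0
    · have hmn' : Odd m ↔ Odd n := by
        obtain rfl : n = -m := by omega
        exact odd_neg.symm
      rw [if_pos hmn, if_pos hmn]
      by_cases hn : Odd n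
      · simp [hmn', hn, e, f, Matrix.trace_fin_two]
        ring
      · simp [hmn', hn, h, Matrix.trace_fin_two]
        ring
    · simp [hmn]
  · rw [dPart_lie, map_smul, map_sub, map_smul, map_smul]
    simp

/-- For fixed m + n the bracket is (-1)^m times an affine function of m, so its alternating second
difference vanishes. In generating series this is (ζ₁ + ζ₂)² [X(ζ₁), X(ζ₂)] = 0. -/
theorem lie_X_X_relation (m n : ℤ) :
    ⁅X (m - 1 - 1), X n⁆ + ⁅X (m - 1), X (n - 1)⁆ + ⁅X (m - 1), X (n - 1)⁆ +
      ⁅X m, X (n - 1 - 1)⁆ = 0 := by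
  simp only [lie_X_X]
  have e1 : m - 1 - 1 + n = m + (n - 1 - 1) := by ring
  have e2 : m - 1 + (n - 1) = m + (n - 1 - 1) := by ring
  have e3 : (-1 : ℂ) ^ (m - 1) = - (-1) ^ m := by
    rw [zpow_sub_one₀ (by norm_num)]; norm_num
  have e4 : (-1 : ℂ) ^ (m - 1 - 1) = (-1) ^ m := by
    rw [zpow_sub_one₀ (by norm_num), e3]; norm_num
  rw [e1, e2, e3, e4]
  split_ifs <;> push_cast <;> module

/-! ### Convolution with Laurent polynomials -/

section Convolution

variable {p : ℕ} {M : Type*} [AddCommGroup M] [Module ℂ M]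

/-- The translation by `a`. -/
def shift (p : ℕ) (M : Type*) [AddCommGroup M] [Module ℂ M] :
    Multiplicative (Fin p → ℤ) →* Module.End ℂ ((Fin p → ℤ) → M) where
  toFun a :=
    { toFun := fun T i => T (i - a.toAdd)
      map_add' := fun _ _ => rfl
      map_smul' := fun _ _ => rfl }
  map_one' := by
    refine LinearMap.ext fun T => funext fun i => ?_
    change T (i - 0) = T i
    rw [sub_zero]
  map_mul' a b := by
    refine LinearMap.ext fun T => funext fun i => ?_
    change T (i - (a.toAdd + b.toAdd)) = T (i - a.toAdd - b.toAdd)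
    rw [sub_sub]

/-- The convolution of a Laurent polynomial with a family of vectors. -/
def conv (p : ℕ) (M : Type*) [AddCommGroup M] [Module ℂ M] :
    LaurentPoly p →ₐ[ℂ] Module.End ℂ ((Fin p → ℤ) → M) :=
  AddMonoidAlgebra.lift ℂ _ (Fin p → ℤ) (shift p M)

theorem conv_apply (F : LaurentPoly p) (T : (Fin p → ℤ) → M) (i : Fin p → ℤ) :
    conv p M F T i = F.coeff.sum fun a r => r • T (i - a) := by
  rw [conv, AddMonoidAlgebra.lift_apply, Finsupp.sum, LinearMap.sum_apply, Finset.sum_apply]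
  rfl

theorem conv_zeta (k : Fin p) (m : ℤ) (T : (Fin p → ℤ) → M) (i : Fin p → ℤ) :
    conv p M (zeta p k m) T i = T (i - Pi.single k m) := by
  rw [conv_apply, zeta, AddMonoidAlgebra.coeff_single, Finsupp.sum_single_index] <;> simp

/-- `F'` is obtained from `F` by permuting the variables. -/
def Intertwines (M : Type*) [AddCommGroup M] [Module ℂ M] (σ : Equiv.Perm (Fin p))
    (F F' : LaurentPoly p) : Prop :=
  ∀ (T : (Fin p → ℤ) → M) i, conv p M F T (i ∘ σ) = conv p M F' (fun j => T (j ∘ σ)) i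

variable {σ : Equiv.Perm (Fin p)} {F F' G G' : LaurentPoly p}

theorem Intertwines.mul (h1 : Intertwines M σ F F') (h2 : Intertwines M σ G G') :
    Intertwines M σ (F * G) (F' * G') := by
  intro T i
  rw [map_mul, map_mul, Module.End.mul_apply, Module.End.mul_apply, h1]
  exact congrArg (fun S => conv p M F' S i) (funext fun j => h2 T j)

theorem Intertwines.add (h1 : Intertwines M σ F F') (h2 : Intertwines M σ G G') :
    Intertwines M σ (F + G) (F' + G') := by
  intro T i
  rw [map_add, map_add, LinearMap.add_apply, LinearMap.add_apply, Pi.add_apply, Pi.add_apply, h1,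
    h2]

theorem intertwines_one : Intertwines M σ 1 1 := by
  intro T i
  rw [map_one]
  rfl

theorem intertwines_prod {ι : Type*} (s : Finset ι) {F F' : ι → LaurentPoly p}
    (h : ∀ i ∈ s, Intertwines M σ (F i) (F' i)) :
    Intertwines M σ (∏ i ∈ s, F i) (∏ i ∈ s, F' i) := by
  classical
  induction s using Finset.induction_on with
  | empty => exact intertwines_one
  | insert a s ha ih =>
    rw [Finset.prod_insert ha, Finset.prod_insert ha]
    exact (h a (Finset.mem_insert_self a s)).mul
      (ih fun i hi => h i (Finset.mem_insert_of_mem hi))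

theorem intertwines_zeta (k : Fin p) (m : ℤ) :
    Intertwines M σ (zeta p k m) (zeta p (σ k) m) := by
  intro T i
  rw [conv_zeta, conv_zeta]
  congr 1
  ext j
  simp only [Pi.sub_apply, Function.comp_apply, Pi.single_apply, σ.injective.eq_iff]

/-- The factor of `factorPoly` which belongs to a pair of variables. -/
def pairFactor (p : ℕ) (k l : Fin p) : LaurentPoly p :=
  zeta p k (-1) * zeta p l (-1) * (zeta p k 1 + zeta p l 1) ^ 2

theorem pairFactor_comm (k l : Fin p) : pairFactor p k l = pairFactor p l k := by
  rw [pairFactor, pairFactor, mul_comm (zeta p k (-1)), add_comm (zeta p k 1)]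

theorem intertwines_pairFactor (k l : Fin p) :
    Intertwines M σ (pairFactor p k l) (pairFactor p (σ k) (σ l)) := by
  rw [pairFactor, pairFactor, pow_two, pow_two]
  have h := (intertwines_zeta (M := M) (σ := σ) k 1).add (intertwines_zeta l 1)
  exact ((intertwines_zeta k (-1)).mul (intertwines_zeta l (-1))).mul (h.mul h)

theorem factorPoly_eq (p : ℕ) :
    factorPoly p = ∏ kl : Fin p × Fin p with kl.1 < kl.2, pairFactor p kl.1 kl.2 := rfl

theorem pairFactor_dvd {k l : Fin p} (hkl : k < l) : pairFactor p k l ∣ factorPoly p := by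
  rw [factorPoly_eq]
  exact Finset.dvd_prod_of_mem (fun kl : Fin p × Fin p => pairFactor p kl.1 kl.2) (a := (k, l))
    (by simpa using hkl)

theorem exists_forall_mem_support_le (F : LaurentPoly p) (k : Fin p) :
    ∃ A, ∀ a ∈ F.coeff.support, a k ≤ A := by
  obtain ⟨A, hA⟩ := (F.coeff.support.image fun a => a k).bddAbove
  exact ⟨A, fun a ha => hA (Finset.mem_coe.mpr (Finset.mem_image_of_mem (fun a => a k) ha))⟩

theorem intertwines_factorPoly : Intertwines M σ (factorPoly p) (factorPoly p) := by
  have h := intertwines_prod (M := M) (σ := σ)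
    ((Finset.univ : Finset (Fin p × Fin p)).filter (fun kl => kl.1 < kl.2))
    fun kl _ => intertwines_pairFactor kl.1 kl.2
  rwa [Finset.prod_lt_comp_perm (pairFactor p) pairFactor_comm σ] at h

/-- A family of vectors which commutes up to terms annihilated by `(ζ_k + ζ_l)²`, after
multiplication by `factorPoly`, becomes symmetric. -/
theorem conv_factorPoly_comp_swap {k l : Fin p} (hkl : k < l) (T : (Fin p → ℤ) → M)
    (hT : conv p M ((zeta p k 1 + zeta p l 1) ^ 2) (fun i => T (i ∘ Equiv.swap k l) - T i) = 0)
    (i : Fin p → ℤ) :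
    conv p M (factorPoly p) T (i ∘ Equiv.swap k l) = conv p M (factorPoly p) T i := by
  -- The symmetry of `factorPoly` moves the swap onto T; its factor (ζ_k + ζ_l)² then kills the
  -- difference.
  rw [intertwines_factorPoly, ← sub_eq_zero, ← Pi.sub_apply, ← map_sub]
  obtain ⟨F, hF⟩ : (zeta p k 1 + zeta p l 1) ^ 2 ∣ factorPoly p :=
    (dvd_mul_left _ (zeta p k (-1) * zeta p l (-1))).trans (pairFactor_dvd hkl)
  rw [hF, mul_comm, map_mul, Module.End.mul_apply]
  have h0 : ((fun j => T (j ∘ Equiv.swap k l)) - T) = fun i => T (i ∘ Equiv.swap k l) - T i := rfl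
  rw [h0, hT, map_zero]
  rfl

end Convolution

/-! ### Finiteness -/

/-- The vectors `X(i₁) ⋯ X(i_p) v`. -/
def xWord (p : ℕ) (v : Verma Λ) (i : Fin p → ℤ) : Verma Λ :=
  (List.ofFn fun k => inc (X (i k))).prod • v

theorem qpCoeff_smul (p : ℕ) (i : Fin p → ℤ) (v : Verma Λ) :
    qpCoeff p i • v = conv p (Verma Λ) (factorPoly p) (xWord p v) i := by
  rw [conv_apply, qpCoeff, Finsupp.sum, Finset.sum_smul]
  refine Finset.sum_congr rfl fun a _ => ?_
  rw [smul_assoc]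
  rfl

theorem prod_ofFn_eq {W : Type*} [Monoid W] {p : ℕ} (f : Fin p → W) {k l : Fin p}
    (hkl : (k : ℕ) + 1 = l) :
    (List.ofFn f).prod = ((List.ofFn f).take k).prod *
      (f k * f l * ((List.ofFn f).drop (k + 2)).prod) := by
  conv_lhs => rw [← List.take_append_drop k (List.ofFn f), List.prod_append]
  congr 1
  have h1 : (k : ℕ) < (List.ofFn f).length := by simp
  have h2 : (k : ℕ) + 1 < (List.ofFn f).length := by simp [hkl]
  rw [List.drop_eq_getElem_cons h1, List.drop_eq_getElem_cons h2, List.prod_cons, List.prod_cons,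
    mul_assoc, List.getElem_ofFn, List.getElem_ofFn]
  have h3 : (⟨k + 1, hkl ▸ l.2⟩ : Fin p) = l := Fin.ext hkl
  rw [h3]

/-- Exchanging neighbours leaves one commutator between untouched factors. The same a and w serve
all j that agree with i off k and l, so the shifts coming from (ζ_k + ζ_l)² can be added up inside.
-/
theorem xWord_swap_sub (p : ℕ) (v : Verma Λ) {k l : Fin p} (hkl : (k : ℕ) + 1 = l)
    (i : Fin p → ℤ) : ∃ (a : U) (w : Verma Λ), ∀ j : Fin p → ℤ,
      (∀ t, t ≠ k → t ≠ l → j t = i t) → xWord p v (j ∘ Equiv.swap k l) - xWord p v j =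
        - (a • inc ⁅X (j k), X (j l)⁆ • w) := by
  set f := fun t => inc (X (i t))
  refine ⟨((List.ofFn f).take k).prod, ((List.ofFn f).drop (k + 2)).prod • v, fun j hj => ?_⟩
  have key : ∀ j : Fin p → ℤ, (∀ t, t ≠ k → t ≠ l → j t = i t) → xWord p v j =
      ((List.ofFn f).take k).prod • inc (X (j k)) • inc (X (j l)) •
        ((List.ofFn f).drop (k + 2)).prod • v := by
    intro j hj
    rw [xWord, prod_ofFn_eq _ hkl, mul_smul, mul_smul, mul_smul]
    congr 2
    · refine List.ext_getElem (by simp) fun t h1 h2 => ?_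
      simp only [List.length_take, List.length_ofFn, lt_inf_iff] at h1
      rw [List.getElem_take, List.getElem_take, List.getElem_ofFn, List.getElem_ofFn]
      rw [hj]
      · intro h; have := congrArg Fin.val h; simp at this; omega
      · intro h; have := congrArg Fin.val h; simp at this; omega
    · congr 3
      refine List.ext_getElem (by simp) fun t h1 h2 => ?_
      rw [List.getElem_drop, List.getElem_drop, List.getElem_ofFn, List.getElem_ofFn]
      rw [hj]
      · intro h; have := congrArg Fin.val h; simp at this; omega
      · intro h; have := congrArg Fin.val h; simp at this; omega
  rw [key j hj, key (j ∘ Equiv.swap k l) fun t h1 h2 => by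
    rw [Function.comp_apply, Equiv.swap_apply_of_ne_of_ne h1 h2, hj t h1 h2]]
  rw [Function.comp_apply, Function.comp_apply, Equiv.swap_apply_left, Equiv.swap_apply_right,
    inc_smul_inc_smul (X (j k)), smul_add]
  abel

theorem qpCoeff_swap (p : ℕ) (v : Verma Λ) {k l : Fin p} (hkl : (k : ℕ) + 1 = l)
    (i : Fin p → ℤ) : qpCoeff p (i ∘ Equiv.swap k l) • v = qpCoeff p i • v := by
  have hlt : k < l := Fin.lt_def.mpr (by omega)
  rw [qpCoeff_smul, qpCoeff_smul]
  refine conv_factorPoly_comp_swap hlt _ (funext fun i => ?_) i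
  obtain ⟨a, w, h⟩ := xWord_swap_sub p v hkl i
  simp only [pow_two, map_mul, map_add, Module.End.mul_apply, LinearMap.add_apply, Pi.add_apply,
    conv_zeta]
  rw [h, h, h, h]
  · have h1 : ∀ m, (Pi.single k m : Fin p → ℤ) l = 0 := fun m => by
      rw [Pi.single_apply, if_neg hlt.ne']
    have h2 : ∀ m, (Pi.single l m : Fin p → ℤ) k = 0 := fun m => by
      rw [Pi.single_apply, if_neg hlt.ne]
    simp only [Pi.sub_apply, Pi.single_eq_same, h1, h2, sub_zero, Pi.zero_apply]
    have h3 := congrArg (fun x => a • inc x • w) (lie_X_X_relation (i k) (i l))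
    have h4 : ∀ x y : gHat, inc (x + y) = inc x + inc y :=
      map_add (UniversalEnvelopingAlgebra.ι ℂ : gHat →ₗ⁅ℂ⁆ U).toLinearMap
    have h5 : inc (0 : gHat) = 0 :=
      map_zero (UniversalEnvelopingAlgebra.ι ℂ : gHat →ₗ⁅ℂ⁆ U).toLinearMap
    simp only [h4, h5, add_smul, smul_add, zero_smul, smul_zero] at h3
    rw [← neg_eq_zero, ← h3]
    abel
  all_goals
    intro t h1 h2
    simp [h1, h2]

/-- The rightmost operator meets v first and kills it when its index is large; by `qpCoeff_swap` any
index can be moved to that place. -/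
theorem exists_bound_qpCoeff (p : ℕ) (v : Verma Λ) :
    ∃ N : ℤ, ∀ (i : Fin p → ℤ) (k : Fin p), N ≤ i k → qpCoeff p i • v = 0 := by
  rcases p with - | p
  · exact ⟨0, fun i k => k.elim0⟩
  obtain ⟨N, hN⟩ := exists_forall_X_smul_eq_zero v
  obtain ⟨A, hA⟩ := exists_forall_mem_support_le (factorPoly (p + 1)) (Fin.last p)
  refine ⟨N + A, ?_⟩
  have hlast : ∀ i : Fin (p + 1) → ℤ, N + A ≤ i (Fin.last p) → qpCoeff (p + 1) i • v = 0 := by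
    intro i hi
    rw [qpCoeff_smul, conv_apply, Finsupp.sum]
    refine Finset.sum_eq_zero fun a ha => ?_
    have h1 : a (Fin.last p) ≤ A := hA a ha
    rw [xWord, List.ofFn_succ', List.concat_eq_append, List.prod_append, List.prod_singleton,
      mul_smul, hN, smul_zero, smul_zero]
    rw [Pi.sub_apply]
    omega
  have key : ∀ (n : ℕ) (i : Fin (p + 1) → ℤ) (k : Fin (p + 1)), (k : ℕ) + n = p →
      N + A ≤ i k → qpCoeff (p + 1) i • v = 0 := by
    intro n
    induction n with
    | zero =>
      intro i k hk hi
      obtain rfl : k = Fin.last p := Fin.ext (by simpa using hk)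
      exact hlast i hi
    | succ n ih =>
      intro i k hk hi
      have hl : (k : ℕ) + 1 < p + 1 := by omega
      rw [← qpCoeff_swap (p + 1) v (k := k) (l := ⟨k + 1, hl⟩) rfl i]
      refine ih _ ⟨k + 1, hl⟩ (by simp only; omega) ?_
      rwa [Function.comp_apply, Equiv.swap_apply_right]
  exact fun i k hi => key (p - k) i k (by omega) hi

theorem finite_qpCoeff (p : ℕ) (n : ℤ) (v : Verma Λ) :
    {i : Fin p → ℤ | ∑ k, i k = n ∧ qpCoeff p i • v ≠ 0}.Finite := by
  obtain ⟨N, hN⟩ := exists_bound_qpCoeff p v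
  refine (Set.finite_Icc (fun _ => n - p * |N|) (fun _ => N)).subset ?_
  rintro i ⟨hi, hne⟩
  have h1 : ∀ k, i k ≤ N := fun k => le_of_lt (not_le.mp fun h => hne (hN i k h))
  refine ⟨fun k => ?_, h1⟩
  have h2 : ∑ t ∈ Finset.univ.erase k, i t ≤ ∑ t ∈ Finset.univ.erase k, |N| :=
    Finset.sum_le_sum fun t _ => (h1 t).trans (le_abs_self N)
  have h3 := Finset.add_sum_erase Finset.univ i (Finset.mem_univ k)
  rw [Finset.sum_const, Finset.card_erase_of_mem (Finset.mem_univ k), Finset.card_univ,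
    Fintype.card_fin, nsmul_eq_mul] at h2
  have h4 : ((p - 1 : ℕ) : ℤ) * |N| ≤ p * |N| :=
    mul_le_mul_of_nonneg_right (by omega) (abs_nonneg N)
  simp only
  omega

end PrincipalSl2

/-! ### Bases perturbed by terms of lower degree -/

namespace MvPolynomial

variable {K σ ι : Type*} [Field K]

theorem homogeneousComponent_eq_zero_of_mem_degLT {f : MvPolynomial σ K} {d n : ℕ}
    (hf : f ∈ degLT K σ d) (h : d ≤ n) : homogeneousComponent n f = 0 := by
  ext m
  rw [coeff_homogeneousComponent, coeff_zero]
  split_ifs with hm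
  · by_contra h0
    have := mem_degLT_iff.mp hf m h0
    omega
  · rfl

theorem IsHomogeneous.mem_degLT {f : MvPolynomial σ K} {d : ℕ} (hf : f.IsHomogeneous d) :
    f ∈ degLT K σ (d + 1) := by
  rw [mem_degLT_iff]
  intro m hm
  have h := hf hm
  have h' : m.degree = d := by
    rw [Finsupp.degree_eq_weight_one]
    exact h
  omega

/-- A basis of homogeneous polynomials stays a basis after adding terms of lower degree. -/
theorem linearIndependent_and_span_of_sub_mem_degLT (b : Module.Basis ι K (MvPolynomial σ K))
    (d : ι → ℕ) (hb : ∀ i, (b i).IsHomogeneous (d i)) (g : ι → MvPolynomial σ K)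
    (hg : ∀ i, g i - b i ∈ degLT K σ (d i)) :
    LinearIndependent K g ∧ Submodule.span K (Set.range g) = ⊤ := by
  set φ := b.constr K g
  have hφ : ∀ i, φ (b i) = g i := b.constr_basis K g
  have key : ∀ n, ∀ f ∈ degLT K σ (n + 1), φ f - f ∈ degLT K σ n := by
    intro n f hf
    -- By homogeneity of the basis, a component of f of degree above n is the matching part of the
    -- expansion of f; it vanishes, hence so do its coefficients.
    have h1 : ∀ i ∈ (b.repr f).support, d i ≤ n := by
      intro i hi
      by_contra hlt
      have h2 := homogeneousComponent_eq_zero_of_mem_degLT hf (not_le.mp hlt)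
      rw [← b.linearCombination_repr f, Finsupp.linearCombination_apply, Finsupp.sum, map_sum] at h2
      simp only [map_smul, homogeneousComponent_of_mem (hb _), smul_ite, smul_zero] at h2
      rw [← Finset.sum_filter] at h2
      have h3 := (linearIndependent_iff'.mp b.linearIndependent) _ _ h2 i
        (Finset.mem_filter.mpr ⟨hi, rfl⟩)
      exact (Finsupp.mem_support_iff.mp hi) h3
    have h2 : φ f - f = ∑ i ∈ (b.repr f).support, b.repr f i • (g i - b i) := by
      conv_lhs => rw [← b.linearCombination_repr f, Finsupp.linearCombination_apply, Finsupp.sum]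
      simp only [map_sum, map_smul, hφ, smul_sub, Finset.sum_sub_distrib]
    rw [h2]
    exact Submodule.sum_mem _ fun i hi =>
      Submodule.smul_mem _ _ (degLT_mono (h1 i hi) (hg i))
  have hinj : ∀ n, ∀ f ∈ degLT K σ n, φ f = 0 → f = 0 := by
    intro n
    induction n with
    | zero => intro f hf _; rwa [degLT_zero, Submodule.mem_bot] at hf
    | succ n ih =>
      intro f hf h0
      have h1 := key n f hf
      rw [h0, zero_sub] at h1
      exact ih f (neg_mem_iff.mp h1) h0
  have hsurj : ∀ n, degLT K σ n ≤ LinearMap.range φ := by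
    intro n
    induction n with
    | zero => rw [degLT_zero]; exact bot_le
    | succ n ih =>
      intro f hf
      have h1 := Submodule.sub_mem _ (LinearMap.mem_range_self φ f) (ih (key n f hf))
      rwa [sub_sub_cancel] at h1
  have hcomp : g = φ ∘ b := _root_.funext fun i => (hφ i).symm
  constructor
  · rw [hcomp]
    refine b.linearIndependent.map' φ (LinearMap.ker_eq_bot'.mpr fun f hf => ?_)
    obtain ⟨n, hn⟩ := exists_mem_degLT f
    exact hinj n f hn hf
  · rw [hcomp, Set.range_comp, ← Submodule.map_span, b.span_eq, Submodule.map_top, eq_top_iff]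
    intro f _
    obtain ⟨n, hn⟩ := exists_mem_degLT f
    exact hsurj n hn

end MvPolynomial

namespace PrincipalSl2

open MvPolynomial

/-! ### Leading terms -/

/-- `h` is the sum of `g` and terms of degree less than `d`, where `g` has degree at most `d`. -/
def HasTop (d : ℕ) (h g : MvPolynomial (ℕ ⊕ ℕ) ℂ) : Prop :=
  g ∈ degLT ℂ (ℕ ⊕ ℕ) (d + 1) ∧ h - g ∈ degLT ℂ (ℕ ⊕ ℕ) d

theorem HasTop.mem {d : ℕ} {h g : MvPolynomial (ℕ ⊕ ℕ) ℂ} (H : HasTop d h g) :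
    h ∈ degLT ℂ (ℕ ⊕ ℕ) (d + 1) := by
  have := Submodule.add_mem _ (degLT_mono d.le_succ H.2) H.1
  rwa [sub_add_cancel] at this

theorem HasTop.mul_left {d n : ℕ} {h g q p : MvPolynomial (ℕ ⊕ ℕ) ℂ} (H : HasTop d h g)
    (hp : p ∈ degLT ℂ (ℕ ⊕ ℕ) (n + 1)) (hq : q - p * h ∈ degLT ℂ (ℕ ⊕ ℕ) (n + d)) :
    HasTop (n + d) q (p * g) := by
  refine ⟨by simpa only [add_assoc] using mul_mem_degLT hp H.1, ?_⟩
  have := Submodule.add_mem _ hq (mul_mem_degLT hp H.2)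
  rwa [mul_sub, sub_add_sub_cancel] at this

variable (Λ : Module.Dual ℂ cartan)

theorem hasTop_polyRep {d : ℕ} {h g : MvPolynomial (ℕ ⊕ ℕ) ℂ} (H : HasTop d h g) (x : gHat) :
    HasTop (1 + d) (polyRep Λ x h) ((inducingData Λ).top x * g) := by
  refine H.mul_left ((inducingData Λ).top_mem x) ?_
  rw [add_comm]
  exact polyRep_sub_mem Λ H.mem x

theorem hasTop_list {d : ℕ} {h g : MvPolynomial (ℕ ⊕ ℕ) ℂ} (H : HasTop d h g) (l : List gHat) :
    HasTop (l.length + d) (polyAct Λ (l.map inc).prod h)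
      ((l.map (inducingData Λ).top).prod * g) := by
  induction l with
  | nil => simpa using H
  | cons x l ih =>
    rw [List.map_cons, List.prod_cons, List.map_cons, List.prod_cons, map_mul,
      Module.End.mul_apply, polyAct_inc, mul_assoc, List.length_cons, add_comm l.length, add_assoc]
    exact hasTop_polyRep Λ ih x

theorem top_X (n : ℤ) : (inducingData Λ).top (X n) =
    if n < 0 then MvPolynomial.X (Sum.inr (-n - 1).toNat) else 0 := by
  split_ifs with hn
  · have h1 := (inducingData Λ).top_vec (Sum.inr (-n - 1).toNat)
    have h2 : (inducingData Λ).vec (Sum.inr (-n - 1).toNat) = X (-(((-n - 1).toNat : ℤ) + 1)) := rfl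
    have h3 : -(((-n - 1).toNat : ℤ) + 1) = n := by omega
    rwa [h2, h3] at h1
  · have h1 : coord (X n) = 0 := (coord_eq_zero_iff _).mpr fun m hm => by
      rw [coeff_X, if_neg (by omega)]
    change Finsupp.linearCombination ℂ MvPolynomial.X (coord (X n)) = 0
    rw [h1, map_zero]

theorem top_B (a : ℕ) :
    (inducingData Λ).top (B (-(2 * a + 1))) = MvPolynomial.X (Sum.inl a) :=
  (inducingData Λ).top_vec (Sum.inl a)

/-! ### The Laurent polynomial `factorPoly` -/

/-- All exponents of `F` have sum `w`. -/
def HasWeight {p : ℕ} (w : ℤ) (F : LaurentPoly p) : Prop :=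
  ∀ a ∈ F.coeff.support, ∑ k, a k = w

theorem HasWeight.mul {p : ℕ} {w w' : ℤ} {F F' : LaurentPoly p} (h : HasWeight w F)
    (h' : HasWeight w' F') : HasWeight (w + w') (F * F') := by
  classical
  intro a ha
  obtain ⟨b, hb, b', hb', rfl⟩ := Finset.mem_add.mp
    (AddMonoidAlgebra.support_coeff_mul_subset F F' ha)
  simp only [Pi.add_apply, Finset.sum_add_distrib, h b hb, h' b' hb']

theorem HasWeight.add {p : ℕ} {w : ℤ} {F F' : LaurentPoly p} (h : HasWeight w F)
    (h' : HasWeight w F') : HasWeight w (F + F') := by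
  classical
  intro a ha
  rw [AddMonoidAlgebra.coeff_add] at ha
  rcases Finset.mem_union.mp (Finsupp.support_add ha) with ha | ha
  · exact h a ha
  · exact h' a ha

theorem hasWeight_zeta {p : ℕ} (k : Fin p) (m : ℤ) : HasWeight m (zeta p k m) := by
  intro a ha
  rw [zeta, AddMonoidAlgebra.coeff_single] at ha
  rw [Finset.mem_singleton.mp (Finsupp.support_single_subset ha)]
  simp

theorem hasWeight_pairFactor {p : ℕ} (k l : Fin p) : HasWeight 0 (pairFactor p k l) := by
  rw [pairFactor, pow_two]
  have h := (hasWeight_zeta k 1).add (hasWeight_zeta l 1)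
  exact ((hasWeight_zeta k (-1)).mul (hasWeight_zeta l (-1))).mul (h.mul h)

theorem hasWeight_factorPoly (p : ℕ) : HasWeight 0 (factorPoly p) := by
  rw [factorPoly_eq]
  refine Finset.prod_induction _ (HasWeight 0) (fun F F' h h' => by simpa using h.mul h') ?_
    fun kl _ => hasWeight_pairFactor _ _
  intro a ha
  rw [AddMonoidAlgebra.one_def, AddMonoidAlgebra.coeff_single] at ha
  rw [Finset.mem_singleton.mp (Finsupp.support_single_subset ha)]
  simp

/-- The sum of the coefficients. -/
def augmentation (p : ℕ) : LaurentPoly p →ₐ[ℂ] ℂ := AddMonoidAlgebra.lift ℂ ℂ (Fin p → ℤ) 1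

theorem augmentation_apply {p : ℕ} (F : LaurentPoly p) :
    augmentation p F = ∑ a ∈ F.coeff.support, F.coeff a := by
  rw [augmentation, AddMonoidAlgebra.lift_apply, Finsupp.sum]
  simp

/-- At ζ = 1 every pair contributes (1 + 1)² = 4. -/
theorem augmentation_factorPoly_ne_zero (p : ℕ) : augmentation p (factorPoly p) ≠ 0 := by
  have hz : ∀ (k : Fin p) (m : ℤ), augmentation p (zeta p k m) = 1 := by
    intro k m
    rw [augmentation, zeta, AddMonoidAlgebra.lift_single]
    simp
  rw [factorPoly_eq, map_prod]
  refine Finset.prod_ne_zero_iff.mpr fun kl _ => ?_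
  rw [pairFactor, map_mul, map_mul, map_pow, map_add]
  simp only [hz]
  norm_num

/-! ### Leading terms of quasi-particles -/

variable {Λ}

/-- The leading part of the coefficient of `ζⁿ` in the product of `p` copies of `X(ζ)`. -/
theorem sum_top_eq (p N : ℕ) (S : Finset (Fin p → ℤ)) (a : Fin p → ℤ) (ha : ∑ k, a k = 0)
    (hS : ∀ i ∈ S, ∑ k, i k = -p - N)
    (hS' : ∀ i ∈ Finset.piAntidiag (Finset.univ : Finset (Fin p)) N,
      (fun k => a k - (i k + 1)) ∈ S) :
    ∑ i ∈ S, (List.ofFn fun k => (inducingData Λ).top (X (i k - a k))).prod =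
      rename Sum.inr (QuasiParticle.powCoeff p N) := by
  rw [QuasiParticle.powCoeff, map_sum]
  symm
  refine Finset.sum_of_injOn (fun i k => a k - ((i k : ℤ) + 1)) ?_ (fun i hi => hS' i hi) ?_ ?_
  · intro i _ j _ hij
    funext k
    have := congrFun hij k
    simp only at this
    omega
  · intro i hi hni
    -- A word containing an X of nonnegative degree has zero leading part; the other words are those
    -- indexed by `piAntidiag`.
    by_cases hneg : ∀ k, i k - a k < 0
    · exfalso
      refine hni ⟨fun k => (-(i k - a k) - 1).toNat, ?_, ?_⟩
      · rw [Finset.mem_coe, Finset.mem_piAntidiag]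
        refine ⟨?_, fun _ _ => Finset.mem_univ _⟩
        have h1 : ∀ k, (((-(i k - a k) - 1).toNat : ℕ) : ℤ) = a k - i k - 1 := fun k => by
          have := hneg k
          omega
        zify
        simp only [h1, Finset.sum_sub_distrib, ha, hS i hi]
        simp
      · funext k
        have := hneg k
        simp only
        omega
    · push Not at hneg
      obtain ⟨k, hk⟩ := hneg
      rw [List.prod_ofFn, Finset.prod_eq_zero (Finset.mem_univ k)]
      rw [top_X, if_neg (not_lt.mpr hk)]
  · intro i _
    rw [List.prod_ofFn, QuasiParticle.word, map_prod]
    refine Finset.prod_congr rfl fun k _ => ?_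
    have h1 : a k - ((i k : ℤ) + 1) - a k < 0 := by omega
    have h2 : (-(a k - ((i k : ℤ) + 1) - a k) - 1).toNat = i k := by omega
    rw [rename_X, top_X, if_pos h1, h2]

theorem powCoeff_isHomogeneous (p N : ℕ) : (QuasiParticle.powCoeff p N).IsHomogeneous p := by
  refine IsHomogeneous.sum _ _ _ fun i _ => ?_
  have h := IsHomogeneous.prod (Finset.univ : Finset (Fin p))
    (fun k => (MvPolynomial.X (i k) : MvPolynomial ℕ ℂ))
    (fun _ => 1) fun k _ => isHomogeneous_X ℂ (i k)
  rwa [Finset.sum_const, Finset.card_univ, Fintype.card_fin, smul_eq_mul, mul_one] at h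

/-- Since `factorPoly` has weight 0, shifting by any of its monomials preserves the total index;
every monomial thus contributes the same leading part, and only the sum of the coefficients remains.
-/
theorem hasTop_quasi (p N : ℕ) {d : ℕ} {v : Verma Λ} {g : MvPolynomial (ℕ ⊕ ℕ) ℂ}
    (H : HasTop d (toPoly Λ v) g) :
    HasTop (p + d) (toPoly Λ (quasi p (-p - N) v))
      ((augmentation p (factorPoly p) • rename Sum.inr (QuasiParticle.powCoeff p N)) * g) := by
  classical
  have hhom : (rename Sum.inr (QuasiParticle.powCoeff p N) :
      MvPolynomial (ℕ ⊕ ℕ) ℂ).IsHomogeneous p := (powCoeff_isHomogeneous p N).rename_isHomogeneous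
  refine H.mul_left (Submodule.smul_mem _ _ hhom.mem_degLT) ?_
  have hfin := finite_qpCoeff p (-p - N) v
  -- S holds the indices with nonzero action on v and, for each monomial a of `factorPoly`, those
  -- whose shift by a has nonzero leading part, so one finite sum serves both computations.
  set S : Finset (Fin p → ℤ) := hfin.toFinset ∪
    ((factorPoly p).coeff.support ×ˢ Finset.piAntidiag (Finset.univ : Finset (Fin p)) N).image
      (fun q k => q.1 k - ((q.2 k : ℤ) + 1)) with hSdef
  have hS : ∀ i ∈ S, ∑ k, i k = -p - N := by
    intro i hi
    rcases Finset.mem_union.mp hi with hi | hi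
    · exact ((Set.Finite.mem_toFinset hfin).mp hi).1
    · obtain ⟨q, hq, rfl⟩ := Finset.mem_image.mp hi
      obtain ⟨h1, h2⟩ := Finset.mem_product.mp hq
      have h3 := (Finset.mem_piAntidiag.mp h2).1
      rw [Finset.sum_sub_distrib, hasWeight_factorPoly p _ h1, Finset.sum_add_distrib,
        ← Nat.cast_sum, h3]
      simp
      ring
  have hquasi : quasi p (-p - N) v = ∑ i ∈ S, qpCoeff p i • v := by
    rw [quasi]
    refine finsum_mem_eq_sum_of_inter_support_eq _ ?_
    ext i
    simp only [Set.mem_inter_iff, Set.mem_ofPred_eq, Function.mem_support, Finset.mem_coe]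
    refine ⟨fun h => ⟨?_, h.2⟩, fun h => ⟨hS i h.1, h.2⟩⟩
    exact Finset.mem_union_left _ ((Set.Finite.mem_toFinset hfin).mpr h)
  have hword : ∀ i : Fin p → ℤ, toPoly Λ (xWord p v i) -
      (List.ofFn fun k => (inducingData Λ).top (X (i k))).prod * toPoly Λ v ∈
        degLT ℂ (ℕ ⊕ ℕ) (p + d) := by
    intro i
    have h0 : HasTop d (toPoly Λ v) (toPoly Λ v) := ⟨H.mem, by simp⟩
    have h1 := (hasTop_list Λ h0 (List.ofFn fun k => X (i k))).2
    rw [List.length_ofFn, List.map_ofFn, List.map_ofFn, ← toPoly_smul] at h1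
    exact h1
  have hsum : (augmentation p (factorPoly p) • rename Sum.inr (QuasiParticle.powCoeff p N)) *
      toPoly Λ v = ∑ i ∈ S, ∑ a ∈ (factorPoly p).coeff.support, (factorPoly p).coeff a •
        ((List.ofFn fun k => (inducingData Λ).top (X (i k - a k))).prod * toPoly Λ v) := by
    rw [Finset.sum_comm, augmentation_apply, Finset.sum_smul, Finset.sum_mul]
    refine Finset.sum_congr rfl fun a ha => ?_
    rw [← Finset.smul_sum, ← Finset.sum_mul, sum_top_eq p N S a (hasWeight_factorPoly p a ha) hS,
      smul_mul_assoc]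
    intro i hi
    exact Finset.mem_union_right _ (Finset.mem_image.mpr
      ⟨(a, i), Finset.mem_product.mpr ⟨ha, hi⟩, rfl⟩)
  rw [hsum, hquasi, map_sum, ← Finset.sum_sub_distrib]
  refine Submodule.sum_mem _ fun i _ => ?_
  rw [qpCoeff_smul, conv_apply, Finsupp.sum, map_sum, ← Finset.sum_sub_distrib]
  refine Submodule.sum_mem _ fun a _ => ?_
  rw [map_smul, ← smul_sub]
  exact Submodule.smul_mem _ _ (hword (i - a))

end PrincipalSl2

namespace PrincipalSl2

open MvPolynomial QuasiParticle

/-! ### A homogeneous basis of the polynomial ring -/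

/-- A product of variables `B` and of coefficients of powers of the generating function of the
variables `X`. -/
def modelVector (x : ClusterIndex × (ℕ →₀ ℕ)) : MvPolynomial (ℕ ⊕ ℕ) ℂ :=
  rename Sum.inl (monomial x.2 1) * rename Sum.inr x.1.poly

/-- The degree of `modelVector x`. -/
def modelDegree (x : ClusterIndex × (ℕ →₀ ℕ)) : ℕ := x.2.degree + ∑ l, x.1.c l

theorem modelVector_isHomogeneous (x : ClusterIndex × (ℕ →₀ ℕ)) :
    (modelVector x).IsHomogeneous (modelDegree x) := by
  refine IsHomogeneous.mul ?_ ?_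
  · exact (isHomogeneous_monomial _ rfl).rename_isHomogeneous
  · refine IsHomogeneous.rename_isHomogeneous ?_
    exact IsHomogeneous.prod _ _ _ fun l _ => powCoeff_isHomogeneous _ _

/-- The basis of the polynomial ring consisting of the polynomials `modelVector x`. -/
def modelBasis : Module.Basis (ClusterIndex × (ℕ →₀ ℕ)) ℂ (MvPolynomial (ℕ ⊕ ℕ) ℂ) :=
  ((Module.Basis.mk linearIndependent_poly span_poly.ge).smulTower
    (basisMonomials ℕ (MvPolynomial ℕ ℂ))).map (sumAlgEquiv ℂ ℕ ℕ).symm.toLinearEquiv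

theorem modelBasis_apply (x : ClusterIndex × (ℕ →₀ ℕ)) : modelBasis x = modelVector x := by
  rw [modelBasis, Module.Basis.map_apply, Module.Basis.smulTower_apply, Module.Basis.mk_apply,
    coe_basisMonomials]
  refine (sumAlgEquiv ℂ ℕ ℕ).symm_apply_eq.mpr ?_
  have h1 := DFunLike.congr_fun (sumAlgEquiv_comp_rename_inl ℂ ℕ ℕ) (monomial x.2 1)
  have h2 := DFunLike.congr_fun (sumAlgEquiv_comp_rename_inr ℂ ℕ ℕ) x.1.poly
  change sumAlgEquiv ℂ ℕ ℕ (rename Sum.inl _) = _ at h1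
  change sumAlgEquiv ℂ ℕ ℕ (rename Sum.inr _) = _ at h2
  rw [modelVector, map_mul, h1, h2, Algebra.smul_def, mul_comm]
  congr 1
  rw [mapAlgHom_apply]
  simp

/-! ### Indices of basis vectors -/

/-- The indices of a product of operators `B(n)`. -/
def bList (m : ℕ →₀ ℕ) : List ℤ :=
  (m.toMultiset.map fun a : ℕ => -(2 * (a : ℤ) + 1)).sort (· ≤ ·)

/-- The charges and indices of a product of quasi-particles. -/
def qList (x : ClusterIndex) : List (ℕ × ℤ) :=
  List.ofFn fun l => (x.c l, -(x.c l : ℤ) - (x.e l : ℤ))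

theorem admissible_list (x : ClusterIndex) (m : ℕ →₀ ℕ) : Admissible (bList m) (qList x) := by
  obtain ⟨s, c, e, hc, hm, hadm⟩ := x
  have hlen : ∀ l : Fin s, ((s - 1 - l : ℕ) : ℤ) = s - (l + 1) := fun l => by
    have := l.2
    omega
  have hground : ∀ l : Fin s, 2 * (c l : ℤ) * (s - (l + 1)) ≤ e l := fun l => by
    rw [← hlen]
    exact_mod_cast hadm.ground_le l
  refine ⟨Multiset.pairwise_sort _ _, ?_, ?_, ?_, ?_, ?_, ?_⟩
  · intro i hi
    rw [bList, Multiset.mem_sort, Multiset.mem_map] at hi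
    obtain ⟨a, -, rfl⟩ := hi
    exact ⟨odd_genDeg_inl a, by omega⟩
  · intro q hq
    obtain ⟨l, rfl⟩ := List.mem_ofFn.mp hq
    exact hc l
  · rw [qList, List.pairwise_ofFn]
    exact fun i j hij => hm hij.le
  · intro q hq
    obtain ⟨l, rfl⟩ := List.mem_ofFn.mp (List.mem_of_getLast? hq)
    simp only
    omega
  · intro l hl _
    have hls : l + 1 < s := by rwa [qList, List.length_ofFn] at hl
    simp only [qList, List.getElem_ofFn, List.length_ofFn]
    have := hground ⟨l, by omega⟩
    simp only at this
    linarith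
  · intro l hl heq
    have hls : l + 1 < s := by rwa [qList, List.length_ofFn] at hl
    simp only [qList, List.getElem_ofFn] at heq ⊢
    have h1 := hadm.difference ⟨l, by omega⟩ ⟨l + 1, hls⟩ rfl heq
    have h2 : (e ⟨l + 1, hls⟩ : ℤ) + 2 * (c ⟨l, by omega⟩ : ℤ) ≤ e ⟨l, by omega⟩ := by
      exact_mod_cast h1
    rw [← heq]
    linarith

/-- The index of a basis vector. -/
def toIndex (x : ClusterIndex × (ℕ →₀ ℕ)) : BasisIndex :=
  ⟨(bList x.2, qList x.1), admissible_list x.1 x.2⟩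

theorem toIndex_injective : Function.Injective toIndex := by
  rintro ⟨⟨s, c, e, hc, hm, hadm⟩, m⟩ ⟨⟨s', c', e', hc', hm', hadm'⟩, m'⟩ h
  have h1 : bList m = bList m' := congrArg (fun x => x.1.1) h
  have h2 := congrArg (fun x : BasisIndex => x.1.2) h
  simp only [toIndex, qList] at h2
  have hs := congrArg List.length h2
  rw [List.length_ofFn, List.length_ofFn] at hs
  subst hs
  have h3 := List.ofFn_injective h2
  obtain rfl : c = c' := funext fun l => congrArg Prod.fst (congrFun h3 l)
  obtain rfl : e = e' := by
    ext l
    have := congrArg Prod.snd (congrFun h3 l)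
    simp only at this
    omega
  have h4 := congrArg (fun l : List ℤ => (l : Multiset ℤ)) h1
  simp only [bList, Multiset.sort_eq] at h4
  have h5 : Function.Injective fun a : ℕ => -(2 * (a : ℤ) + 1) := fun a b hab => by
    simp only at hab
    omega
  have h6 := Multiset.map_injective h5 h4
  obtain rfl : m = m' := by
    rw [← Finsupp.toMultiset_toFinsupp m, h6, Finsupp.toMultiset_toFinsupp]
  rfl

/-- The bound is given at the end of each block of equal charges, and the difference condition
carries it backwards by twice the charge per step. Thus it holds at every position, as `IsAdm`
demands. -/
theorem Admissible.le {bs : List ℤ} {qs : List (ℕ × ℤ)} (h : Admissible bs qs) (n l : ℕ)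
    (hn : l + 1 + n = qs.length) :
    qs[l].2 ≤ -(qs[l].1 : ℤ) - 2 * (qs[l].1 : ℤ) * n := by
  induction n generalizing l with
  | zero =>
    have h1 := h.last_initial qs[l] (by
      rw [List.getLast?_eq_getElem?, Option.mem_def, List.getElem?_eq_some_iff]
      refine ⟨by omega, ?_⟩
      congr 1
      omega)
    simpa using h1
  | succ n ih =>
    have hl : l + 1 < qs.length := by omega
    have hle : qs[l].1 ≤ qs[l + 1].1 :=
      List.pairwise_iff_getElem.mp h.charge_sorted l (l + 1) (by omega) hl (by omega)
    rcases hle.lt_or_eq with hlt | heq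
    · have h1 := h.initial l hl hlt
      have h2 : (qs.length : ℤ) - (l + 1) = (n + 1 : ℕ) := by omega
      rwa [h2] at h1
    · have h1 := h.difference l hl heq
      have h2 := ih (l + 1) (by omega)
      rw [← heq] at h2
      push_cast
      linarith

theorem toIndex_surjective : Function.Surjective toIndex := by
  rintro ⟨⟨bs, qs⟩, h⟩
  change Admissible bs qs at h
  have hle : ∀ l : Fin qs.length, qs[l].2 ≤ -(qs[l].1 : ℤ) - 2 * (qs[l].1 : ℤ) *
      ((qs.length - 1 - l : ℕ) : ℤ) := fun l => h.le (qs.length - 1 - l) l (by omega)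
  have hnn : ∀ l : Fin qs.length, 0 ≤ 2 * (qs[l].1 : ℤ) * ((qs.length - 1 - l : ℕ) : ℤ) :=
    fun l => by positivity
  let c : Fin qs.length → ℕ := fun l => qs[l].1
  -- The number -j - p is nonnegative by `Admissible.le`, so `toNat` loses nothing.
  let e : Fin qs.length →₀ ℕ := Finsupp.equivFunOnFinite.symm fun l => (-qs[l].2 - qs[l].1).toNat
  have he : ∀ l, (e l : ℤ) = -qs[l].2 - qs[l].1 := fun l => by
    have h1 := hle l
    have h2 := hnn l
    change (((-qs[l].2 - qs[l].1).toNat : ℕ) : ℤ) = _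
    omega
  let x : ClusterIndex :=
    { s := qs.length
      c := c
      e := e
      pos := fun l => h.charge_pos _ (List.getElem_mem _)
      mono := by
        intro l l' hll
        rcases hll.eq_or_lt with rfl | hlt
        · exact le_rfl
        · exact List.pairwise_iff_getElem.mp h.charge_sorted l l' l.2 l'.2 hlt
      adm := by
        refine ⟨fun l => ?_, fun l l' hll hcl => ?_⟩
        · zify
          rw [he]
          have := hle l
          simp only [c]
          push_cast at this
          linarith
        · obtain ⟨l, hl⟩ := l
          obtain ⟨l', hl'⟩ := l'
          obtain rfl : l + 1 = l' := hll
          have h1 := h.difference l hl' hcl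
          have h2 : (qs[l].1 : ℤ) = qs[l + 1].1 := by exact_mod_cast hcl
          zify
          rw [he, he]
          simp only [c, Fin.getElem_fin]
          linarith }
  refine ⟨(x, Multiset.toFinsupp ((bs : Multiset ℤ).map fun i => ((-i - 1) / 2).toNat)), ?_⟩
  refine Subtype.ext (Prod.ext ?_ ?_)
  · change bList _ = bs
    rw [bList, Multiset.toFinsupp_toMultiset, Multiset.map_map]
    have h1 : ((bs : Multiset ℤ).map ((fun a : ℕ => -(2 * (a : ℤ) + 1)) ∘
        fun i : ℤ => ((-i - 1) / 2).toNat)) = bs := by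
      conv_rhs => rw [← Multiset.map_id (bs : Multiset ℤ)]
      refine Multiset.map_congr rfl fun i hi => ?_
      obtain ⟨⟨k, hk⟩, h2⟩ := h.bs_odd i (Multiset.mem_coe.mp hi)
      simp only [Function.comp_apply, id_eq]
      omega
    rw [h1]
    exact List.Perm.eq_of_pairwise' (Multiset.pairwise_sort _ _) h.bs_sorted
      (Multiset.coe_eq_coe.mp (Multiset.sort_eq _ _))
  · change qList x = qs
    refine List.ext_getElem (by simp [qList, x]) fun l h1 h2 => ?_
    simp only [qList, List.getElem_ofFn]
    refine Prod.ext rfl ?_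
    have := he ⟨l, h2⟩
    change -((c ⟨l, h2⟩ : ℕ) : ℤ) - (e ⟨l, h2⟩ : ℤ) = _
    rw [this]
    simp only [c, Fin.getElem_fin]
    ring

/-! ### The basis theorem -/

variable (Λ : Module.Dual ℂ cartan)

theorem hasTop_foldr (L : List (ℕ × ℕ)) :
    HasTop (L.map Prod.fst).sum
      (toPoly Λ ((L.map fun q => (q.1, -(q.1 : ℤ) - (q.2 : ℤ))).foldr
        (fun q v => quasi q.1 q.2 v) (hwVector Λ)))
      (L.map fun q => augmentation q.1 (factorPoly q.1) • rename Sum.inr (powCoeff q.1 q.2)).prod := by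
  induction L with
  | nil =>
    refine ⟨?_, ?_⟩
    · simpa using one_mem_degLT
    · simp [toPoly_hwVector]
  | cons q L ih =>
    simp only [List.map_cons, List.foldr_cons, List.prod_cons, List.sum_cons]
    exact hasTop_quasi q.1 q.2 ih

/-- The factor by which the leading term of a basis vector differs from `modelVector x`. -/
def leadingConst (x : ClusterIndex × (ℕ →₀ ℕ)) : ℂ :=
  ∏ l, augmentation (x.1.c l) (factorPoly (x.1.c l))

theorem leadingConst_ne_zero (x : ClusterIndex × (ℕ →₀ ℕ)) : leadingConst x ≠ 0 :=
  Finset.prod_ne_zero_iff.mpr fun _ _ => augmentation_factorPoly_ne_zero _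

theorem hasTop_basisVector (x : ClusterIndex × (ℕ →₀ ℕ)) :
    HasTop (modelDegree x) (toPoly Λ (basisVector Λ (toIndex x)))
      (leadingConst x • modelVector x) := by
  have h1 := hasTop_foldr Λ (List.ofFn fun l => (x.1.c l, x.1.e l))
  have h2 := hasTop_list Λ h1 ((bList x.2).map B)
  rw [← toPoly_smul] at h2
  have hq : (List.ofFn fun l => (x.1.c l, x.1.e l)).map
      (fun q => (q.1, -(q.1 : ℤ) - (q.2 : ℤ))) = qList x.1 := by
    rw [List.map_ofFn]; rfl
  have hd : ((bList x.2).map B).length +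
      ((List.ofFn fun l => (x.1.c l, x.1.e l)).map Prod.fst).sum = modelDegree x := by
    rw [List.length_map, bList, Multiset.length_sort, Multiset.card_map, Finsupp.card_toMultiset,
      List.map_ofFn, List.sum_ofFn]
    rfl
  have hb : (((bList x.2).map B).map (inducingData Λ).top).prod =
      rename Sum.inl (monomial x.2 1) := by
    rw [List.map_map, ← Multiset.prod_coe, ← Multiset.map_coe, bList, Multiset.sort_eq,
      Multiset.map_map]
    have h3 : (((inducingData Λ).top ∘ B) ∘ fun a : ℕ => -(2 * (a : ℤ) + 1)) =
        fun a => rename Sum.inl (MvPolynomial.X a) := by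
      funext a
      rw [rename_X]
      exact top_B Λ a
    rw [h3, Finsupp.toMultiset_map, Finsupp.prod_toMultiset,
      Finsupp.prod_mapDomain_index (fun _ => pow_zero _) (fun _ _ _ => pow_add _ _ _),
      monomial_eq, C_1, one_mul, Finsupp.prod, Finsupp.prod, map_prod]
    simp only [map_pow]
  have hp : ((List.ofFn fun l => (x.1.c l, x.1.e l)).map fun q =>
      augmentation q.1 (factorPoly q.1) •
        (rename Sum.inr (powCoeff q.1 q.2) : MvPolynomial (ℕ ⊕ ℕ) ℂ)).prod =
      leadingConst x • rename Sum.inr x.1.poly := by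
    rw [List.map_ofFn, List.prod_ofFn, leadingConst, ClusterIndex.poly, clusterProd, map_prod,
      ← Finset.prod_smul]
    rfl
  rw [hq, hd, hb, hp, mul_smul_comm, List.map_map] at h2
  exact h2

/-- The leading terms form a rescaled `modelBasis`, so the perturbation lemma applies to the images
under `toPoly`; the bijection `toIndex` matches the index sets. -/
theorem linearIndependent_and_span_basisVector :
    LinearIndependent ℂ (basisVector Λ) ∧ Submodule.span ℂ (Set.range (basisVector Λ)) = ⊤ := by
  have hb : ∀ x, (modelBasis.isUnitSMul fun x => (leadingConst_ne_zero x).isUnit) x =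
      leadingConst x • modelVector x := fun x => by
    rw [Module.Basis.isUnitSMul_apply, modelBasis_apply]
  obtain ⟨h1, h2⟩ := linearIndependent_and_span_of_sub_mem_degLT
    (modelBasis.isUnitSMul fun x => (leadingConst_ne_zero x).isUnit) modelDegree
    (fun x => by
      rw [hb, smul_eq_C_mul]
      exact (modelVector_isHomogeneous x).C_mul _)
    (fun x => toPoly Λ (basisVector Λ (toIndex x)))
    (fun x => by rw [hb]; exact (hasTop_basisVector Λ x).2)
  let ε := Equiv.ofBijective toIndex ⟨toIndex_injective, toIndex_surjective⟩
  constructor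
  · refine (linearIndependent_equiv ε).mp ?_
    exact LinearIndependent.of_comp (toPoly Λ) h1
  · refine Submodule.map_injective_of_injective (toPoly_injective Λ) ?_
    rw [Submodule.map_top, LinearMap.range_eq_top.mpr (toPoly_surjective Λ), Submodule.map_span,
      ← Set.range_comp, ← h2]
    congr 1
    exact (ε.surjective.range_comp (toPoly Λ ∘ basisVector Λ)).symm

end PrincipalSl2

end

theorem theorem6p3 (Λ : Module.Dual ℂ PrincipalSl2.cartan) (hΛ : Λ PrincipalSl2.dCartan = 0) :
    (∀ (p : ℕ) (n : ℤ) (v : PrincipalSl2.Verma Λ), 1 ≤ p →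
      {i : Fin p → ℤ | ∑ k, i k = n ∧ PrincipalSl2.qpCoeff p i • v ≠ 0}.Finite) ∧
    LinearIndependent ℂ (PrincipalSl2.basisVector Λ) ∧
    Submodule.span ℂ (Set.range (PrincipalSl2.basisVector Λ)) = ⊤ := by
  exact ⟨fun p n v _ => PrincipalSl2.finite_qpCoeff p n v,
    PrincipalSl2.linearIndependent_and_span_basisVector Λ⟩
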